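/- Let $d\ge 1$ be an integer. For a compact set $A\subset\mathbb{R}^\ell$, $s>0$ and $N\in\mathbb{N}$ put $$\mathcal{P}_s(A;N):=\sup_{x_1,\dots,x_N\in A}\ \inf_{y\in A}\sum_{j=1}^N\frac{1}{|y-x_j|^s},\qquad \rho_A(N):=\min_{x_1,\dots,x_N\in A}\ \max_{y\in A}\ \min_{1\le j\le N}|y-x_j|,$$ where repetitions among the $x_j$ are allowed and $|\cdot|$ is the Euclidean norm. Let $\mathcal{H}_d$ be the $d$-dimensional Hausdorff measure normalized by $\mathcal{H}_d([0,1]^d)=1$. A set $A$ is called $d$-admissible if it is one of the following: (i) a strongly convex body in $\mathbb{R}^d$, that is, a nonempty compact convex set $A\subset\mathbb{R}^d$ which is the closure of its interior and whose boundary is a $(d-1)$-dimensional $C^2$-smooth manifold with nowhere vanishing Gaussian curvature; (ii) the unit sphere $\mathbb{S}^d\subset\mathbb{R}^{d+1}$; (iii) a spherical cap $\{x\in\mathbb{S}^d: x\cdot e\ge t\}$ with $e\in\mathbb{S}^d$ and $-1<t<1$. For $s>d$ let $\sigma_{s,d}:=\lim_{N\to\infty}\mathcal{P}_s([0,1]^d;N)/N^{s/d}$.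 Then this limit exists and is a positive real number, and for every set $A$ that is $d$-admissible or equal to $[0,1]^d$ the following holds. For every $s>d$ the limit $\lim_{N\to\infty}\mathcal{P}_s(A;N)/N^{s/d}$ exists and equals $\sigma_{s,d}/\mathcal{H}_d(A)^{s/d}$. Moreover, the following limits exist as positive real numbers and satisfy $$\lim_{s\to\infty}\left(\frac{\sigma_{s,d}}{\mathcal{H}_d(A)^{s/d}}\right)^{1/s}=\lim_{s\to\infty}\left(\lim_{N\to\infty}\frac{\mathcal{P}_s(A;N)}{N^{s/d}}\right)^{1/s}=\frac{1}{\lim_{N\to\infty}N^{1/d}\rho_A(N)}.$$ In particular, for $A=[0,1]^d$, $$\lim_{s\to\infty}\sigma_{s,d}^{1/s}=\frac{1}{\lim_{N\to\infty}N^{1/d}\rho_{[0,1]^d}(N)}=\left(\frac{V_d}{\Gamma_d}\right)^{1/d},$$ where $V_d$ is the volume of the unit ball of $\mathbb{R}^d$ and $\Gamma_d>0$ is the optimal covering density of $\mathbb{R}^d$, i.e. the infimum, over all families $\mathcal{B}$ of closed unit balls that cover $\mathbb{R}^d$ and for which the limit exists, of $$\Delta(\mathcal{B})=\lim_{R\to\infty}\frac{1}{(2R)^d}\sum_{B\in\mathcal{B}}\mathcal{H}_d(B\cap[-R,R]^d).$$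 -/

import Mathlib

open Filter Topology MeasureTheory Metric
open scoped ENNReal

namespace RieszPolarization

noncomputable section

/-- `ℝⁿ` with the Euclidean norm. -/
abbrev E (n : ℕ) : Type := EuclideanSpace ℝ (Fin n)

/-- `P_s(A; ω) = inf_{y ∈ A} ∑_j |y - x_j|^{-s}` for an `N`-point configuration (repetitions
allowed) `ω = (x_1, …, x_N)` in `A`; for `s > 0` a term with `y = x_j` equals `+∞`. -/
def configPolarization {n N : ℕ} (s : ℝ) (A : Set (E n)) (ω : Fin N → A) : ℝ≥0∞ :=
  ⨅ y : A, ∑ j, edist (y : E n) (ω j : E n) ^ (-s)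

/-- The `N`-th Riesz `s`-polarization constant `𝒫_s(A; N)`. -/
def polarization {n : ℕ} (s : ℝ) (A : Set (E n)) (N : ℕ) : ℝ≥0∞ :=
  ⨆ ω : Fin N → A, configPolarization s A ω

/-- `ρ_A(ω) = sup_{y ∈ A} min_j |y - x_j|`. -/
def coveringRadius {n N : ℕ} (A : Set (E n)) (ω : Fin N → A) : ℝ≥0∞ :=
  ⨆ y : A, ⨅ j, edist (y : E n) (ω j : E n)

/-- The best `N`-point covering radius `ρ_A(N)`. -/
def bestCoveringRadius {n : ℕ} (A : Set (E n)) (N : ℕ) : ℝ≥0∞ :=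
  ⨅ ω : Fin N → A, coveringRadius A ω

/-- The sequence `N ↦ 𝒫_s(A; N) / N^{s/d}`. -/
def normalizedPolarization {n : ℕ} (d : ℕ) (s : ℝ) (A : Set (E n)) (N : ℕ) : ℝ≥0∞ :=
  polarization s A N / (N : ℝ≥0∞) ^ (s / d)

/-- `lim_{N → ∞} 𝒫_s(A; N) / N^{s/d}` (meaningful when the limit exists). -/
def polarizationLimit {n : ℕ} (d : ℕ) (s : ℝ) (A : Set (E n)) : ℝ≥0∞ :=
  limUnder atTop (normalizedPolarization d s A)

/-- The cube `[0,1]^d`. -/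
def unitCube (d : ℕ) : Set (E d) := {x | ∀ i, x i ∈ Set.Icc (0 : ℝ) 1}

/-- The constant `σ_{s,d}`: the value for which
`lim_N 𝒫_s(A; N) / N^{s/d} = σ_{s,d} / H_d(A)^{s/d}` with the same `σ_{s,d}` for all `A`,
read off at the cube, where `H_d(A) = 1`. -/
def sigma (d : ℕ) (s : ℝ) : ℝ := (polarizationLimit d s (unitCube d)).toReal

/-- `H_d(A)`, the `d`-dimensional Hausdorff measure normalized by `H_d([0,1]^d) = 1`. -/
def hausdorffVol {n : ℕ} (d : ℕ) (A : Set (E n)) : ℝ :=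
  (Measure.euclideanHausdorffMeasure d A).toReal

/-- The unit normal field `∇F / |∇F|` of the level sets of `F`. -/
def unitNormal {n : ℕ} (F : E n → ℝ) (x : E n) : E n := ‖gradient F x‖⁻¹ • gradient F x

/-- The tangent space at `p` of the level set of `F` through `p` (a regular point). -/
abbrev tangent {n : ℕ} (F : E n → ℝ) (p : E n) : Submodule ℝ (E n) :=
  (Submodule.span ℝ {gradient F p})ᗮ

/-- The shape operator (Weingarten map) at `p` of the level set of `F` through `p`: the derivative
of the unit normal field, as an endomorphism of the tangent space. -/
def shapeOperator {n : ℕ} (F : E n → ℝ) (p : E n) : tangent F p →ₗ[ℝ] tangent F p :=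
  ((tangent F p).orthogonalProjectionOnto ∘L
    (fderiv ℝ (unitNormal F) p ∘L (tangent F p).subtypeL)).toLinearMap

/-- Gaussian curvature (up to the choice of orientation) at `p` of the level set of `F` through `p`:
the product of the principal curvatures. -/
def gaussianCurvature {n : ℕ} (F : E n → ℝ) (p : E n) : ℝ := LinearMap.det (shapeOperator F p)

/-- `S` is a `C²`-smooth embedded hypersurface with nowhere vanishing Gaussian curvature: near each
of its points it is the zero set of a `C²` function without critical points. -/
def IsCurvedHypersurface {n : ℕ} (S : Set (E n)) : Prop :=
  ∀ p ∈ S, ∃ (U : Set (E n)) (F : E n → ℝ), IsOpen U ∧ p ∈ U ∧ ContDiffOn ℝ 2 F U ∧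
    (∀ x ∈ U, gradient F x ≠ 0) ∧ (∀ x ∈ U, x ∈ S ↔ F x = 0) ∧ gaussianCurvature F p ≠ 0

/-- Strongly convex bodies. -/
structure IsStronglyConvexBody {n : ℕ} (A : Set (E n)) : Prop where
  isCompact : IsCompact A
  nonempty : A.Nonempty
  closure_interior : closure (interior A) = A
  convex : Convex ℝ A
  boundary : IsCurvedHypersurface (frontier A)

/-- `d`-admissible subsets of `ℝ^ℓ`: strongly convex bodies in `ℝ^d`, the unit sphere
`𝕊^d ⊂ ℝ^{d+1}`, and spherical caps in `𝕊^d`. -/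
inductive IsAdmissible (d : ℕ) : (ℓ : ℕ) → Set (E ℓ) → Prop
  | stronglyConvex (A : Set (E d)) (hA : IsStronglyConvexBody A) : IsAdmissible d d A
  | sphere : IsAdmissible d (d + 1) (Metric.sphere 0 1)
  | cap (e : E (d + 1)) (he : ‖e‖ = 1) (t : ℝ) (ht : -1 < t) (ht' : t < 1) :
      IsAdmissible d (d + 1) {x | x ∈ Metric.sphere (0 : E (d + 1)) 1 ∧ t ≤ inner ℝ e x}

/-- `A` is `d`-admissible or `A = [0,1]^d`. -/
inductive IsAdmissibleOrCube (d : ℕ) : (ℓ : ℕ) → Set (E ℓ) → Prop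
  | admissible (ℓ : ℕ) (A : Set (E ℓ)) (hA : IsAdmissible d ℓ A) : IsAdmissibleOrCube d ℓ A
  | cube : IsAdmissibleOrCube d d (unitCube d)

/-- The cube `[-R,R]^d`. -/
def cube (d : ℕ) (R : ℝ) : Set (E d) := {x | ∀ i, x i ∈ Set.Icc (-R) R}

/-- The family of closed unit balls with centers in `C` has density `δ`. -/
def HasBallDensity {d : ℕ} (C : Set (E d)) (δ : ℝ≥0∞) : Prop :=
  Tendsto (fun R : ℝ => (∑' x : C, volume (closedBall (x : E d) 1 ∩ cube d R)) /
    ENNReal.ofReal ((2 * R) ^ d)) atTop (𝓝 δ)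

/-- The optimal covering density `Γ_d` of `ℝ^d`: the infimum of the densities of families of unit
balls that cover `ℝ^d` and have a density. -/
def coveringDensity (d : ℕ) : ℝ :=
  (sInf {δ : ℝ≥0∞ | ∃ C : Set (E d),
    (⋃ x ∈ C, closedBall x 1) = Set.univ ∧ HasBallDensity C δ}).toReal

/-- `V_d = H_d(𝔹^d)`, the volume of the unit ball. -/
def ballVolume (d : ℕ) : ℝ := hausdorffVol d (closedBall (0 : E d) 1)

end

end RieszPolarization

open RieszPolarization

/-!
Up to an `s`-th root, `𝒫_s(A; N)` is the largest possible value, over all configurations of `N`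
points `x_j` of `A`, of the infimum over `y ∈ A` of the `ℓ^s` norm of the numbers `1 / |y - x_j|`.
For the `ℓ^∞` norm the same expression is `1 / ρ_A(N)`, so one functional, depending on an exponent
`p ∈ (d, ∞]`, accounts for polarization and for covering.

Cutting the cube into `n ^ d` smaller ones shows that this functional grows at least like `N^{1/d}`,
so that on the cube the normalized values converge to their supremum `cubeConst p d`; comparing with
an integral bounds it when `p > d`. Up to a small part of its measure, an admissible set is covered
by nearly similar images of small cubes, and it contains disjoint such images. Distributing points
over the former bounds its constant from below, and the pigeonhole principle applied to the latter
bounds it from above, by the same number `cubeConst p d / H_d(A)^{1/d}`.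

As `p → ∞`, a configuration with a large `ℓ^p` value covers almost everything: separated points that
it leaves uncovered are few, and once they are added, the configuration is a covering. Hence
`cubeConst p d → cubeConst ∞ d`. Finally, coverings of the cube extend periodically to coverings of
`ℝ^d`, and coverings of `ℝ^d` restrict to large cubes, which turns `cubeConst ∞ d` into the optimal
covering density.
-/

namespace RieszPolarization

open scoped NNReal

/-- The `ℓ^p` norm of a family of extended nonnegative numbers, for `p ∈ (0, ∞]`. Riesz sums
(`p = s`) and covering radii (`p = ∞`) are treated at once through it. -/
noncomputable def lpSum {ι : Type*} (p : ℝ≥0∞) (f : ι → ℝ≥0∞) : ℝ≥0∞ :=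
  if p = ∞ then ⨆ i, f i else (∑' i, f i ^ p.toReal) ^ p.toReal⁻¹

section LpSum

variable {ι κ : Type*} {p : ℝ≥0∞} {f g : ι → ℝ≥0∞}

theorem lpSum_top (f : ι → ℝ≥0∞) : lpSum ∞ f = ⨆ i, f i := if_pos rfl

theorem lpSum_of_ne_top (hp : p ≠ ∞) (f : ι → ℝ≥0∞) :
    lpSum p f = (∑' i, f i ^ p.toReal) ^ p.toReal⁻¹ := if_neg hp

theorem lpSum_mono (h : ∀ i, f i ≤ g i) : lpSum p f ≤ lpSum p g := by
  rcases eq_or_ne p ∞ with rfl | hp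
  · simpa only [lpSum_top] using iSup_mono h
  · simp only [lpSum_of_ne_top hp]
    gcongr with i
    exact h i

theorem lpSum_const_mul (hp : p ≠ 0) (c : ℝ≥0∞) (f : ι → ℝ≥0∞) :
    lpSum p (fun i => c * f i) = c * lpSum p f := by
  rcases eq_or_ne p ∞ with rfl | hp'
  · simp only [lpSum_top, ENNReal.mul_iSup]
  · have hpos := ENNReal.toReal_pos hp hp'
    simp only [lpSum_of_ne_top hp', ENNReal.mul_rpow_of_nonneg _ _ hpos.le, ENNReal.tsum_mul_left,
      ENNReal.mul_rpow_of_nonneg _ _ (inv_nonneg.2 hpos.le), ENNReal.rpow_rpow_inv hpos.ne']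

theorem lpSum_comp_le (f : ι → ℝ≥0∞) {e : κ → ι} (he : Function.Injective e) :
    lpSum p (fun k => f (e k)) ≤ lpSum p f := by
  rcases eq_or_ne p ∞ with rfl | hp
  · simpa only [lpSum_top] using iSup_comp_le f e
  · simp only [lpSum_of_ne_top hp]
    gcongr
    exact ENNReal.tsum_comp_le_tsum_of_injective he fun i => f i ^ p.toReal

theorem lpSum_le_add_compl (hp : 1 ≤ p) (f : ι → ℝ≥0∞) (s : Set ι) :
    lpSum p f ≤ lpSum p (fun i : s => f i) + lpSum p (fun i : (sᶜ : Set ι) => f i) := by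
  rcases eq_or_ne p ∞ with rfl | hp'
  · simp only [lpSum_top]
    refine iSup_le fun i => ?_
    by_cases hi : i ∈ s
    · exact (le_iSup (fun i : s => f i) ⟨i, hi⟩).trans le_self_add
    · exact (le_iSup (fun i : (sᶜ : Set ι) => f i) ⟨i, hi⟩).trans le_add_self
  · have hp_real : 1 ≤ p.toReal := by
      simpa only [ENNReal.toReal_one] using ENNReal.toReal_mono hp' hp
    simp only [lpSum_of_ne_top hp', ← ENNReal.summable.tsum_add_tsum_compl (s := s)
      ENNReal.summable]
    exact ENNReal.rpow_add_le_add_rpow _ _ (by positivity) (inv_le_one_of_one_le₀ hp_real)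

theorem lpSum_le_card [Fintype ι] (hp : p ≠ 0) {c : ℝ≥0∞} (h : ∀ i, f i ≤ c) :
    lpSum p f ≤ (Fintype.card ι : ℝ≥0∞) ^ p.toReal⁻¹ * c := by
  rcases eq_or_ne p ∞ with rfl | hp'
  · simpa [lpSum_top] using h
  · have hpos := ENNReal.toReal_pos hp hp'
    calc lpSum p f ≤ (∑' _ : ι, c ^ p.toReal) ^ p.toReal⁻¹ := by
          rw [lpSum_of_ne_top hp']
          gcongr with i
          exact h i
      _ = (Fintype.card ι : ℝ≥0∞) ^ p.toReal⁻¹ * c := by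
          rw [tsum_fintype, Finset.sum_const, Finset.card_univ, nsmul_eq_mul,
            ENNReal.mul_rpow_of_nonneg _ _ (by positivity), ENNReal.rpow_rpow_inv hpos.ne']

theorem le_lpSum (hp : p ≠ 0) (f : ι → ℝ≥0∞) (i : ι) : f i ≤ lpSum p f := by
  rcases eq_or_ne p ∞ with rfl | hp'
  · exact (le_iSup f i).trans_eq (lpSum_top f).symm
  · have hpos := ENNReal.toReal_pos hp hp'
    rw [lpSum_of_ne_top hp', ENNReal.le_rpow_inv_iff hpos]
    exact ENNReal.le_tsum (f := fun i => f i ^ p.toReal) i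

end LpSum

/-- The `N`-point polarization constant of `A` for the `ℓ^p` norm of the reciprocal distances: the
`p`-th root of `𝒫_p(A; N)` if `p` is finite, and `1 / ρ_A(N)` if `p = ∞`. -/
noncomputable def lpPolarization {X : Type*} [PseudoEMetricSpace X] (p : ℝ≥0∞) (A : Set X)
    (N : ℕ) : ℝ≥0∞ :=
  ⨆ ω : Fin N → A, ⨅ y : A, lpSum p fun j => (edist (y : X) (ω j))⁻¹

theorem polarization_eq_rpow {n : ℕ} {s : ℝ} (hs : 0 < s) (A : Set (E n)) (N : ℕ) :
    polarization s A N = lpPolarization (ENNReal.ofReal s) A N ^ s := by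
  rw [lpPolarization, ← ENNReal.orderIsoRpow_apply s hs, OrderIso.map_iSup, polarization]
  congr! 2 with ω
  rw [OrderIso.map_iInf, configPolarization]
  congr! 2 with y
  rw [lpSum_of_ne_top ENNReal.ofReal_ne_top, ENNReal.toReal_ofReal hs.le,
    ENNReal.orderIsoRpow_apply, ENNReal.rpow_inv_rpow hs.ne', tsum_fintype]
  congr! 1 with j
  rw [ENNReal.rpow_neg, ENNReal.inv_rpow]

theorem bestCoveringRadius_eq_inv {n : ℕ} (A : Set (E n)) (N : ℕ) :
    bestCoveringRadius A N = (lpPolarization ∞ A N)⁻¹ := by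
  simp only [bestCoveringRadius, coveringRadius, lpPolarization, lpSum_top, ENNReal.inv_iSup,
    ENNReal.inv_iInf, inv_inv]

section LpPolarization

variable {X Y : Type*} [PseudoEMetricSpace X] [PseudoEMetricSpace Y] {ι : Type*} {p : ℝ≥0∞}
  {A : Set X} {K : Set Y} {N : ℕ}

theorem le_lpPolarization [Fintype ι] (hA : A.Nonempty) (hN : Fintype.card ι ≤ N) (ω : ι → A) :
    ⨅ y : A, lpSum p (fun j => (edist (y : X) (ω j))⁻¹) ≤ lpPolarization p A N := by
  obtain ⟨e⟩ : Nonempty (ι ↪ Fin N) :=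
    Function.Embedding.nonempty_of_card_le (by rwa [Fintype.card_fin])
  refine le_iSup_of_le (Function.extend e ω fun _ => ⟨_, hA.some_mem⟩) (iInf_mono fun y => ?_)
  refine le_of_eq_of_le ?_ (lpSum_comp_le _ e.injective)
  simp only [e.injective.extend_apply]

theorem exists_config_of_lt_lpPolarization {v : ℝ≥0∞} (h : v < lpPolarization p A N) :
    ∃ ω : Fin N → A, ∀ y ∈ A, v ≤ lpSum p (fun j => (edist y (ω j : X))⁻¹) := by
  rw [lpPolarization, lt_iSup_iff] at h
  obtain ⟨ω, hω⟩ := h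
  rw [lt_iInf_iff] at hω
  obtain ⟨b, hvb, hb⟩ := hω
  exact ⟨ω, fun y hy => hvb.le.trans (hb ⟨y, hy⟩)⟩

theorem lpPolarization_mono (hA : A.Nonempty) : Monotone (lpPolarization p A) := fun M N hMN =>
  iSup_le fun ω => le_lpPolarization hA (by rwa [Fintype.card_fin]) ω

theorem lpPolarization_zero (hp : p ≠ 0) (hA : A.Nonempty) : lpPolarization p A 0 = 0 := by
  refine le_antisymm (iSup_le fun ω => iInf_le_of_le ⟨_, hA.some_mem⟩ ?_) zero_le
  exact (lpSum_le_card (c := 0) hp fun i => i.elim0).trans_eq (mul_zero _)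

theorem lpPolarization_top_le (hp : p ≠ 0) (A : Set X) (N : ℕ) :
    lpPolarization ∞ A N ≤ lpPolarization p A N := by
  refine iSup_mono fun ω => iInf_mono fun y => ?_
  rw [lpSum_top]
  exact iSup_le (le_lpSum hp _)

/-- The maps `f i` send `K` into `A` so that every point of `A` is at least as close, up to the
factor `L i` for some `i`, to the image of each point of `K` as some `u ∈ K` is to that point.
Optimal configurations of `K` are transported by the `f i` to a good configuration of `A`. -/
structure IsImageCover (K : Set Y) (A : Set X) (f : ι → Y → X) (L : ι → ℝ≥0) : Prop where
  pos : ∀ i, 0 < L i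
  mapsTo : ∀ i, Set.MapsTo (f i) K A
  exists_edist_le : ∀ y ∈ A, ∃ i, ∃ u ∈ K, ∀ x ∈ K, edist y (f i x) ≤ L i * edist u x

/-- The maps `g i` send `K` into parts of `A` that see the points of `A` outside the pairwise
disjoint sets `W i` only from a distance `δ`, and the points inside `W i` as points of `K`, up to
the factor `l i`. Every configuration of `A` thus restricts to one of `K` for each `i`. -/
structure IsImagePacking (K : Set Y) (A : Set X) (g : ι → Y → X) (W : ι → Set X)
    (l : ι → ℝ≥0) (δ : ℝ≥0) : Prop where
  delta_pos : 0 < δ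
  pos : ∀ i, 0 < l i
  mapsTo : ∀ i, Set.MapsTo (g i) K A
  pairwise_disjoint : Pairwise (Function.onFun Disjoint W)
  le_edist : ∀ i, ∀ u ∈ K, ∀ z ∈ A, z ∉ W i → δ ≤ edist (g i u) z
  exists_le_edist : ∀ i, ∀ z ∈ A, z ∈ W i → ∃ x ∈ K, ∀ u ∈ K, l i * edist u x ≤ edist (g i u) z

theorem IsImageCover.le_lpPolarization [Fintype ι] {f : ι → Y → X} {L : ι → ℝ≥0}
    (h : IsImageCover K A f L) (hp : p ≠ 0) (hA : A.Nonempty) {m : ι → ℕ} (hm : ∑ i, m i ≤ N) :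
    ⨅ i, (L i : ℝ≥0∞)⁻¹ * lpPolarization p K (m i) ≤ lpPolarization p A N := by
  refine le_of_forall_lt fun v hv => ?_
  obtain ⟨v', hvv', hv'⟩ := exists_between hv
  have hL (i : ι) : (L i : ℝ≥0∞) ≠ 0 := ENNReal.coe_ne_zero.2 (h.pos i).ne'
  have hlt (i : ι) : L i * v' < lpPolarization p K (m i) := by
    have hi := hv'.trans_le (iInf_le _ i)
    rwa [mul_comm, ← div_eq_mul_inv, ENNReal.lt_div_iff_mul_lt (.inl (hL i))
      (.inl ENNReal.coe_ne_top), mul_comm] at hi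
  choose ω hω using fun i => exists_config_of_lt_lpPolarization (hlt i)
  let ω' : (Σ i, Fin (m i)) → A := fun j => ⟨f j.1 (ω j.1 j.2), h.mapsTo j.1 (ω j.1 j.2).2⟩
  refine hvv'.trans_le (le_trans (le_iInf fun y => ?_)
    (RieszPolarization.le_lpPolarization hA (by simpa using hm) ω'))
  obtain ⟨i, u, hu, hyu⟩ := h.exists_edist_le y y.2
  calc v' = (L i : ℝ≥0∞)⁻¹ * (L i * v') := by
        rw [← mul_assoc, ENNReal.inv_mul_cancel (hL i) ENNReal.coe_ne_top, one_mul]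
    _ ≤ (L i : ℝ≥0∞)⁻¹ * lpSum p (fun j => (edist u (ω i j : Y))⁻¹) := by gcongr; exact hω i u hu
    _ ≤ lpSum p (fun j => (edist (y : X) (ω' ⟨i, j⟩))⁻¹) := by
        rw [← lpSum_const_mul hp]
        refine lpSum_mono fun j => ?_
        rw [← ENNReal.mul_inv (.inl (hL i)) (.inl ENNReal.coe_ne_top)]
        exact ENNReal.inv_le_inv.2 (hyu _ (ω i j).2)
    _ ≤ lpSum p (fun j => (edist (y : X) (ω' j))⁻¹) :=
        lpSum_comp_le (fun j => (edist (y : X) (ω' j))⁻¹) sigma_mk_injective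

namespace IsImagePacking

variable {g : ι → Y → X} {W : ι → Set X} {l : ι → ℝ≥0} {δ : ℝ≥0}

theorem iInf_lpSum_le (h : IsImagePacking K A g W l δ) (hp : 1 ≤ p) (hK : K.Nonempty)
    (ω : Fin N → A) (i : ι) :
    ⨅ y : A, lpSum p (fun j => (edist (y : X) (ω j))⁻¹) ≤
      (l i : ℝ≥0∞)⁻¹ * lpPolarization p K (Nat.card {j | (ω j : X) ∈ W i}) +
        (N : ℝ≥0∞) ^ p.toReal⁻¹ * (δ : ℝ≥0∞)⁻¹ := by
  classical
  have hp₀ : p ≠ 0 := (one_pos.trans_le hp).ne'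
  have hl : (l i : ℝ≥0∞) ≠ 0 := ENNReal.coe_ne_zero.2 (h.pos i).ne'
  set s : Set (Fin N) := {j | (ω j : X) ∈ W i}
  choose x hxK hx using fun j : s => h.exists_le_edist i (ω j) (ω j).2 j.2
  have key (u : K) : ⨅ y : A, lpSum p (fun j => (edist (y : X) (ω j))⁻¹) ≤
      (l i : ℝ≥0∞)⁻¹ * lpSum p (fun j : s => (edist (u : Y) (x j))⁻¹) +
        (N : ℝ≥0∞) ^ p.toReal⁻¹ * (δ : ℝ≥0∞)⁻¹ := by
    refine (iInf_le _ ⟨g i u, h.mapsTo i u.2⟩).trans ((lpSum_le_add_compl hp _ s).trans ?_)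
    rw [← lpSum_const_mul hp₀]
    gcongr
    · refine lpSum_mono fun j => ?_
      rw [← ENNReal.mul_inv (.inl hl) (.inl ENNReal.coe_ne_top)]
      exact ENNReal.inv_le_inv.2 (hx j u u.2)
    · have hfar (j : (sᶜ : Set (Fin N))) : (edist (g i u) (ω j : X))⁻¹ ≤ (δ : ℝ≥0∞)⁻¹ :=
        ENNReal.inv_le_inv.2 (h.le_edist i u u.2 _ (ω j).2 j.2)
      refine (lpSum_le_card hp₀ hfar).trans ?_
      gcongr
      exact (Fintype.card_subtype_le _).trans_eq (Fintype.card_fin N)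
  have := hK.to_subtype
  calc _ ≤ (l i : ℝ≥0∞)⁻¹ * (⨅ u : K, lpSum p (fun j : s => (edist (u : Y) (x j))⁻¹)) +
        (N : ℝ≥0∞) ^ p.toReal⁻¹ * (δ : ℝ≥0∞)⁻¹ := by
        rw [ENNReal.mul_iInf_of_ne (ENNReal.inv_ne_zero.2 ENNReal.coe_ne_top)
          (ENNReal.inv_ne_top.2 hl), ENNReal.iInf_add]
        exact le_iInf key
    _ ≤ _ := by
        gcongr
        exact le_lpPolarization hK Nat.card_eq_fintype_card.ge fun j => ⟨x j, hxK j⟩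

theorem sum_card_le [Fintype ι] (h : IsImagePacking K A g W l δ) (ω : Fin N → A) :
    ∑ i, Nat.card {j | (ω j : X) ∈ W i} ≤ N := by
  classical
  simp only [Nat.card_eq_fintype_card, ← Set.toFinset_card]
  rw [← Finset.card_biUnion]
  · exact (Finset.card_le_univ _).trans_eq (Fintype.card_fin N)
  · intro i _ i' _ hii'
    refine Set.disjoint_toFinset.2 ?_
    exact Set.disjoint_left.2 fun j hj hj' =>
      Set.disjoint_left.1 (h.pairwise_disjoint hii') hj hj'

theorem exists_card_mul_le [Fintype ι] [Nonempty ι] (h : IsImagePacking K A g W l δ) (d : ℕ)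
    (ω : Fin N → A) :
    ∃ i, (Nat.card {j | (ω j : X) ∈ W i} : ℝ≥0) * ∑ k, l k ^ d ≤ N * l i ^ d := by
  by_contra! hlt
  have hsum := Finset.sum_lt_sum_of_nonempty Finset.univ_nonempty fun i _ => hlt i
  rw [← Finset.sum_mul, ← Finset.mul_sum] at hsum
  have hN : (∑ i, (Nat.card {j | (ω j : X) ∈ W i} : ℝ≥0)) ≤ N := mod_cast h.sum_card_le ω
  exact hsum.not_ge (by gcongr)

/-- By the pigeonhole principle some image of `K` receives at most its share of the points. -/
theorem lpPolarization_le [Fintype ι] [Nonempty ι] (h : IsImagePacking K A g W l δ) (hp : 1 ≤ p)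
    (hK : K.Nonempty) {d : ℕ} (hd : d ≠ 0) {τ : ℝ≥0∞}
    (hτ : ∀ m : ℕ, lpPolarization p K m ≤ τ * (m : ℝ≥0∞) ^ (1 / (d : ℝ))) :
    lpPolarization p A N ≤
      τ * ((N : ℝ≥0∞) / ((∑ i, l i ^ d : ℝ≥0) : ℝ≥0∞)) ^ (1 / (d : ℝ)) +
        (N : ℝ≥0∞) ^ p.toReal⁻¹ * (δ : ℝ≥0∞)⁻¹ := by
  refine iSup_le fun ω => ?_
  obtain ⟨i, hi⟩ := h.exists_card_mul_le d ω
  set m := Nat.card {j | (ω j : X) ∈ W i}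
  set T := ∑ k, l k ^ d
  have hT : (T : ℝ≥0∞) ≠ 0 :=
    ENNReal.coe_ne_zero.2 (Finset.sum_pos (fun k _ => pow_pos (h.pos k) d)
      Finset.univ_nonempty).ne'
  have hl : (l i : ℝ≥0∞) ≠ 0 := ENNReal.coe_ne_zero.2 (h.pos i).ne'
  have hm : (m : ℝ≥0∞) ≤ (l i : ℝ≥0∞) ^ d * (N / T) := by
    rw [← mul_div_assoc, ENNReal.le_div_iff_mul_le (.inl hT) (.inl ENNReal.coe_ne_top), mul_comm
      _ (N : ℝ≥0∞)]
    exact mod_cast hi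
  have hroot : (m : ℝ≥0∞) ^ (1 / (d : ℝ)) ≤ l i * ((N : ℝ≥0∞) / T) ^ (1 / (d : ℝ)) := by
    refine (ENNReal.rpow_le_rpow hm (by positivity)).trans_eq ?_
    rw [ENNReal.mul_rpow_of_nonneg _ _ (by positivity), one_div, ENNReal.pow_rpow_inv_natCast hd]
  refine (h.iInf_lpSum_le hp hK ω i).trans ?_
  gcongr ?_ + _
  calc (l i : ℝ≥0∞)⁻¹ * lpPolarization p K m
      ≤ (l i : ℝ≥0∞)⁻¹ * (τ * (l i * ((N : ℝ≥0∞) / T) ^ (1 / (d : ℝ)))) := by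
        gcongr
        exact (hτ m).trans (by gcongr)
    _ = τ * ((N : ℝ≥0∞) / T) ^ (1 / (d : ℝ)) := by
        rw [mul_left_comm τ, ← mul_assoc, ENNReal.inv_mul_cancel hl ENNReal.coe_ne_top, one_mul]

end IsImagePacking

end LpPolarization

section Growth

variable {F : ℕ → ℝ≥0∞}

theorem div_rpow_eq_mul_div_rpow {α : ℝ} (hα : 0 ≤ α) {m : ℕ} (hm : m ≠ 0) (x : ℝ≥0∞) (n : ℕ) :
    x / (n : ℝ≥0∞) ^ α = x / (m : ℝ≥0∞) ^ α * ((m : ℝ≥0∞) / n) ^ α := by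
  have hm₀ : (m : ℝ≥0∞) ^ α ≠ 0 := by simp [ENNReal.rpow_eq_zero_iff, hm]
  have hm_top : (m : ℝ≥0∞) ^ α ≠ ∞ := ENNReal.rpow_ne_top_of_nonneg hα (ENNReal.natCast_ne_top m)
  rw [ENNReal.div_rpow_of_nonneg _ _ hα, ← mul_div_assoc, ENNReal.div_mul_cancel hm₀ hm_top]

theorem tendsto_floor_mul_div_rpow {α : ℝ} (hα : 0 ≤ α) {c : ℝ≥0∞}
    (h : Tendsto (fun N : ℕ => F N / (N : ℝ≥0∞) ^ α) atTop (𝓝 c)) {a : ℝ} (ha : 0 < a) :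
    Tendsto (fun N : ℕ => F ⌊a * N⌋₊ / (N : ℝ≥0∞) ^ α) atTop (𝓝 (c * ENNReal.ofReal a ^ α)) := by
  have hfloor : Tendsto (fun N : ℕ => ⌊a * N⌋₊) atTop atTop := tendsto_nat_floor_mul_atTop a ha
  have hratio : Tendsto (fun N : ℕ => (⌊a * N⌋₊ : ℝ≥0∞) / N) atTop (𝓝 (ENNReal.ofReal a)) := by
    refine (ENNReal.tendsto_ofReal ((tendsto_nat_floor_mul_div_atTop ha.le).comp
      tendsto_natCast_atTop_atTop)).congr' ?_
    filter_upwards [eventually_gt_atTop 0] with N hN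
    rw [Function.comp_apply, ENNReal.ofReal_div_of_pos (by exact_mod_cast hN),
      ENNReal.ofReal_natCast, ENNReal.ofReal_natCast]
  have hα_pos : ENNReal.ofReal a ^ α ≠ 0 := by
    simp [ENNReal.rpow_eq_zero_iff, ha]
  have hα_top : ENNReal.ofReal a ^ α ≠ ∞ := ENNReal.rpow_ne_top_of_nonneg hα ENNReal.ofReal_ne_top
  refine (ENNReal.Tendsto.mul (h.comp hfloor) (.inr hα_top)
    ((ENNReal.continuous_rpow_const.tendsto _).comp hratio) (.inl hα_pos)).congr' ?_
  filter_upwards [hfloor.eventually_gt_atTop 0] with N hN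
  exact (div_rpow_eq_mul_div_rpow hα hN.ne' _ _).symm

theorem floor_rpow_one_div_pow_mul_le {d M N : ℕ} (hd : d ≠ 0) (hM : M ≠ 0) :
    ⌊((N : ℝ) / M) ^ (1 / (d : ℝ))⌋₊ ^ d * M ≤ N := by
  have hpow : (((N : ℝ) / M) ^ (1 / (d : ℝ))) ^ d * M = N := by
    rw [one_div, Real.rpow_inv_natCast_pow (by positivity) hd]
    field_simp
  have hle : ((⌊((N : ℝ) / M) ^ (1 / (d : ℝ))⌋₊ ^ d * M : ℕ) : ℝ) ≤ N := by
    push_cast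
    exact le_of_le_of_eq (by gcongr; exact Nat.floor_le (by positivity)) hpow
  exact_mod_cast hle

/-- A multiplicative version of Fekete's lemma: along `N ≈ n ^ d * M` the quotients cannot drop
below the one at `M`. -/
theorem tendsto_div_rpow_of_superhomogeneous {d : ℕ} (hd : d ≠ 0) (hF : Monotone F) (hF₀ : F 0 = 0)
    (hmul : ∀ n N : ℕ, 0 < n → n * F N ≤ F (n ^ d * N)) :
    Tendsto (fun N : ℕ => F N / (N : ℝ≥0∞) ^ (1 / (d : ℝ))) atTop
      (𝓝 (⨆ N : ℕ, F N / (N : ℝ≥0∞) ^ (1 / (d : ℝ)))) := by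
  refine tendsto_order.2 ⟨fun v hv => ?_, fun v hv => Eventually.of_forall fun N =>
    (le_iSup (fun N : ℕ => F N / (N : ℝ≥0∞) ^ (1 / (d : ℝ))) N).trans_lt hv⟩
  obtain ⟨M, hM⟩ := lt_iSup_iff.1 hv
  have hM₀ : M ≠ 0 := fun h => by simp [h, hF₀] at hM
  have hM_pos : (0 : ℝ) < M := by positivity
  have hd_pos : (0 : ℝ) < 1 / d := by positivity
  let x : ℕ → ℝ := fun N => ((N : ℝ) / M) ^ (1 / (d : ℝ))
  have hx : Tendsto x atTop atTop :=
    (tendsto_rpow_atTop hd_pos).comp (tendsto_natCast_atTop_atTop.atTop_div_const hM_pos)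
  have hlim : Tendsto (fun N => ENNReal.ofReal (⌊x N⌋₊ / x N) *
      (F M / (M : ℝ≥0∞) ^ (1 / (d : ℝ)))) atTop (𝓝 (F M / (M : ℝ≥0∞) ^ (1 / (d : ℝ)))) := by
    simpa using ENNReal.Tendsto.mul_const (b := F M / (M : ℝ≥0∞) ^ (1 / (d : ℝ)))
      (ENNReal.tendsto_ofReal ((tendsto_nat_floor_div_atTop (R := ℝ)).comp hx)) (by simp)
  filter_upwards [hlim.eventually (lt_mem_nhds hM), hx.eventually_ge_atTop 1,
    eventually_gt_atTop 0] with N hN hxN hN₀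
  have hN_pos : (0 : ℝ) < N := by positivity
  have hinv : ((M : ℝ≥0∞) / N) ^ (1 / (d : ℝ)) = ENNReal.ofReal (x N)⁻¹ := by
    rw [← Real.inv_rpow (by positivity), inv_div, ← ENNReal.ofReal_natCast M,
      ← ENNReal.ofReal_natCast N, ← ENNReal.ofReal_div_of_pos hN_pos,
      ENNReal.ofReal_rpow_of_pos (by positivity)]
  calc v < ENNReal.ofReal (⌊x N⌋₊ / x N) * (F M / (M : ℝ≥0∞) ^ (1 / (d : ℝ))) := hN
    _ = ⌊x N⌋₊ * F M / (N : ℝ≥0∞) ^ (1 / (d : ℝ)) := by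
        rw [div_rpow_eq_mul_div_rpow hd_pos.le hM₀ _ N, hinv, div_eq_mul_inv (⌊x N⌋₊ : ℝ),
          ENNReal.ofReal_mul (by positivity), ENNReal.ofReal_natCast, mul_div_assoc]
        ring
    _ ≤ F N / (N : ℝ≥0∞) ^ (1 / (d : ℝ)) := by
        gcongr
        exact (hmul _ _ (Nat.floor_pos.2 hxN)).trans (hF (floor_rpow_one_div_pow_mul_le hd hM₀))

end Growth

section Grid

variable {d : ℕ} {r : ℝ}

theorem unitCube_eq_preimage (d : ℕ) :
    unitCube d = WithLp.ofLp ⁻¹' (Set.univ.pi fun _ : Fin d => Set.Icc (0 : ℝ) 1) := by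
  ext; simp [unitCube, -Set.pi_univ_Icc]

theorem zero_mem_unitCube (d : ℕ) : (0 : E d) ∈ unitCube d := fun _ => by simp

theorem unitCube_nonempty (d : ℕ) : (unitCube d).Nonempty := ⟨0, zero_mem_unitCube d⟩

theorem convex_unitCube (d : ℕ) : Convex ℝ (unitCube d) := by
  rw [unitCube_eq_preimage]
  exact (convex_pi fun _ _ => convex_Icc (0 : ℝ) 1).linear_preimage
    (WithLp.linearEquiv 2 ℝ (Fin d → ℝ)).toLinearMap

theorem isCompact_unitCube (d : ℕ) : IsCompact (unitCube d) := by
  rw [unitCube_eq_preimage]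
  exact (EuclideanSpace.equiv (Fin d) ℝ).toHomeomorph.isCompact_preimage.2
    (isCompact_univ_pi fun _ => isCompact_Icc)

theorem volume_unitCube (d : ℕ) : volume (unitCube d) = 1 := by
  rw [unitCube_eq_preimage, (PiLp.volume_preserving_ofLp (Fin d)).measure_preimage
    (MeasurableSet.univ_pi fun _ => measurableSet_Icc).nullMeasurableSet, volume_pi_pi]
  simp

theorem dist_le_sqrt_of_mem_unitCube {u v : E d} (hu : u ∈ unitCube d) (hv : v ∈ unitCube d) :
    dist u v ≤ √d := by
  rw [EuclideanSpace.dist_eq]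
  gcongr
  calc ∑ i, dist (u i) (v i) ^ 2 ≤ ∑ _ : Fin d, (1 : ℝ) := by
        gcongr with i
        exact pow_le_one₀ dist_nonneg (Real.dist_le_of_mem_Icc_01 (hu i) (hv i))
    _ = d := by simp

/-- The homothety taking `[0,1]^d` to the cube of side `r` with index `k` of the grid `r ℤ^d`. -/
def cellMap (r : ℝ) (k : Fin d → ℤ) (u : E d) : E d :=
  r • (WithLp.toLp 2 (fun i => (k i : ℝ)) + u)

/-- The half-open cube of side `r` with index `k` of the grid `r ℤ^d`. Defining it by integer parts
makes it plain that these cubes partition the space. -/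
def cell (r : ℝ) (k : Fin d → ℤ) : Set (E d) := {x | ∀ i, ⌊x i / r⌋ = k i}

theorem cellMap_apply (k : Fin d → ℤ) (u : E d) (i : Fin d) :
    cellMap r k u i = r * (k i + u i) := by
  simp [cellMap, mul_add]

theorem continuous_cellMap (k : Fin d → ℤ) : Continuous (cellMap r k) := by
  unfold cellMap; fun_prop

theorem edist_cellMap (hr : 0 ≤ r) (k : Fin d → ℤ) (u v : E d) :
    edist (cellMap r k u) (cellMap r k v) = ENNReal.ofReal r * edist u v := by
  rw [cellMap, cellMap, edist_smul₀, edist_add_left, ENNReal.smul_def, smul_eq_mul,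
    Real.nnnorm_of_nonneg hr, ENNReal.ofReal_eq_coe_nnreal hr]

theorem dist_cellMap (hr : 0 ≤ r) (k : Fin d → ℤ) (u v : E d) :
    dist (cellMap r k u) (cellMap r k v) = r * dist u v := by
  rw [dist_edist, edist_cellMap hr, ENNReal.toReal_mul, ENNReal.toReal_ofReal hr, dist_edist]

theorem exists_mem_cell (r : ℝ) (x : E d) : ∃ k, x ∈ cell r k := ⟨_, fun _ => rfl⟩

theorem pairwise_disjoint_cell (d : ℕ) (r : ℝ) :
    Pairwise (Function.onFun Disjoint (cell (d := d) r)) := fun _ _ hne =>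
  Set.disjoint_left.2 fun _ hx hx' => hne (funext fun i => (hx i).symm.trans (hx' i))

theorem cell_eq_preimage (hr : 0 < r) (k : Fin d → ℤ) :
    cell r k = WithLp.ofLp ⁻¹' (Set.univ.pi fun i => Set.Ico (r * k i) (r * (k i + 1))) := by
  ext x
  simp [cell, Int.floor_eq_iff, le_div_iff₀' hr, div_lt_iff₀' hr]

theorem cell_subset_image (hr : 0 < r) (k : Fin d → ℤ) :
    cell r k ⊆ cellMap r k '' unitCube d := by
  refine fun x hx => ⟨WithLp.toLp 2 fun i => Int.fract (x i / r), fun i =>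
    ⟨Int.fract_nonneg _, (Int.fract_lt_one _).le⟩, ?_⟩
  ext i
  rw [cellMap_apply, ← hx i, Int.floor_add_fract, mul_div_cancel₀ _ hr.ne']

theorem cellMap_zero_mem_cell (hr : 0 < r) (k : Fin d → ℤ) : cellMap r k 0 ∈ cell r k := fun i => by
  rw [cellMap_apply, PiLp.zero_apply, add_zero, mul_div_cancel_left₀ _ hr.ne', Int.floor_intCast]

theorem measurableSet_cell (hr : 0 < r) (k : Fin d → ℤ) : MeasurableSet (cell r k) := by
  rw [cell_eq_preimage hr]
  exact (WithLp.measurable_ofLp 2 _) (MeasurableSet.univ_pi fun _ => measurableSet_Ico)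

theorem volume_cell (hr : 0 < r) (k : Fin d → ℤ) : volume (cell r k) = ENNReal.ofReal r ^ d := by
  rw [cell_eq_preimage hr, (PiLp.volume_preserving_ofLp (Fin d)).measure_preimage
    (MeasurableSet.univ_pi fun _ => measurableSet_Ico).nullMeasurableSet, volume_pi_pi]
  simp [Real.volume_Ico, mul_add]

theorem finite_cell_inter_nonempty (hr : 0 < r) {A : Set (E d)} (hA : Bornology.IsBounded A) :
    {k : Fin d → ℤ | (cell r k ∩ A).Nonempty}.Finite := by
  obtain ⟨R, hR⟩ := hA.subset_closedBall 0
  refine (Set.finite_Icc (fun _ : Fin d => ⌊-R / r⌋) (fun _ => ⌊R / r⌋)).subset ?_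
  rintro k ⟨x, hxk, hxA⟩
  have hi (i : Fin d) : |x i| ≤ R :=
    (PiLp.norm_apply_le x i).trans (by simpa using hR hxA)
  refine ⟨fun i => ?_, fun i => ?_⟩ <;> rw [← hxk i] <;> apply Int.floor_le_floor <;> gcongr
  exacts [(abs_le.1 (hi i)).1, (abs_le.1 (hi i)).2]

theorem mapsTo_cellMap_subcube {n : ℕ} (k : Fin d → Fin n) :
    Set.MapsTo (cellMap (n : ℝ)⁻¹ fun i => ((k i : ℕ) : ℤ)) (unitCube d) (unitCube d) := by
  intro u hu i
  have hk : ((k i : ℕ) : ℝ) + 1 ≤ n := by exact_mod_cast (k i).2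
  have hn : (0 : ℝ) < n := by exact_mod_cast (k i).pos
  rw [cellMap_apply, Set.mem_Icc, inv_mul_le_iff₀ hn]
  exact ⟨mul_nonneg (by positivity) (add_nonneg (by positivity) (hu i).1),
    by push_cast; linarith [(hu i).2]⟩

theorem exists_eq_cellMap_subcube {n : ℕ} (hn : 0 < n) {y : E d} (hy : y ∈ unitCube d) :
    ∃ k : Fin d → Fin n, ∃ u ∈ unitCube d, cellMap (n : ℝ)⁻¹ (fun i => ((k i : ℕ) : ℤ)) u = y := by
  have hn' : (0 : ℝ) < n := by exact_mod_cast hn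
  have hlt (i : Fin d) : ⌈n * y i⌉₊ - 1 < n := by
    have hle : ⌈n * y i⌉₊ ≤ n := Nat.ceil_le.2 (mul_le_of_le_one_right hn'.le (hy i).2)
    exact (Nat.sub_le_sub_right hle 1).trans_lt (Nat.sub_one_lt hn.ne')
  refine ⟨fun i => ⟨_, hlt i⟩, WithLp.toLp 2 fun i => n * y i - (⌈n * y i⌉₊ - 1 : ℕ),
    fun i => ?_, ?_⟩
  · have h₀ : 0 ≤ n * y i := mul_nonneg hn'.le (hy i).1
    simp only [Set.mem_Icc, sub_nonneg, tsub_le_iff_right]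
    rcases ⌈n * y i⌉₊.eq_zero_or_pos with h | h
    · have := Nat.ceil_eq_zero.1 h
      simp only [h, zero_tsub, Nat.cast_zero]
      constructor <;> linarith
    · rw [Nat.cast_pred h]
      constructor <;> linarith [Nat.le_ceil (n * y i), Nat.ceil_lt_add_one h₀]
  · ext i
    rw [cellMap_apply]
    simp [hn'.ne']

end Grid

section CubeConst

variable {d : ℕ} {p : ℝ≥0∞}

theorem mul_lpPolarization_unitCube_le (hp : p ≠ 0) (n N : ℕ) (hn : 0 < n) :
    n * lpPolarization p (unitCube d) N ≤ lpPolarization p (unitCube d) (n ^ d * N) := by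
  have hcover : IsImageCover (unitCube d) (unitCube d)
      (fun k : Fin d → Fin n => cellMap (n : ℝ)⁻¹ fun i => ((k i : ℕ) : ℤ))
      fun _ => (n : ℝ≥0)⁻¹ := by
    refine ⟨fun _ => by positivity, mapsTo_cellMap_subcube, fun y hy => ?_⟩
    obtain ⟨k, u, hu, rfl⟩ := exists_eq_cellMap_subcube hn hy
    refine ⟨k, u, hu, fun x _ => (edist_cellMap (by positivity) _ u x).trans_le ?_⟩
    rw [ENNReal.ofReal, Real.toNNReal_inv, Real.toNNReal_natCast]
  refine le_trans (le_iInf fun _ => ?_)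
    (hcover.le_lpPolarization hp (unitCube_nonempty d) (m := fun _ => N) (by simp))
  rw [ENNReal.coe_inv (by positivity), inv_inv, ENNReal.coe_natCast]

/-- The limit of `lpPolarization p [0,1]^d N / N^{1/d}`, which for finite `p` is `σ_{p,d}^{1/p}`. -/
noncomputable def cubeConst (p : ℝ≥0∞) (d : ℕ) : ℝ≥0∞ :=
  ⨆ N : ℕ, lpPolarization p (unitCube d) N / (N : ℝ≥0∞) ^ (1 / (d : ℝ))

theorem tendsto_lpPolarization_unitCube (hd : d ≠ 0) (hp : p ≠ 0) :
    Tendsto (fun N : ℕ => lpPolarization p (unitCube d) N / (N : ℝ≥0∞) ^ (1 / (d : ℝ))) atTop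
      (𝓝 (cubeConst p d)) :=
  tendsto_div_rpow_of_superhomogeneous hd (lpPolarization_mono (unitCube_nonempty d))
    (lpPolarization_zero hp (unitCube_nonempty d)) (mul_lpPolarization_unitCube_le hp)

theorem lpPolarization_unitCube_le (hd : d ≠ 0) (hp : p ≠ 0) (N : ℕ) :
    lpPolarization p (unitCube d) N ≤ cubeConst p d * (N : ℝ≥0∞) ^ (1 / (d : ℝ)) := by
  rcases eq_or_ne N 0 with rfl | hN
  · rw [lpPolarization_zero hp (unitCube_nonempty d)]
    exact zero_le
  · refine (ENNReal.div_le_iff ?_ ?_).1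
      (le_iSup (fun N : ℕ => lpPolarization p (unitCube d) N / (N : ℝ≥0∞) ^ (1 / (d : ℝ))) N)
    · simp [ENNReal.rpow_eq_zero_iff, hN]
    · exact ENNReal.rpow_ne_top_of_nonneg (by positivity) (ENNReal.natCast_ne_top N)

theorem cubeConst_top_le (hp : p ≠ 0) (d : ℕ) : cubeConst ∞ d ≤ cubeConst p d :=
  iSup_mono fun N => ENNReal.div_le_div_right (lpPolarization_top_le hp _ N) _

theorem cubeConst_pos (hp : p ≠ 0) (d : ℕ) : 0 < cubeConst p d := by
  suffices h : (ENNReal.ofReal √d)⁻¹ ≤ lpPolarization p (unitCube d) 1 from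
    (ENNReal.inv_pos.2 ENNReal.ofReal_ne_top).trans_le
      (h.trans (le_iSup_of_le 1 (by simp)))
  refine le_iSup_of_le (fun _ => ⟨0, zero_mem_unitCube d⟩) (le_iInf fun y => ?_)
  refine le_trans (ENNReal.inv_le_inv.2 ?_) (le_lpSum hp _ 0)
  rw [edist_dist]
  exact ENNReal.ofReal_le_ofReal (dist_le_sqrt_of_mem_unitCube y.2 (zero_mem_unitCube d))

end CubeConst

section Averaging

variable {F : Type*} [NormedAddCommGroup F] [NormedSpace ℝ F] [FiniteDimensional ℝ F]
  [MeasurableSpace F] [BorelSpace F] {μ : Measure F} [μ.IsAddHaarMeasure] {s : ℝ}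

theorem setLIntegral_compl_ball_edist_rpow_neg (x : F) {r : ℝ} (hr : 0 < r) (hs : 0 ≤ s) :
    ∫⁻ y in (ball x r)ᶜ, edist y x ^ (-s) ∂μ = ENNReal.ofReal r ^ ((Module.finrank ℝ F : ℝ) - s) *
      ∫⁻ y in (ball 0 1)ᶜ, ‖y‖ₑ ^ (-s) ∂μ := by
  have hr_ne : ENNReal.ofReal r ≠ 0 := (ENNReal.ofReal_pos.2 hr).ne'
  let φ (y : F) : F := r⁻¹ • (y - x)
  have hφ : Measurable φ := by fun_prop
  have hmap : μ.map φ = ENNReal.ofReal r ^ Module.finrank ℝ F • μ := by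
    rw [show φ = (r⁻¹ • ·) ∘ (· - x) from rfl, ← Measure.map_map (by fun_prop) (by fun_prop),
      map_sub_right_eq_self, Measure.map_addHaar_smul _ (inv_ne_zero hr.ne'), inv_pow, inv_inv,
      abs_of_pos (by positivity), ENNReal.ofReal_pow hr.le]
  have hpre : φ ⁻¹' (ball 0 1)ᶜ = (ball x r)ᶜ := by
    ext y
    simp [φ, norm_smul, abs_of_pos hr, dist_eq_norm, le_inv_mul_iff₀ hr]
  have hnorm (y : F) : ‖φ y‖ₑ ^ (-s) = ENNReal.ofReal r ^ s * edist y x ^ (-s) := by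
    rw [enorm_smul, enorm_inv hr.ne', Real.enorm_of_nonneg hr.le, edist_eq_enorm_sub,
      ENNReal.rpow_neg, ENNReal.mul_rpow_of_nonneg _ _ hs, ENNReal.inv_rpow,
      ENNReal.mul_inv (by simp [hr_ne]) (by simp [hr_ne]), inv_inv, ENNReal.rpow_neg]
  have hscale : ENNReal.ofReal r ^ Module.finrank ℝ F * ∫⁻ y in (ball 0 1)ᶜ, ‖y‖ₑ ^ (-s) ∂μ =
      ENNReal.ofReal r ^ s * ∫⁻ y in (ball x r)ᶜ, edist y x ^ (-s) ∂μ := by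
    calc _ = ∫⁻ y in (ball 0 1)ᶜ, ‖y‖ₑ ^ (-s) ∂μ.map φ := by
          rw [hmap, Measure.restrict_smul, lintegral_smul_measure, smul_eq_mul]
      _ = ∫⁻ y in (ball x r)ᶜ, ‖φ y‖ₑ ^ (-s) ∂μ := by
          rw [setLIntegral_map measurableSet_ball.compl (by fun_prop) hφ, hpre]
      _ = _ := by
          simp only [hnorm]
          exact lintegral_const_mul _ (by fun_prop)
  rw [ENNReal.rpow_sub _ _ hr_ne ENNReal.ofReal_ne_top, ENNReal.rpow_natCast,
    ENNReal.div_eq_inv_mul, mul_assoc, hscale, ← mul_assoc, ENNReal.inv_mul_cancel _ _, one_mul] <;>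
  simp [hr_ne]

theorem setLIntegral_compl_ball_enorm_rpow_neg_lt_top (hs : Module.finrank ℝ F < s) :
    ∫⁻ y in (ball 0 1)ᶜ, ‖y‖ₑ ^ (-s) ∂μ < ∞ := by
  have hs₀ : 0 < s := (Nat.cast_nonneg _).trans_lt hs
  have hle (y : F) (hy : y ∈ (ball (0 : F) 1)ᶜ) :
      ‖y‖ₑ ^ (-s) ≤ ENNReal.ofReal (2⁻¹ ^ (-s)) * ENNReal.ofReal ((1 + ‖y‖) ^ (-s)) := by
    have hy₁ : 1 ≤ ‖y‖ := by simpa using hy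
    rw [← ofReal_norm, ENNReal.ofReal_rpow_of_pos (by positivity),
      ← ENNReal.ofReal_mul (by positivity), ← Real.mul_rpow (by positivity) (by positivity)]
    exact ENNReal.ofReal_le_ofReal
      (Real.rpow_le_rpow_of_nonpos (by positivity) (by linarith) (neg_nonpos.2 hs₀.le))
  calc _ ≤ ∫⁻ y in (ball 0 1)ᶜ,
          ENNReal.ofReal (2⁻¹ ^ (-s)) * ENNReal.ofReal ((1 + ‖y‖) ^ (-s)) ∂μ :=
        setLIntegral_mono' measurableSet_ball.compl hle
    _ ≤ ∫⁻ y, ENNReal.ofReal (2⁻¹ ^ (-s)) * ENNReal.ofReal ((1 + ‖y‖) ^ (-s)) ∂μ :=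
        setLIntegral_le_lintegral _ _
    _ = ENNReal.ofReal (2⁻¹ ^ (-s)) * ∫⁻ y, ENNReal.ofReal ((1 + ‖y‖) ^ (-s)) ∂μ :=
        lintegral_const_mul' _ _ ENNReal.ofReal_ne_top
    _ < ∞ := ENNReal.mul_lt_top ENNReal.ofReal_lt_top (finite_integral_one_add_norm hs)

/-- Integrate the Riesz sum over `Y`. -/
theorem mul_measure_le_of_le_sum_edist_rpow_neg {ι : Type*} [Fintype ι] {ω : ι → F} {r : ℝ}
    (hr : 0 < r) (hs : 0 ≤ s) {Y : Set F} (hY : ∀ y ∈ Y, ∀ j, r ≤ dist y (ω j)) {v : ℝ≥0∞}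
    (hv : ∀ y ∈ Y, v ≤ ∑ j, edist y (ω j) ^ (-s)) :
    v * μ Y ≤ Fintype.card ι * (ENNReal.ofReal r ^ ((Module.finrank ℝ F : ℝ) - s) *
      ∫⁻ y in (ball 0 1)ᶜ, ‖y‖ₑ ^ (-s) ∂μ) := by
  have hmeas (j : ι) : Measurable fun y : F => edist y (ω j) ^ (-s) := by fun_prop
  calc v * μ Y = ∫⁻ _ in Y, v ∂μ := (setLIntegral_const Y v).symm
    _ ≤ ∫⁻ y in Y, ∑ j, edist y (ω j) ^ (-s) ∂μ :=
        setLIntegral_mono (Finset.measurable_sum _ fun j _ => hmeas j) hv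
    _ = ∑ j, ∫⁻ y in Y, edist y (ω j) ^ (-s) ∂μ := lintegral_finsetSum _ fun j _ => hmeas j
    _ ≤ ∑ j, ∫⁻ y in (ball (ω j) r)ᶜ, edist y (ω j) ^ (-s) ∂μ := by
        gcongr with j
        exact fun y hy => by simpa using hY y hy j
    _ = _ := by
        simp only [setLIntegral_compl_ball_edist_rpow_neg _ hr hs, Finset.sum_const,
          Finset.card_univ, nsmul_eq_mul]

theorem inv_two_le_measure_sdiff_iUnion_ball {ι : Type*} [Fintype ι] (ω : ι → F) {r : ℝ}
    (hr : 0 < r) {A : Set F} (hA : 1 ≤ μ A)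
    (hvol : Fintype.card ι * (ENNReal.ofReal (r ^ Module.finrank ℝ F) * μ (ball 0 1)) ≤ 2⁻¹) :
    2⁻¹ ≤ μ (A \ ⋃ j, ball (ω j) r) := by
  have hU : μ (⋃ j, ball (ω j) r) ≤ 2⁻¹ := by
    refine (measure_iUnion_fintype_le _ _).trans (le_of_eq_of_le ?_ hvol)
    simp only [Measure.addHaar_ball_of_pos _ _ hr, Finset.sum_const, Finset.card_univ,
      nsmul_eq_mul]
  refine le_trans ?_ le_measure_sdiff
  rw [ENNReal.le_sub_iff_add_le_left (hU.trans_lt (by simp)).ne (hU.trans (le_trans (by simp) hA))]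
  exact (add_le_add_left hU _).trans (ENNReal.inv_two_add_inv_two.trans_le hA)

end Averaging

section CubeConstFinite

variable {p : ℝ≥0∞} {d : ℕ}

theorem lpPolarization_unitCube_rpow_le (hp : p ≠ ∞) (hp₀ : p ≠ 0) {N : ℕ} {r : ℝ} (hr : 0 < r)
    (hvol : N * (ENNReal.ofReal (r ^ d) * volume (ball (0 : E d) 1)) ≤ 2⁻¹) :
    lpPolarization p (unitCube d) N ^ p.toReal ≤ 2 * (N * (ENNReal.ofReal r ^ (d - p.toReal) *
      ∫⁻ y in (ball (0 : E d) 1)ᶜ, ‖y‖ₑ ^ (-p.toReal))) := by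
  have hs : 0 < p.toReal := ENNReal.toReal_pos hp₀ hp
  rw [← ENNReal.le_rpow_inv_iff hs]
  refine le_of_forall_lt fun v hv => ?_
  obtain ⟨v', hvv', hv'⟩ := exists_between hv
  refine hvv'.trans_le ?_
  rw [ENNReal.le_rpow_inv_iff hs]
  obtain ⟨ω, hω⟩ := exists_config_of_lt_lpPolarization hv'
  have hhalf := inv_two_le_measure_sdiff_iUnion_ball (μ := volume) (A := unitCube d)
    (fun j => (ω j : E d)) hr (volume_unitCube d).ge (by simpa using hvol)
  have key := mul_measure_le_of_le_sum_edist_rpow_neg (μ := volume) (v := v' ^ p.toReal)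
    (ω := fun j => (ω j : E d)) (Y := unitCube d \ ⋃ j, ball (ω j : E d) r) hr hs.le
    (fun y hy j => not_lt.1 fun h => hy.2 (Set.mem_iUnion.2 ⟨j, h⟩)) fun y hy => by
      have h := hω y hy.1
      rw [lpSum_of_ne_top hp, ENNReal.le_rpow_inv_iff hs, tsum_fintype] at h
      simpa only [ENNReal.inv_rpow, ← ENNReal.rpow_neg] using h
  rw [Fintype.card_fin, finrank_euclideanSpace_fin] at key
  calc v' ^ p.toReal = 2 * (v' ^ p.toReal * 2⁻¹) := by
        rw [mul_comm (v' ^ _), ← mul_assoc, ENNReal.mul_inv_cancel (by simp) (by simp), one_mul]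
    _ ≤ 2 * (v' ^ p.toReal * volume (unitCube d \ ⋃ j, ball (ω j : E d) r)) := by gcongr
    _ ≤ _ := by gcongr 2 * ?_

theorem mul_rpow_neg_one_div_rpow {n : ℝ} (hn : 0 < n) {N c : ℝ} (hN : 0 < N) (hc : 0 < c)
    (s : ℝ) : N * ((c * N) ^ (-(1 / n))) ^ (n - s) = c ^ (s / n - 1) * N ^ (s / n) := by
  rw [← Real.rpow_mul (by positivity), show -(1 / n) * (n - s) = s / n - 1 by field_simp; ring,
    Real.mul_rpow hc.le hN.le, Real.rpow_sub_one hN.ne']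
  field_simp

theorem cubeConst_lt_top_of_ne_top (hd : d ≠ 0) (hdp : (d : ℝ≥0∞) < p) (hp : p ≠ ∞) :
    cubeConst p d < ∞ := by
  have hd₀ : (0 : ℝ) < d := by positivity
  have hp₀ : p ≠ 0 := (zero_le.trans_lt hdp).ne'
  have hs : (d : ℝ) < p.toReal := by simpa using ENNReal.toReal_strict_mono hp hdp
  have hs₀ : 0 < p.toReal := hd₀.trans hs
  set V : ℝ := (volume (ball (0 : E d) 1)).toReal
  have hV : volume (ball (0 : E d) 1) = ENNReal.ofReal V :=
    (ENNReal.ofReal_toReal measure_ball_lt_top.ne).symm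
  have hVpos : 0 < V := ENNReal.toReal_pos (measure_ball_pos _ _ one_pos).ne' measure_ball_lt_top.ne
  set J : ℝ≥0∞ := ∫⁻ y in (ball (0 : E d) 1)ᶜ, ‖y‖ₑ ^ (-p.toReal)
  have hJ : J < ∞ := setLIntegral_compl_ball_enorm_rpow_neg_lt_top (by simpa using hs)
  have hbound : (2 * (ENNReal.ofReal ((2 * V) ^ (p.toReal / d - 1)) * J)) ^ p.toReal⁻¹ < ∞ :=
    ENNReal.rpow_lt_top_of_nonneg (by positivity) (by finiteness)
  refine (iSup_le fun N => ?_).trans_lt hbound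
  rcases eq_or_ne N 0 with rfl | hN
  · simp [lpPolarization_zero hp₀ (unitCube_nonempty d)]
  have hN₀ : (0 : ℝ) < N := by positivity
  set r : ℝ := (2 * V * N) ^ (-(1 / d : ℝ))
  have hrd : r ^ d = (2 * V * N)⁻¹ := by
    rw [← Real.rpow_natCast, ← Real.rpow_mul (by positivity), neg_mul,
      one_div_mul_cancel hd₀.ne', Real.rpow_neg_one]
  have hvol : N * (ENNReal.ofReal (r ^ d) * volume (ball (0 : E d) 1)) ≤ 2⁻¹ := by
    rw [hV, ← ENNReal.ofReal_mul (by positivity), ← ENNReal.ofReal_natCast,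
      ← ENNReal.ofReal_mul hN₀.le, hrd, ← ENNReal.ofReal_ofNat 2,
      ← ENNReal.ofReal_inv_of_pos two_pos]
    exact ENNReal.ofReal_le_ofReal (by field_simp; rfl)
  have key := lpPolarization_unitCube_rpow_le hp hp₀ (by positivity : 0 < r) hvol
  refine ENNReal.div_le_of_le_mul ?_
  rw [← ENNReal.le_rpow_inv_iff hs₀] at key
  refine key.trans_eq ?_
  rw [← ENNReal.rpow_rpow_inv hs₀.ne' ((N : ℝ≥0∞) ^ (1 / (d : ℝ))),
    ← ENNReal.mul_rpow_of_nonneg _ _ (by positivity), ← ENNReal.rpow_mul, ← mul_assoc (N : ℝ≥0∞),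
    ENNReal.ofReal_rpow_of_pos (by positivity), ← ENNReal.ofReal_natCast,
    ← ENNReal.ofReal_mul (by positivity),
    mul_rpow_neg_one_div_rpow hd₀ hN₀ (by positivity) p.toReal, ENNReal.ofReal_mul (by positivity),
    ENNReal.ofReal_rpow_of_pos hN₀, one_div_mul_eq_div]
  ring_nf
  rfl

theorem cubeConst_lt_top (hd : d ≠ 0) (hdp : (d : ℝ≥0∞) < p) : cubeConst p d < ∞ := by
  rcases eq_or_ne p ∞ with rfl | hp
  · refine (cubeConst_top_le (p := d + 1) (by simp) d).trans_lt
      (cubeConst_lt_top_of_ne_top hd (ENNReal.lt_add_right (by simp) one_ne_zero) (by finiteness))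
  · exact cubeConst_lt_top_of_ne_top hd hdp hp

end CubeConstFinite

section GridApproximation

variable {d : ℕ} {r : ℝ} {A : Set (E d)}

/-- The cubes of the grid `r ℤ^d` contained in `A`. -/
def innerCells (r : ℝ) (A : Set (E d)) : Set (Fin d → ℤ) := {k | cellMap r k '' unitCube d ⊆ A}

/-- The cubes of the grid `r ℤ^d` that meet `A` without being contained in it. The half-open cube
is used for the former and the closed one for the latter, so that with the inner cubes these cover
`A` without overlap. -/
def boundaryCells (r : ℝ) (A : Set (E d)) : Set (Fin d → ℤ) :=
  {k | (cell r k ∩ A).Nonempty} \ innerCells r A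

theorem nonempty_cell_inter_of_mem_innerCells (hr : 0 < r) {k : Fin d → ℤ}
    (hk : k ∈ innerCells r A) : (cell r k ∩ A).Nonempty :=
  ⟨_, cellMap_zero_mem_cell hr k, hk ⟨0, zero_mem_unitCube d, rfl⟩⟩

theorem finite_innerCells (hr : 0 < r) (hA : Bornology.IsBounded A) : (innerCells r A).Finite :=
  (finite_cell_inter_nonempty hr hA).subset fun _ => nonempty_cell_inter_of_mem_innerCells hr

theorem finite_boundaryCells (hr : 0 < r) (hA : Bornology.IsBounded A) :
    (boundaryCells r A).Finite :=
  (finite_cell_inter_nonempty hr hA).subset Set.sdiff_subset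

theorem nonempty_inter_frontier_of_isPreconnected {X : Type*} [TopologicalSpace X] {s t : Set X}
    (hs : IsPreconnected s) (h : (s ∩ t).Nonempty) (h' : (s \ t).Nonempty) :
    (s ∩ frontier t).Nonempty := by
  by_contra hne
  have hsub : s ⊆ interior t ∪ interior tᶜ := by
    rw [← compl_frontier_eq_union_interior]
    exact fun x hx hxt => hne ⟨x, hx, hxt⟩
  obtain ⟨x, hxs, hxt⟩ := h
  obtain ⟨y, hys, hyt⟩ := h'
  obtain ⟨z, -, hz, hz'⟩ := hs _ _ isOpen_interior isOpen_interior hsub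
    ⟨x, hxs, (hsub hxs).resolve_right fun h => interior_subset h hxt⟩
    ⟨y, hys, (hsub hys).resolve_left fun h => hyt (interior_subset h)⟩
  exact interior_subset hz' (interior_subset hz)

theorem cell_subset_cthickening_frontier (hr : 0 < r) {k : Fin d → ℤ}
    (hk : k ∈ boundaryCells r A) : cell r k ⊆ cthickening (r * √d) (frontier A) := by
  obtain ⟨⟨a, hak, haA⟩, hk'⟩ := hk
  obtain ⟨c, hc, hcA⟩ := Set.not_subset.1 hk'
  have hconn : IsPreconnected (cellMap r k '' unitCube d) :=
    (convex_unitCube d).isPreconnected.image _ (continuous_cellMap k).continuousOn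
  obtain ⟨_, ⟨v, hv, rfl⟩, hvA⟩ := nonempty_inter_frontier_of_isPreconnected hconn
    ⟨a, cell_subset_image hr k hak, haA⟩ ⟨c, hc, hcA⟩
  intro x hx
  obtain ⟨u, hu, rfl⟩ := cell_subset_image hr k hx
  refine mem_cthickening_of_dist_le _ _ _ _ hvA ?_
  rw [dist_cellMap hr.le]
  gcongr
  exact dist_le_sqrt_of_mem_unitCube hu hv

theorem measure_biUnion_cell (hr : 0 < r) (μ : Measure (E d)) {s : Set (Fin d → ℤ)}
    (hs : s.Finite) : μ (⋃ k ∈ s, cell r k) = ∑ k ∈ hs.toFinset, μ (cell r k) := by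
  rw [← measure_biUnion_finset (fun _ _ _ _ h => pairwise_disjoint_cell d r h)
    fun k _ => measurableSet_cell hr k]
  simp

theorem tendsto_volume_boundaryCells (hA : IsCompact A) (hA₀ : volume (frontier A) = 0) :
    Tendsto (fun r => volume (⋃ k ∈ boundaryCells r A, cell r k)) (𝓝[>] 0) (𝓝 0) := by
  have hcomp : IsCompact (frontier A) :=
    hA.of_isClosed_subset isClosed_frontier hA.isClosed.frontier_subset
  have hmul : Tendsto (fun r : ℝ => r * √d) (𝓝[>] 0) (𝓝 0) := by
    simpa using (tendsto_id.mul_const √d).mono_left (nhdsWithin_le_nhds (a := (0 : ℝ)))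
  refine tendsto_of_tendsto_of_tendsto_of_le_of_le' tendsto_const_nhds
    (hA₀ ▸ (tendsto_measure_cthickening_of_isCompact hcomp).comp hmul)
    (Eventually.of_forall fun _ => zero_le) ?_
  filter_upwards [self_mem_nhdsWithin] with r hr
  exact measure_mono (Set.iUnion₂_subset fun k hk => cell_subset_cthickening_frontier hr hk)

theorem cellMap_mem_interior_cell (hr : 0 < r) (k : Fin d → ℤ) {u : E d}
    (hu : ∀ i, u i ∈ Set.Ioo (0 : ℝ) 1) : cellMap r k u ∈ interior (cell r k) := by
  rw [cell_eq_preimage hr]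
  refine preimage_interior_subset_interior_preimage (PiLp.continuous_ofLp 2 _) ?_
  simp only [interior_pi_set Set.finite_univ, interior_Ico]
  intro i _
  rw [cellMap_apply]
  exact ⟨by gcongr; linarith [(hu i).1], by gcongr; exact (hu i).2⟩

end GridApproximation

theorem exists_forall_dist_le_of_convex {F : Type*} [NormedAddCommGroup F] [InnerProductSpace ℝ F]
    {K : Set F} (hK : IsComplete K) (hne : K.Nonempty) (hconv : Convex ℝ K) (v : F) :
    ∃ x ∈ K, ∀ u ∈ K, dist u x ≤ dist u v := by
  obtain ⟨x, hx, hmin⟩ := exists_norm_eq_iInf_of_complete_convex hne hK hconv v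
  refine ⟨x, hx, fun u hu => ?_⟩
  have hinner : inner ℝ (v - x) (u - x) ≤ 0 :=
    (norm_eq_iInf_iff_real_inner_le_zero hconv hx).1 hmin u hu
  rw [dist_eq_norm, dist_eq_norm, ← sq_le_sq₀ (norm_nonneg _) (norm_nonneg _),
    ← sub_sub_sub_cancel_right u v x, norm_sub_sq_real (u - x), real_inner_comm]
  nlinarith [sq_nonneg ‖v - x‖]

section WellTiled

variable {X ι : Type*} [PseudoEMetricSpace X] {d : ℕ} {p : ℝ≥0∞} {A B : Set X} {V : ℝ≥0∞}

/-- `A` is covered, in the sense of `IsImageCover`, by expanded copies of `[0,1]^d` of total volume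
arbitrarily close to `V`. This bounds the polarization of `A` from below. -/
def HasImageCovers (d : ℕ) (A : Set X) (V : ℝ≥0∞) : Prop :=
  ∀ V' > V, ∃ (ι : Type) (_ : Fintype ι) (f : ι → E d → X) (L : ι → ℝ≥0),
    IsImageCover (unitCube d) A f L ∧ ((∑ i, L i ^ d : ℝ≥0) : ℝ≥0∞) ≤ V'

/-- `A` contains separated contracted copies of `[0,1]^d`, in the sense of `IsImagePacking`, of
total volume arbitrarily close to `V`. This bounds the polarization of `A` from above. -/
def HasImagePackings (d : ℕ) (A : Set X) (V : ℝ≥0∞) : Prop :=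
  ∀ V' < V, ∃ (ι : Type) (_ : Fintype ι) (g : ι → E d → X) (W : ι → Set X) (l : ι → ℝ≥0) (δ : ℝ≥0),
    IsImagePacking (unitCube d) A g W l δ ∧ V' ≤ ((∑ i, l i ^ d : ℝ≥0) : ℝ≥0∞)

/-- A set of volume `V` that is covered and packed by nearly similar copies of the cube whose total
volumes approach `V`. The polarization problem on such a set reduces to the one on the cube. -/
structure IsWellTiled (d : ℕ) (A : Set X) (V : ℝ≥0∞) : Prop where
  nonempty : A.Nonempty
  ne_zero : V ≠ 0
  ne_top : V ≠ ∞
  hasImageCovers : HasImageCovers d A V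
  hasImagePackings : HasImagePackings d A V

theorem IsImageCover.union {Y : Type*} [PseudoEMetricSpace Y] {K : Set Y} {κ : Type*}
    {f : ι → Y → X} {L : ι → ℝ≥0} {g : κ → Y → X} {M : κ → ℝ≥0} (hA : IsImageCover K A f L)
    (hB : IsImageCover K B g M) :
    IsImageCover K (A ∪ B) (Sum.elim f g) (Sum.elim L M) where
  pos := Sum.rec hA.pos hB.pos
  mapsTo := Sum.rec (fun i => (hA.mapsTo i).mono_right Set.subset_union_left)
    fun i => (hB.mapsTo i).mono_right Set.subset_union_right
  exists_edist_le := by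
    rintro y (hy | hy)
    · obtain ⟨i, h⟩ := hA.exists_edist_le y hy
      exact ⟨.inl i, h⟩
    · obtain ⟨i, h⟩ := hB.exists_edist_le y hy
      exact ⟨.inr i, h⟩

theorem HasImageCovers.union {V₁ V₂ : ℝ≥0∞} (hA : HasImageCovers d A V₁)
    (hB : HasImageCovers d B V₂) : HasImageCovers d (A ∪ B) (V₁ + V₂) := by
  intro V' hV'
  obtain ⟨W₁, W₂, hW₁, hW₂, hW⟩ : ∃ W₁ W₂, V₁ < W₁ ∧ V₂ < W₂ ∧ W₁ + W₂ ≤ V' := by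
    have hε : (V' - (V₁ + V₂)) / 2 ≠ 0 := by simpa [tsub_eq_zero_iff_le] using hV'
    refine ⟨_, _, ENNReal.lt_add_right (ne_top_of_lt (le_self_add.trans_lt hV')) hε,
      ENNReal.lt_add_right (ne_top_of_lt (le_add_self.trans_lt hV')) hε, ?_⟩
    rw [add_add_add_comm, ENNReal.add_halves, add_tsub_cancel_of_le hV'.le]
  obtain ⟨ι, _, f, L, hf, hL⟩ := hA W₁ hW₁
  obtain ⟨κ, _, g, M, hg, hM⟩ := hB W₂ hW₂
  refine ⟨ι ⊕ κ, inferInstance, _, _, hf.union hg, le_trans ?_ hW⟩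
  rw [Fintype.sum_sum_type, ENNReal.coe_add]
  exact add_le_add hL hM

theorem IsImageCover.eventually_le_lpPolarization_div [Fintype ι] {f : ι → E d → X} {L : ι → ℝ≥0}
    (h : IsImageCover (unitCube d) A f L) (hd : d ≠ 0) (hp : p ≠ 0) (hA : A.Nonempty) {v : ℝ≥0∞}
    (hv : v < cubeConst p d / ((∑ i, L i ^ d : ℝ≥0) : ℝ≥0∞) ^ (1 / (d : ℝ))) :
    ∀ᶠ N : ℕ in atTop, v ≤ lpPolarization p A N / (N : ℝ≥0∞) ^ (1 / (d : ℝ)) := by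
  set S := ∑ i, L i ^ d
  have hS : 0 < S := by
    obtain ⟨y, hy⟩ := hA
    obtain ⟨i, -⟩ := h.exists_edist_le y hy
    exact Finset.sum_pos (fun i _ => pow_pos (h.pos i) d) ⟨i, Finset.mem_univ i⟩
  have hlim (i : ι) : Tendsto (fun N : ℕ => (L i : ℝ≥0∞)⁻¹ *
      (lpPolarization p (unitCube d) ⌊(L i ^ d / S : ℝ≥0) * (N : ℝ)⌋₊ /
        (N : ℝ≥0∞) ^ (1 / (d : ℝ)))) atTop (𝓝 (cubeConst p d / (S : ℝ≥0∞) ^ (1 / (d : ℝ)))) := by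
    have hL : (L i : ℝ≥0∞) ≠ 0 := ENNReal.coe_ne_zero.2 (h.pos i).ne'
    have hroot : ENNReal.ofReal (L i ^ d / S : ℝ≥0) ^ (1 / (d : ℝ)) =
        L i / (S : ℝ≥0∞) ^ (1 / (d : ℝ)) := by
      rw [ENNReal.ofReal_coe_nnreal, ENNReal.coe_div hS.ne', ENNReal.div_rpow_of_nonneg _ _
        (by positivity), ENNReal.coe_pow, one_div, ENNReal.pow_rpow_inv_natCast hd]
    convert ENNReal.Tendsto.const_mul (tendsto_floor_mul_div_rpow (by positivity)
      (tendsto_lpPolarization_unitCube hd hp)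
      (NNReal.coe_pos.2 (div_pos (pow_pos (h.pos i) d) hS)))
      (.inr (ENNReal.inv_ne_top.2 hL)) using 2
    rw [hroot, mul_left_comm, ← mul_div_assoc, ENNReal.inv_mul_cancel hL ENNReal.coe_ne_top,
      mul_one_div]
  filter_upwards [eventually_all.2 fun i => (hlim i).eventually (lt_mem_nhds hv),
    eventually_ne_atTop 0] with N hN hN₀
  have hsum : ∑ i, ⌊(L i ^ d / S : ℝ≥0) * (N : ℝ)⌋₊ ≤ N := by
    have hle : ∑ i, (⌊(L i ^ d / S : ℝ≥0) * (N : ℝ)⌋₊ : ℝ) ≤ ∑ i, (L i ^ d / S : ℝ≥0) * (N : ℝ) :=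
      Finset.sum_le_sum fun i _ => Nat.floor_le (by positivity)
    rw [← Finset.sum_mul, ← NNReal.coe_sum, ← Finset.sum_div, div_self hS.ne', NNReal.coe_one,
      one_mul] at hle
    exact_mod_cast hle
  refine le_trans ?_ (ENNReal.div_le_div_right (h.le_lpPolarization hp hA hsum) _)
  rw [ENNReal.iInf_div_of_ne (by simp [ENNReal.rpow_eq_zero_iff, hN₀])
    (ENNReal.rpow_ne_top_of_nonneg (by positivity) (ENNReal.natCast_ne_top N))]
  exact le_iInf fun i => (hN i).le.trans_eq (mul_div_assoc _ _ _).symm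

theorem tendsto_natCast_rpow_div_rpow_zero {α β : ℝ} (h : α < β) :
    Tendsto (fun N : ℕ => (N : ℝ≥0∞) ^ α / (N : ℝ≥0∞) ^ β) atTop (𝓝 0) := by
  have hlim : Tendsto (fun N : ℕ => ((N : ℝ≥0∞) ^ (β - α))⁻¹) atTop (𝓝 0) := by
    rw [← ENNReal.inv_top]
    exact tendsto_inv_iff.2 ((ENNReal.tendsto_rpow_at_top (sub_pos.2 h)).comp
      ENNReal.tendsto_nat_nhds_top)
  refine hlim.congr' ?_
  filter_upwards [eventually_ne_atTop 0] with N hN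
  rw [← ENNReal.rpow_neg, neg_sub,
    ENNReal.rpow_sub _ _ (Nat.cast_ne_zero.2 hN) (ENNReal.natCast_ne_top N)]

theorem inv_toReal_lt_one_div (hd : d ≠ 0) (hdp : (d : ℝ≥0∞) < p) : p.toReal⁻¹ < 1 / (d : ℝ) := by
  rw [one_div]
  rcases eq_or_ne p ∞ with rfl | hp
  · simpa using Nat.pos_of_ne_zero hd
  · exact inv_strictAnti₀ (by positivity) (by simpa using ENNReal.toReal_strict_mono hp hdp)

theorem IsImagePacking.eventually_lpPolarization_div_le [Fintype ι] [Nonempty ι]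
    {g : ι → E d → X} {W : ι → Set X} {l : ι → ℝ≥0} {δ : ℝ≥0}
    (h : IsImagePacking (unitCube d) A g W l δ) (hd : d ≠ 0) (hdp : (d : ℝ≥0∞) < p) {v : ℝ≥0∞}
    (hv : cubeConst p d / ((∑ i, l i ^ d : ℝ≥0) : ℝ≥0∞) ^ (1 / (d : ℝ)) < v) :
    ∀ᶠ N : ℕ in atTop, lpPolarization p A N / (N : ℝ≥0∞) ^ (1 / (d : ℝ)) ≤ v := by
  have hp : 1 ≤ p := le_trans (mod_cast Nat.one_le_iff_ne_zero.2 hd) hdp.le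
  set T := ∑ i, l i ^ d
  have hlim : Tendsto (fun N : ℕ => cubeConst p d / (T : ℝ≥0∞) ^ (1 / (d : ℝ)) +
      (N : ℝ≥0∞) ^ p.toReal⁻¹ / (N : ℝ≥0∞) ^ (1 / (d : ℝ)) * (δ : ℝ≥0∞)⁻¹) atTop
      (𝓝 (cubeConst p d / (T : ℝ≥0∞) ^ (1 / (d : ℝ)))) := by
    simpa using tendsto_const_nhds.add (ENNReal.Tendsto.mul_const
      (tendsto_natCast_rpow_div_rpow_zero (inv_toReal_lt_one_div hd hdp))
      (.inr (ENNReal.inv_ne_top.2 (ENNReal.coe_ne_zero.2 h.delta_pos.ne'))))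
  filter_upwards [hlim.eventually (gt_mem_nhds hv), eventually_ne_atTop 0] with N hN hN₀
  refine le_trans ?_ hN.le
  refine (ENNReal.div_le_div_right (h.lpPolarization_le hp (unitCube_nonempty d) hd
    (lpPolarization_unitCube_le hd (one_pos.trans_le hp).ne')) _).trans_eq ?_
  have hN_ne : (N : ℝ≥0∞) ^ (1 / (d : ℝ)) ≠ 0 := by simp [ENNReal.rpow_eq_zero_iff, hN₀]
  have hN_top : (N : ℝ≥0∞) ^ (1 / (d : ℝ)) ≠ ∞ :=
    ENNReal.rpow_ne_top_of_nonneg (by positivity) (ENNReal.natCast_ne_top N)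
  rw [ENNReal.add_div, ENNReal.div_rpow_of_nonneg _ _ (by positivity), ← mul_div_assoc,
    ENNReal.div_right_comm, ENNReal.mul_div_cancel_right hN_ne hN_top, ENNReal.mul_div_right_comm]

theorem tendsto_div_rpow_nhds (c : ℝ≥0∞) {V : ℝ≥0∞} (hV : V ≠ ∞) {α : ℝ} (hα : 0 ≤ α) :
    Tendsto (fun V' => c / V' ^ α) (𝓝 V) (𝓝 (c / V ^ α)) :=
  ENNReal.Tendsto.const_div (ENNReal.continuous_rpow_const.tendsto V)
    (.inl (ENNReal.rpow_ne_top_of_nonneg hα hV))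

theorem IsWellTiled.tendsto_lpPolarization (h : IsWellTiled d A V) (hd : d ≠ 0)
    (hdp : (d : ℝ≥0∞) < p) :
    Tendsto (fun N : ℕ => lpPolarization p A N / (N : ℝ≥0∞) ^ (1 / (d : ℝ))) atTop
      (𝓝 (cubeConst p d / V ^ (1 / (d : ℝ)))) := by
  have hV := tendsto_div_rpow_nhds (cubeConst p d) h.ne_top (α := 1 / (d : ℝ)) (by positivity)
  refine tendsto_order.2 ⟨fun v hv => ?_, fun v hv => ?_⟩
  · obtain ⟨v', hvv', hv'⟩ := exists_between hv
    have : (𝓝[>] V).NeBot := nhdsGT_neBot_of_exists_gt ⟨∞, h.ne_top.lt_top⟩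
    obtain ⟨V', hV', hlt⟩ := (((hV.mono_left nhdsWithin_le_nhds).eventually (lt_mem_nhds hv')).and
      (self_mem_nhdsWithin (s := Set.Ioi V))).exists
    obtain ⟨ι, _, f, L, hf, hL⟩ := h.hasImageCovers V' hlt
    filter_upwards [hf.eventually_le_lpPolarization_div hd (pos_of_gt hdp).ne' h.nonempty
      (hV'.trans_le (ENNReal.div_le_div_left (ENNReal.rpow_le_rpow hL (by positivity)) _))]
      with N hN using hvv'.trans_le hN
  · obtain ⟨v', hv', hvv'⟩ := exists_between hv
    have : (𝓝[<] V).NeBot := nhdsLT_neBot_of_exists_lt ⟨0, h.ne_zero.bot_lt⟩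
    obtain ⟨V', hV', hpos, hlt⟩ := (((hV.mono_left nhdsWithin_le_nhds).eventually
      (gt_mem_nhds hv')).and (Ioo_mem_nhdsLT h.ne_zero.bot_lt)).exists
    obtain ⟨ι, _, g, W, l, δ, hg, hl⟩ := h.hasImagePackings V' hlt
    have : Nonempty ι := by
      by_contra hι
      have := not_nonempty_iff.1 hι
      exact hpos.ne' (by simpa using hl)
    filter_upwards [hg.eventually_lpPolarization_div_le hd hdp
      ((ENNReal.div_le_div_left (ENNReal.rpow_le_rpow hl (by positivity)) _).trans_lt hV')]
      with N hN using hN.trans_lt hvv'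

end WellTiled

section ConformalChart

variable {d : ℕ} {X : Type*} [MetricSpace X] {φ : E d → X} {w : E d → ℝ≥0} {A : Set (E d)}

/-- A parametrization that multiplies distances by the product of the values at the two points of a
continuous positive weight, as stereographic projection and other Möbius maps do. -/
structure IsConformalChart (φ : E d → X) (w : E d → ℝ≥0) : Prop where
  continuous_weight : Continuous w
  weight_pos : ∀ x, 0 < w x
  edist_eq : ∀ x y, edist (φ x) (φ y) = (w x * w y : ℝ≥0) * edist x y

/-- `φ` is a similarity of ratio `a` on `S`, up to the factor `q`. -/
def IsNearSimilarityOn (φ : E d → X) (S : Set (E d)) (q a : ℝ≥0) : Prop :=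
  ∀ x ∈ S, ∀ y ∈ S, edist (φ x) (φ y) ≤ (q * a : ℝ≥0) * edist x y ∧
    a * edist x y ≤ q * edist (φ x) (φ y)

theorem IsNearSimilarityOn.mono {S T : Set (E d)} {q a : ℝ≥0} (h : IsNearSimilarityOn φ T q a)
    (hST : S ⊆ T) : IsNearSimilarityOn φ S q a := fun x hx y hy => h x (hST hx) y (hST hy)

theorem exists_forall_dist_lt_le_mul {Y : Type*} [PseudoMetricSpace Y] {K : Set Y}
    (hK : IsCompact K) {f : Y → ℝ≥0} (hf : Continuous f) (hpos : ∀ x, 0 < f x) {q : ℝ≥0}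
    (hq : 1 < q) : ∃ δ > 0, ∀ x ∈ K, ∀ y ∈ K, dist x y < δ → f x ≤ q * f y := by
  have hlog : Continuous fun x => Real.log (f x) :=
    (NNReal.continuous_coe.comp hf).log fun x => (NNReal.coe_pos.2 (hpos x)).ne'
  obtain ⟨δ, hδ, h⟩ := Metric.uniformContinuousOn_iff.1
    (hK.uniformContinuousOn_of_continuous hlog.continuousOn) (Real.log q) (Real.log_pos hq)
  refine ⟨δ, hδ, fun x hx y hy hxy => ?_⟩
  have hlt := (abs_lt.1 (h x hx y hy hxy)).2
  rw [sub_lt_iff_lt_add, ← Real.log_mul (by positivity) (NNReal.coe_pos.2 (hpos y)).ne',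
    Real.log_lt_log_iff (NNReal.coe_pos.2 (hpos x))
      (mul_pos (by positivity) (NNReal.coe_pos.2 (hpos y)))] at hlt
  exact_mod_cast hlt.le

theorem isConformalChart_of_isometry (h : Isometry φ) : IsConformalChart φ fun _ => 1 :=
  ⟨continuous_const, fun _ => one_pos, fun x y => by simp [h x y]⟩

section HausdorffMeasure

variable [MeasurableSpace X] [BorelSpace X]

theorem euclideanHausdorffMeasure_image_le {Y Z : Type*} [EMetricSpace Y] [MeasurableSpace Y]
    [BorelSpace Y] [EMetricSpace Z] [MeasurableSpace Z] [BorelSpace Z] {f : Y → Z} {S : Set Y}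
    {C : ℝ≥0} (hf : LipschitzOnWith C f S) (n : ℕ) :
    μHE[n] (f '' S) ≤ (C : ℝ≥0∞) ^ n * μHE[n] S := by
  have hle := hf.hausdorffMeasure_image_le (d := n) (Nat.cast_nonneg n)
  rw [ENNReal.rpow_natCast] at hle
  simp only [Measure.euclideanHausdorffMeasure_def, Measure.smul_apply, ENNReal.smul_def,
    smul_eq_mul]
  rw [mul_left_comm]
  gcongr

theorem IsNearSimilarityOn.euclideanHausdorffMeasure_image_le {S : Set (E d)} {q a : ℝ≥0}
    (h : IsNearSimilarityOn φ S q a) :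
    μHE[d] (φ '' S) ≤ ((q * a : ℝ≥0) : ℝ≥0∞) ^ d * volume S := by
  rw [← EuclideanSpace.euclideanHausdorffMeasure_eq_volume]
  exact RieszPolarization.euclideanHausdorffMeasure_image_le (fun x hx y hy => (h x hx y hy).1) d

theorem IsNearSimilarityOn.le_euclideanHausdorffMeasure_image {S : Set (E d)} {q a : ℝ≥0}
    (h : IsNearSimilarityOn φ S q a) (ha : 0 < a) :
    (a : ℝ≥0∞) ^ d * volume S ≤ (q : ℝ≥0∞) ^ d * μHE[d] (φ '' S) := by
  have ha₀ : (a : ℝ≥0∞) ≠ 0 := ENNReal.coe_ne_zero.2 ha.ne'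
  have hinj : S.InjOn φ := fun x hx y hy hxy => by
    have := (h x hx y hy).2
    rw [hxy, edist_self, mul_zero, nonpos_iff_eq_zero, mul_eq_zero, edist_eq_zero] at this
    exact this.resolve_left ha₀
  have hleft := hinj.leftInvOn_invFunOn
  have hLip : LipschitzOnWith (q / a) (Function.invFunOn φ S) (φ '' S) := by
    rintro _ ⟨x, hx, rfl⟩ _ ⟨y, hy, rfl⟩
    rw [hleft hx, hleft hy, ENNReal.coe_div ha.ne', ENNReal.mul_comm_div, ← mul_div_assoc,
      ENNReal.le_div_iff_mul_le (.inl ha₀) (.inl ENNReal.coe_ne_top), mul_comm]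
    exact (h x hx y hy).2
  have hle := RieszPolarization.euclideanHausdorffMeasure_image_le hLip d
  rw [hleft.image_image, EuclideanSpace.euclideanHausdorffMeasure_eq_volume,
    ENNReal.coe_div ha.ne'] at hle
  calc (a : ℝ≥0∞) ^ d * volume S ≤ a ^ d * ((q / a) ^ d * μHE[d] (φ '' S)) := by gcongr
    _ = q ^ d * μHE[d] (φ '' S) := by
        rw [← mul_assoc, ← mul_pow, ENNReal.mul_div_cancel ha₀ ENNReal.coe_ne_top]

end HausdorffMeasure

/-- `φ` is on each cube of the grid `r ℤ^d` that meets `A` a near similarity, of ratio `a k ≤ M` on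
the part in `A` of the `k`-th cube. -/
def HasCellRatios (φ : E d → X) (A : Set (E d)) (r : ℝ) (q M : ℝ≥0) (a : (Fin d → ℤ) → ℝ≥0) :
    Prop :=
  ∀ k, (cell r k ∩ A).Nonempty →
    0 < a k ∧ a k ≤ M ∧ IsNearSimilarityOn φ (A ∩ cellMap r k '' unitCube d) q (a k)

namespace IsConformalChart

variable (h : IsConformalChart φ w)
include h

theorem injective : Function.Injective φ := by
  intro x y hxy
  have hmul := h.edist_eq x y
  rw [hxy, edist_self, eq_comm, mul_eq_zero, edist_eq_zero] at hmul
  exact hmul.resolve_left (ENNReal.coe_ne_zero.2 (mul_pos (h.weight_pos x) (h.weight_pos y)).ne')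

theorem continuous : Continuous φ := by
  refine continuous_iff_continuousAt.2 fun x => tendsto_iff_edist_tendsto_0.2 ?_
  simp_rw [h.edist_eq]
  have hw : Continuous fun y => w y * w x := h.continuous_weight.mul continuous_const
  have hedist : Tendsto (fun y => edist y x) (𝓝 x) (𝓝 0) :=
    tendsto_iff_edist_tendsto_0.1 tendsto_id
  simpa using ENNReal.Tendsto.mul (ENNReal.tendsto_coe.2 (hw.tendsto x)) (.inr (by simp))
    hedist (.inr ENNReal.coe_ne_top)

theorem exists_hasCellRatios (hA : IsCompact A) : ∃ M : ℝ≥0, ∀ q > 1, ∀ᶠ r in 𝓝[>] (0 : ℝ),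
    ∃ a, HasCellRatios φ A r q M a := by
  have hw : Continuous fun z : E d × E d => w z.1 * w z.2 :=
    (h.continuous_weight.comp continuous_fst).mul (h.continuous_weight.comp continuous_snd)
  obtain ⟨M, hM⟩ := (hA.prod hA).bddAbove_image hw.continuousOn
  refine ⟨M, fun q hq => ?_⟩
  obtain ⟨δ, hδ, hδw⟩ := exists_forall_dist_lt_le_mul (hA.prod hA) hw
    (fun z => mul_pos (h.weight_pos z.1) (h.weight_pos z.2)) hq
  have hmul : Tendsto (fun r : ℝ => r * √d) (𝓝[>] 0) (𝓝 0) := by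
    simpa using (tendsto_id.mul_const √d).mono_left (nhdsWithin_le_nhds (a := (0 : ℝ)))
  filter_upwards [hmul.eventually (gt_mem_nhds hδ), self_mem_nhdsWithin] with r hrδ hr
  suffices hk : ∀ k, (cell r k ∩ A).Nonempty → ∃ a, 0 < a ∧ a ≤ M ∧
      IsNearSimilarityOn φ (A ∩ cellMap r k '' unitCube d) q a by
    choose! a ha using hk
    exact ⟨a, ha⟩
  rintro k ⟨z, hzk, hzA⟩
  refine ⟨w z * w z, mul_pos (h.weight_pos z) (h.weight_pos z), hM ⟨(z, z), ⟨hzA, hzA⟩, rfl⟩, ?_⟩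
  have hdist : ∀ x ∈ cellMap r k '' unitCube d, dist x z < δ := by
    obtain ⟨v, hv, rfl⟩ := cell_subset_image hr k hzk
    rintro _ ⟨u, hu, rfl⟩
    rw [dist_cellMap (le_of_lt hr)]
    exact (mul_le_mul_of_nonneg_left (dist_le_sqrt_of_mem_unitCube hu hv) (le_of_lt hr)).trans_lt
      hrδ
  intro x ⟨hxA, hx⟩ y ⟨hyA, hy⟩
  rw [h.edist_eq]
  constructor
  · refine mul_le_mul_left (ENNReal.coe_le_coe.2 ?_) _
    exact hδw (x, y) ⟨hxA, hyA⟩ (z, z) ⟨hzA, hzA⟩ (max_lt (hdist x hx) (hdist y hy))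
  · rw [← mul_assoc, ← ENNReal.coe_mul]
    refine mul_le_mul_left (ENNReal.coe_le_coe.2 ?_) _
    refine hδw (z, z) ⟨hzA, hzA⟩ (x, y) ⟨hxA, hyA⟩ ?_
    rw [dist_comm]
    exact max_lt (hdist x hx) (hdist y hy)

end IsConformalChart

section CellRatios

variable {r : ℝ} {q M : ℝ≥0} {a : (Fin d → ℤ) → ℝ≥0}

theorem HasCellRatios.euclideanHausdorffMeasure_image_le [MeasurableSpace X] [BorelSpace X]
    (h : HasCellRatios φ A r q M a) (hr : 0 < r) (hA : Bornology.IsBounded A) :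
    μHE[d] (φ '' A) ≤ (q : ℝ≥0∞) ^ d *
      ∑ k ∈ (finite_cell_inter_nonempty hr hA).toFinset, (a k * r.toNNReal : ℝ≥0∞) ^ d := by
  have hcover : φ '' A ⊆ ⋃ k ∈ (finite_cell_inter_nonempty hr hA).toFinset,
      φ '' (cell r k ∩ A) := by
    rintro _ ⟨x, hx, rfl⟩
    obtain ⟨k, hk⟩ := exists_mem_cell r x
    exact Set.mem_biUnion (by simpa using ⟨x, hk, hx⟩) ⟨x, ⟨hk, hx⟩, rfl⟩
  refine (measure_mono hcover).trans ((measure_biUnion_finset_le _ _).trans ?_)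
  rw [Finset.mul_sum]
  refine Finset.sum_le_sum fun k hk => ?_
  have hsub : cell r k ∩ A ⊆ A ∩ cellMap r k '' unitCube d :=
    fun x hx => ⟨hx.2, cell_subset_image hr k hx.1⟩
  obtain ⟨-, -, hsim⟩ := h k ((finite_cell_inter_nonempty hr hA).mem_toFinset.1 hk)
  calc μHE[d] (φ '' (cell r k ∩ A))
      ≤ ((q * a k : ℝ≥0) : ℝ≥0∞) ^ d * volume (cell r k ∩ A) :=
        (hsim.mono hsub).euclideanHausdorffMeasure_image_le
    _ ≤ ((q * a k : ℝ≥0) : ℝ≥0∞) ^ d * volume (cell r k) := by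
        gcongr
        exact Set.inter_subset_left
    _ = q ^ d * (a k * r.toNNReal) ^ d := by
        rw [volume_cell hr, ENNReal.coe_mul, mul_pow, mul_pow, mul_assoc, ENNReal.ofReal]

theorem HasCellRatios.sum_innerCells_le [MeasurableSpace X] [BorelSpace X]
    (h : HasCellRatios φ A r q M a) (hφ : MeasurableEmbedding φ) (hr : 0 < r)
    (hA : Bornology.IsBounded A) :
    ∑ k ∈ (finite_innerCells hr hA).toFinset, (a k * r.toNNReal : ℝ≥0∞) ^ d ≤
      (q : ℝ≥0∞) ^ d * μHE[d] (φ '' A) := by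
  have hcell {k : Fin d → ℤ} (hk : k ∈ innerCells r A) : cell r k ⊆ A :=
    (cell_subset_image hr k).trans hk
  have hterm : ∀ k ∈ (finite_innerCells hr hA).toFinset, (a k * r.toNNReal : ℝ≥0∞) ^ d ≤
      (q : ℝ≥0∞) ^ d * (μHE[d]).comap φ (cell r k) := by
    intro k hk
    replace hk : k ∈ innerCells r A := by simpa using hk
    obtain ⟨ha, -, hsim⟩ := h k (nonempty_cell_inter_of_mem_innerCells hr hk)
    rw [hφ.comap_apply, mul_pow, ← ENNReal.ofReal, ← volume_cell hr k]
    exact (hsim.mono fun x hx => ⟨hcell hk hx, cell_subset_image hr k hx⟩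
      ).le_euclideanHausdorffMeasure_image ha
  refine (Finset.sum_le_sum hterm).trans ?_
  rw [← Finset.mul_sum, ← measure_biUnion_cell hr, ← hφ.comap_apply]
  gcongr
  exact Set.iUnion₂_subset fun k hk => hcell hk

theorem HasCellRatios.sum_le_sum_innerCells_add (h : HasCellRatios φ A r q M a) (hr : 0 < r)
    (hA : Bornology.IsBounded A) :
    ∑ k ∈ (finite_cell_inter_nonempty hr hA).toFinset, (a k * r.toNNReal : ℝ≥0∞) ^ d ≤
      ∑ k ∈ (finite_innerCells hr hA).toFinset, (a k * r.toNNReal : ℝ≥0∞) ^ d +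
        (M : ℝ≥0∞) ^ d * volume (⋃ k ∈ boundaryCells r A, cell r k) := by
  classical
  have hunion : (finite_cell_inter_nonempty hr hA).toFinset ⊆
      (finite_innerCells hr hA).toFinset ∪ (finite_boundaryCells hr hA).toFinset := by
    intro k hk
    by_cases hk' : k ∈ innerCells r A <;> simp_all [boundaryCells]
  have hdisj : Disjoint (finite_innerCells hr hA).toFinset (finite_boundaryCells hr hA).toFinset :=
    Finset.disjoint_left.2 fun k hk hk' => by simp_all [boundaryCells]
  refine (Finset.sum_le_sum_of_subset hunion).trans ?_
  rw [Finset.sum_union hdisj, measure_biUnion_cell hr _ (finite_boundaryCells hr hA),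
    Finset.mul_sum]
  refine add_le_add_right (Finset.sum_le_sum fun k hk => ?_) _
  rw [volume_cell hr, mul_pow, ENNReal.ofReal]
  gcongr
  exact (h k ((Set.Finite.mem_toFinset _).1 hk).1).2.1

theorem convex_image_cellMap (r : ℝ) (k : Fin d → ℤ) : Convex ℝ (cellMap r k '' unitCube d) := by
  have himage : cellMap r k '' unitCube d =
      (fun x => r • x) '' ((fun x => WithLp.toLp 2 (fun i => (k i : ℝ)) + x) '' unitCube d) := by
    rw [Set.image_image]
    rfl
  rw [himage]
  exact ((convex_unitCube d).translate _).smul r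

theorem HasCellRatios.exists_isImageCover (h : HasCellRatios φ A r q M a) (hr : 0 < r)
    (hq : 0 < q) (hA : IsCompact A) (hconv : Convex ℝ A) :
    ∃ f, IsImageCover (unitCube d) (φ '' A) f
      fun k : {k | (cell r k ∩ A).Nonempty} => q * (a k * r.toNNReal) := by
  have hproj (k : {k | (cell r k ∩ A).Nonempty}) (v : E d) :=
    exists_forall_dist_le_of_convex
      (hA.inter ((isCompact_unitCube d).image (continuous_cellMap k.1))).isComplete
      (k.2.mono fun x hx => ⟨hx.2, cell_subset_image hr k.1 hx.1⟩)
      (hconv.inter (convex_image_cellMap r k.1)) v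
  choose P hP hPle using hproj
  refine ⟨fun k u => φ (P k (cellMap r k u)), fun k => ?_, fun k u _ => ⟨_, (hP k _).1, rfl⟩, ?_⟩
  · exact mul_pos hq (mul_pos (h k k.2).1 (Real.toNNReal_pos.2 hr))
  rintro _ ⟨x, hxA, rfl⟩
  obtain ⟨k, hk⟩ := exists_mem_cell r x
  obtain ⟨u, hu, rfl⟩ := cell_subset_image hr k hk
  lift k to {k | (cell r k ∩ A).Nonempty} using ⟨_, hk, hxA⟩
  refine ⟨k, u, hu, fun v _ => ?_⟩
  calc edist (φ (cellMap r k u)) (φ (P k (cellMap r k v)))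
      ≤ (q * a k : ℝ≥0) * edist (cellMap r k u) (P k (cellMap r k v)) :=
        ((h k k.2).2.2 _ ⟨hxA, u, hu, rfl⟩ _ (hP k _)).1
    _ ≤ (q * a k : ℝ≥0) * edist (cellMap r k u) (cellMap r k v) := by
        rw [edist_dist, edist_dist (cellMap r k u)]
        gcongr
        exact hPle k _ _ ⟨hxA, u, hu, rfl⟩
    _ = (q * (a k * r.toNNReal) : ℝ≥0) * edist u v := by
        rw [edist_cellMap hr.le, ENNReal.ofReal, ← mul_assoc, ← ENNReal.coe_mul, mul_assoc]

theorem exists_shrink_unitCube (d : ℕ) (hq : 1 < q) : ∃ σ : E d → E d, Continuous σ ∧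
    Function.Surjective σ ∧ (∀ x y, edist x y = q * edist (σ x) (σ y)) ∧
      ∀ u ∈ unitCube d, ∀ i, σ u i ∈ Set.Ioo (0 : ℝ) 1 := by
  have hq₀ : q ≠ 0 := (one_pos.trans hq).ne'
  have hq₁ : (1 : ℝ) < q := hq
  refine ⟨fun u => q⁻¹ • u + WithLp.toLp 2 fun _ => (1 - (q : ℝ)⁻¹) / 2, by fun_prop, fun v => ?_,
    fun x y => ?_, fun u hu i => ?_⟩
  · exact ⟨q • (v - WithLp.toLp 2 fun _ => (1 - (q : ℝ)⁻¹) / 2), by simp [smul_smul, hq₀]⟩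
  · rw [edist_add_right, edist_nndist, edist_nndist, NNReal.smul_def, NNReal.smul_def, nndist_smul₀,
      ← ENNReal.coe_mul, ← mul_assoc]
    simp [hq₀]
  · have hinv : (q : ℝ)⁻¹ < 1 := inv_lt_one_of_one_lt₀ hq₁
    have hle : (q : ℝ)⁻¹ * u i ≤ (q : ℝ)⁻¹ := mul_le_of_le_one_right (by positivity) (hu i).2
    have hpos : 0 ≤ (q : ℝ)⁻¹ * u i := mul_nonneg (by positivity) (hu i).1
    simp only [PiLp.add_apply, PiLp.smul_apply, NNReal.smul_def, NNReal.coe_inv, smul_eq_mul,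
      Set.mem_Ioo]
    constructor <;> linarith

theorem exists_pos_forall_le_edist {Y : Type*} [EMetricSpace Y] {ι : Type*} [Finite ι]
    {S T : ι → Set Y} (hS : ∀ i, IsCompact (S i)) (hT : ∀ i, IsClosed (T i))
    (h : ∀ i, Disjoint (S i) (T i)) :
    ∃ δ : ℝ≥0, 0 < δ ∧ ∀ i, ∀ x ∈ S i, ∀ y ∈ T i, (δ : ℝ≥0∞) ≤ edist x y := by
  have hev (i : ι) : ∀ᶠ δ : ℝ≥0 in 𝓝[>] 0, ∀ x ∈ S i, ∀ y ∈ T i, (δ : ℝ≥0∞) ≤ edist x y := by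
    obtain ⟨ε, hε, hlt⟩ := Metric.exists_pos_forall_lt_edist (hS i) (hT i) (h i)
    filter_upwards [Ioo_mem_nhdsGT hε] with δ hδ x hx y hy
    exact (ENNReal.coe_le_coe.2 hδ.2.le).trans (hlt x hx y hy).le
  obtain ⟨δ, hδ, hpos⟩ := ((eventually_all.2 hev).and self_mem_nhdsWithin).exists
  exact ⟨δ, hpos, hδ⟩

theorem IsConformalChart.isClosed_sdiff_image_interior_cell (h : IsConformalChart φ w)
    (hA : IsCompact A) {Z : Set X} (hAZ : φ '' A ⊆ Z) (hZ : IsClosed (Z \ φ '' interior A))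
    {k : Fin d → ℤ} (hk : cell r k ⊆ A) : IsClosed (Z \ φ '' interior (cell r k)) := by
  have hunion : Z \ φ '' interior (cell r k) =
      Z \ φ '' interior A ∪ φ '' (A \ interior (cell r k)) := by
    refine Set.Subset.antisymm (fun z hz => ?_) (Set.union_subset
      (Set.sdiff_subset_sdiff_right (Set.image_mono (interior_mono hk))) ?_)
    · by_cases hzA : z ∈ φ '' interior A
      · obtain ⟨x, hx, rfl⟩ := hzA
        exact .inr ⟨x, ⟨interior_subset hx, fun hx' => hz.2 ⟨x, hx', rfl⟩⟩, rfl⟩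
      · exact .inl ⟨hz.1, hzA⟩
    · rw [Set.image_sdiff h.injective]
      exact Set.sdiff_subset_sdiff_left hAZ
  rw [hunion]
  exact hZ.union ((hA.diff isOpen_interior).image h.continuous).isClosed

theorem HasCellRatios.mul_edist_le_edist_cellMap (h : HasCellRatios φ A r q M a) (hr : 0 < r)
    (hq : q ≠ 0) {k : Fin d → ℤ} (hk : k ∈ innerCells r A) {x y : E d} (hx : x ∈ unitCube d)
    (hy : y ∈ unitCube d) :
    ((a k * r.toNNReal / q : ℝ≥0) : ℝ≥0∞) * edist x y ≤
      edist (φ (cellMap r k x)) (φ (cellMap r k y)) := by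
  have hmem {u : E d} (hu : u ∈ unitCube d) : cellMap r k u ∈ A ∩ cellMap r k '' unitCube d :=
    ⟨hk ⟨u, hu, rfl⟩, u, hu, rfl⟩
  calc ((a k * r.toNNReal / q : ℝ≥0) : ℝ≥0∞) * edist x y
      = (a k * edist (cellMap r k x) (cellMap r k y)) / q := by
        rw [edist_cellMap hr.le, ENNReal.coe_div hq, ENNReal.ofReal, ENNReal.coe_mul,
          ENNReal.mul_div_right_comm.symm, mul_assoc]
    _ ≤ edist (φ (cellMap r k x)) (φ (cellMap r k y)) :=
        ENNReal.div_le_of_le_mul' ((h k (nonempty_cell_inter_of_mem_innerCells hr hk)).2.2 _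
          (hmem hx) _ (hmem hy)).2

theorem HasCellRatios.exists_isImagePacking (h : HasCellRatios φ A r q M a)
    (hφ : IsConformalChart φ w) (hr : 0 < r) (hq : 1 < q) (hA : IsCompact A) {Z : Set X}
    (hAZ : φ '' A ⊆ Z) (hZ : IsClosed (Z \ φ '' interior A)) :
    ∃ g W δ, IsImagePacking (unitCube d) Z g W
      (fun k : innerCells r A => a k * r.toNNReal / q ^ 2) δ := by
  have hratio (k : innerCells r A) := h k (nonempty_cell_inter_of_mem_innerCells hr k.2)
  obtain ⟨σ, hσ, hsurj, hedist, hmem⟩ := exists_shrink_unitCube d hq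
  have hσmem {u : E d} (hu : u ∈ unitCube d) : σ u ∈ unitCube d :=
    fun i => Set.Ioo_subset_Icc_self (hmem u hu i)
  have := (finite_innerCells hr hA.isBounded).to_subtype
  obtain ⟨δ, hδ, hle⟩ := exists_pos_forall_le_edist
    (fun k : innerCells r A => (isCompact_unitCube d).image
      (hφ.continuous.comp ((continuous_cellMap k.1).comp hσ)))
    (fun k => hφ.isClosed_sdiff_image_interior_cell hA hAZ hZ
      ((cell_subset_image hr k.1).trans k.2))
    fun k => Set.disjoint_left.2 <| by
      rintro _ ⟨u, hu, rfl⟩ hz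
      exact hz.2 ⟨_, cellMap_mem_interior_cell hr k.1 (hmem u hu), rfl⟩
  refine ⟨fun k u => φ (cellMap r k (σ u)), fun k => φ '' interior (cell r k), δ, hδ, fun k => ?_,
    fun k u hu => hAZ ⟨_, k.2 ⟨_, hσmem hu, rfl⟩, rfl⟩, fun k k' hkk' => ?_,
    fun k u hu z hz hzW => hle k _ ⟨u, hu, rfl⟩ z ⟨hz, hzW⟩, ?_⟩
  · exact div_pos (mul_pos (hratio k).1 (Real.toNNReal_pos.2 hr)) (pow_pos (one_pos.trans hq) 2)
  · exact (Set.disjoint_image_iff hφ.injective).2 ((pairwise_disjoint_cell d r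
      (Subtype.coe_injective.ne hkk')).mono interior_subset interior_subset)
  rintro k _ - ⟨y, hy, rfl⟩
  obtain ⟨v, hv, rfl⟩ := cell_subset_image hr k.1 (interior_subset hy)
  obtain ⟨v', rfl⟩ := hsurj v
  obtain ⟨x, hx, hxle⟩ := exists_forall_dist_le_of_convex (isCompact_unitCube d).isComplete
    (unitCube_nonempty d) (convex_unitCube d) v'
  refine ⟨x, hx, fun u hu => ?_⟩
  have hq₀ : q ≠ 0 := (one_pos.trans hq).ne'
  calc ((a k * r.toNNReal / q ^ 2 : ℝ≥0) : ℝ≥0∞) * edist u x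
      ≤ (a k * r.toNNReal / q ^ 2 : ℝ≥0) * edist u v' := by
        rw [edist_dist, edist_dist u]
        gcongr
        exact hxle u hu
    _ = (a k * r.toNNReal / q : ℝ≥0) * edist (σ u) (σ v') := by
        rw [hedist, ← mul_assoc, ← ENNReal.coe_mul]
        congr 2
        field_simp
    _ ≤ edist (φ (cellMap r k (σ u))) (φ (cellMap r k (σ v'))) :=
        h.mul_edist_le_edist_cellMap hr hq₀ k.2 (hσmem hu) hv

end CellRatios

namespace IsConformalChart

variable (h : IsConformalChart φ w)
include h

theorem exists_hasCellRatios_lt (hA : IsCompact A) (hA₀ : volume (frontier A) = 0)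
    {U V : ℝ≥0∞} (hUV : U < V) : ∃ q > 1, ∃ r > 0, ∃ M a, HasCellRatios φ A r q M a ∧
      (q : ℝ≥0∞) ^ d * ((q : ℝ≥0∞) ^ (2 * d) * U +
        (M : ℝ≥0∞) ^ d * volume (⋃ k ∈ boundaryCells r A, cell r k)) < V := by
  obtain ⟨M, hM⟩ := h.exists_hasCellRatios hA
  have hpow (n : ℕ) : Tendsto (fun q : ℝ≥0 => (q : ℝ≥0∞) ^ n) (𝓝[>] 1) (𝓝 1) := by
    have hcont : Continuous fun q : ℝ≥0 => (q : ℝ≥0∞) ^ n := by fun_prop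
    simpa using (hcont.tendsto 1).mono_left nhdsWithin_le_nhds
  have hq_lim : Tendsto (fun q : ℝ≥0 => (q : ℝ≥0∞) ^ d * ((q : ℝ≥0∞) ^ (2 * d) * U)) (𝓝[>] 1)
      (𝓝 U) := by
    simpa using ENNReal.Tendsto.mul (hpow d) (.inl one_ne_zero)
      (ENNReal.Tendsto.mul_const (hpow (2 * d)) (.inl one_ne_zero)) (.inr ENNReal.one_ne_top)
  obtain ⟨q, hqV, hq⟩ := ((hq_lim.eventually (gt_mem_nhds hUV)).and self_mem_nhdsWithin).exists
  have hr_lim : Tendsto (fun r => (q : ℝ≥0∞) ^ d * ((q : ℝ≥0∞) ^ (2 * d) * U +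
      (M : ℝ≥0∞) ^ d * volume (⋃ k ∈ boundaryCells r A, cell r k))) (𝓝[>] 0)
      (𝓝 ((q : ℝ≥0∞) ^ d * ((q : ℝ≥0∞) ^ (2 * d) * U))) := by
    have hvol := ENNReal.Tendsto.const_mul (tendsto_volume_boundaryCells hA hA₀)
      (.inr (ENNReal.pow_ne_top (n := d) (ENNReal.coe_ne_top (r := M))))
    simpa using ENNReal.Tendsto.const_mul (hvol.const_add ((q : ℝ≥0∞) ^ (2 * d) * U))
      (.inr (ENNReal.pow_ne_top (n := d) (ENNReal.coe_ne_top (r := q))))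
  obtain ⟨r, ⟨hrV, a, ha⟩, hr⟩ := (((hr_lim.eventually (gt_mem_nhds hqV)).and (hM q hq)).and
    self_mem_nhdsWithin).exists
  exact ⟨q, hq, r, hr, M, a, ha, hrV⟩

variable [MeasurableSpace X] [BorelSpace X]

theorem measurableEmbedding : MeasurableEmbedding φ :=
  h.continuous.measurableEmbedding h.injective

theorem hasImageCovers (hA : IsCompact A) (hconv : Convex ℝ A) (hA₀ : volume (frontier A) = 0) :
    HasImageCovers d (φ '' A) (μHE[d] (φ '' A)) := by
  intro V' hV'
  obtain ⟨q, hq, r, hr, M, a, ha, hlt⟩ := h.exists_hasCellRatios_lt hA hA₀ hV'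
  obtain ⟨f, hf⟩ := ha.exists_isImageCover hr (one_pos.trans hq) hA hconv
  have hfin := finite_cell_inter_nonempty hr hA.isBounded
  let := hfin.fintype
  refine ⟨_, inferInstance, f, _, hf, le_trans ?_ hlt.le⟩
  have hq₁ : (1 : ℝ≥0∞) ≤ (q : ℝ≥0∞) := ENNReal.one_le_coe_iff.2 hq.le
  push_cast
  simp_rw [mul_pow _ (_ * _), ← Finset.mul_sum]
  gcongr
  rw [← Finset.sum_subtype hfin.toFinset (fun k => hfin.mem_toFinset)
    fun k => ((a k : ℝ≥0∞) * r.toNNReal) ^ d]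
  refine (ha.sum_le_sum_innerCells_add hr hA.isBounded).trans ?_
  gcongr
  refine (ha.sum_innerCells_le h.measurableEmbedding hr hA.isBounded).trans ?_
  gcongr
  exact Nat.le_mul_of_pos_left d two_pos

theorem hasImagePackings (hA : IsCompact A) (hA₀ : volume (frontier A) = 0) {Z : Set X}
    (hAZ : φ '' A ⊆ Z) (hZ : IsClosed (Z \ φ '' interior A)) :
    HasImagePackings d Z (μHE[d] (φ '' A)) := by
  intro V' hV'
  obtain ⟨q, hq, r, hr, M, a, ha, hlt⟩ := h.exists_hasCellRatios_lt hA hA₀ hV'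
  obtain ⟨g, W, δ, hg⟩ := ha.exists_isImagePacking h hr hq hA hAZ hZ
  have hfin := finite_innerCells hr hA.isBounded
  let := hfin.fintype
  refine ⟨_, inferInstance, g, W, _, δ, hg, ?_⟩
  have hsum := hlt.trans_le (ha.euclideanHausdorffMeasure_image_le hr hA.isBounded)
  replace hsum := (lt_of_mul_lt_mul_left' hsum).trans_le
    (ha.sum_le_sum_innerCells_add hr hA.isBounded)
  replace hsum := (lt_of_add_lt_add_right hsum).le
  have hq₁ : q ^ (2 * d) ≠ 0 := pow_ne_zero _ (one_pos.trans hq).ne'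
  simp_rw [div_pow, ← pow_mul, ← Finset.sum_div]
  rw [ENNReal.coe_div hq₁, ENNReal.le_div_iff_mul_le (.inl (ENNReal.coe_ne_zero.2 hq₁))
    (.inl ENNReal.coe_ne_top), mul_comm]
  push_cast
  rw [← Finset.sum_subtype hfin.toFinset (fun k => hfin.mem_toFinset)
    fun k => ((a k : ℝ≥0∞) * r.toNNReal) ^ d]
  exact hsum

omit [MeasurableSpace X] [BorelSpace X] in
theorem exists_isNearSimilarityOn (hA : IsCompact A) :
    ∃ q a, 0 < a ∧ IsNearSimilarityOn φ A q a := by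
  have hw : Continuous fun z : E d × E d => w z.1 * w z.2 :=
    (h.continuous_weight.comp continuous_fst).mul (h.continuous_weight.comp continuous_snd)
  obtain ⟨M, hM⟩ := (hA.prod hA).bddAbove_image hw.continuousOn
  obtain ⟨m, hm₀, hm⟩ := (hA.prod hA).exists_forall_le' hw.continuousOn (a := 0)
    fun z _ => mul_pos (h.weight_pos z.1) (h.weight_pos z.2)
  refine ⟨M / m + 1, m, hm₀, fun x hx y hy => ?_⟩
  rw [h.edist_eq, ← mul_assoc, ← ENNReal.coe_mul]
  refine ⟨mul_le_mul_left (ENNReal.coe_le_coe.2 ?_) _, mul_le_mul_left (ENNReal.coe_le_coe.2 ?_) _⟩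
  · rw [add_mul, div_mul_cancel₀ _ hm₀.ne']
    exact (hM ⟨(x, y), ⟨hx, hy⟩, rfl⟩).trans le_self_add
  · exact (hm (x, y) ⟨hx, hy⟩).trans (le_mul_of_one_le_left' le_add_self)

theorem euclideanHausdorffMeasure_image_ne_top (hA : IsCompact A) : μHE[d] (φ '' A) ≠ ∞ := by
  obtain ⟨q, a, -, hsim⟩ := h.exists_isNearSimilarityOn hA
  exact ne_top_of_le_ne_top (ENNReal.mul_ne_top (ENNReal.pow_ne_top ENNReal.coe_ne_top)
    hA.measure_ne_top) hsim.euclideanHausdorffMeasure_image_le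

theorem euclideanHausdorffMeasure_image_ne_zero (hA : IsCompact A) (hA₀ : volume A ≠ 0) :
    μHE[d] (φ '' A) ≠ 0 := by
  obtain ⟨q, a, ha, hsim⟩ := h.exists_isNearSimilarityOn hA
  intro hzero
  have hle := hsim.le_euclideanHausdorffMeasure_image ha
  rw [hzero, mul_zero, nonpos_iff_eq_zero, mul_eq_zero] at hle
  exact hle.elim (pow_ne_zero d (ENNReal.coe_ne_zero.2 ha.ne')) hA₀

theorem isWellTiled_image (hA : IsCompact A) (hconv : Convex ℝ A) (hint : (interior A).Nonempty) :
    IsWellTiled d (φ '' A) (μHE[d] (φ '' A)) where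
  nonempty := (hint.mono interior_subset).image φ
  ne_zero := h.euclideanHausdorffMeasure_image_ne_zero hA
    (Measure.measure_pos_of_nonempty_interior volume hint).ne'
  ne_top := h.euclideanHausdorffMeasure_image_ne_top hA
  hasImageCovers := h.hasImageCovers hA hconv (hconv.addHaar_frontier volume)
  hasImagePackings := h.hasImagePackings hA (hconv.addHaar_frontier volume) subset_rfl <| by
    rw [← Set.image_sdiff h.injective]
    exact ((hA.diff isOpen_interior).image h.continuous).isClosed

end IsConformalChart

theorem isWellTiled_of_convex {A : Set (E d)} (hA : IsCompact A) (hconv : Convex ℝ A)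
    (hint : (interior A).Nonempty) : IsWellTiled d A (μHE[d] A) := by
  simpa using (isConformalChart_of_isometry isometry_id).isWellTiled_image hA hconv hint

theorem nonempty_interior_unitCube (d : ℕ) : (interior (unitCube d)).Nonempty := by
  refine ⟨WithLp.toLp 2 fun _ => 1 / 2, ?_⟩
  rw [unitCube_eq_preimage]
  refine preimage_interior_subset_interior_preimage (PiLp.continuous_ofLp 2 _) ?_
  simp only [interior_pi_set Set.finite_univ, interior_Icc]
  intro i _
  simp only [Set.mem_Ioo]
  norm_num

theorem isWellTiled_unitCube (d : ℕ) : IsWellTiled d (unitCube d) (μHE[d] (unitCube d)) :=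
  isWellTiled_of_convex (isCompact_unitCube d) (convex_unitCube d) (nonempty_interior_unitCube d)

end ConformalChart

section Sphere

variable {F : Type*} [NormedAddCommGroup F] [InnerProductSpace ℝ F] {d : ℕ}

/-- The spherical cap with center `e` and height `t`. -/
def sphereCap (e : F) (t : ℝ) : Set F := {x | x ∈ sphere (0 : F) 1 ∧ t ≤ inner ℝ e x}

theorem sphereCap_anti (e : F) : Antitone (sphereCap e) := fun _ _ h _ hx => ⟨hx.1, h.trans hx.2⟩

theorem isClosed_sphereCap (e : F) (t : ℝ) : IsClosed (sphereCap e t) :=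
  isClosed_sphere.inter <|
    isClosed_le (f := fun _ => t) continuous_const (continuous_const.inner continuous_id)

theorem sphereCap_union_sphereCap_neg (e : F) (t : ℝ) :
    sphereCap e t ∪ sphereCap (-e) (-t) = sphere (0 : F) 1 := by
  ext x
  have : t ≤ inner ℝ e x ∨ -t ≤ inner ℝ (-e) x := by
    simpa only [inner_neg_left, neg_le_neg_iff] using le_total t (inner ℝ e x)
  simp only [sphereCap, Set.mem_union, Set.mem_ofPred_eq, ← and_or_left]
  tauto

theorem iInter_sphereCap (e : sphere (0 : F) 1) :
    ⋂ t > (-1 : ℝ), sphereCap (e : F) (-t) = {↑e} := by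
  ext x
  simp only [Set.mem_iInter, Set.mem_singleton_iff]
  constructor
  · intro hx
    have hnorm : ‖x‖ = 1 := by simpa using (hx 0 (by norm_num)).1
    rw [eq_comm, ← inner_eq_one_iff_of_norm_eq_one (𝕜 := ℝ) (norm_eq_of_mem_sphere e) hnorm]
    refine le_antisymm ((real_inner_le_norm _ _).trans (by simp [hnorm])) ?_
    rw [← neg_neg (inner ℝ _ _), le_neg]
    exact le_of_forall_gt_imp_ge_of_dense fun t ht => neg_le.1 (hx t ht).2
  · rintro rfl t ht
    exact ⟨e.2, by simpa using (neg_lt.1 ht).le⟩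

variable [Fact (Module.finrank ℝ F = d + 1)]

/-- The inverse stereographic projection onto the sphere from the pole `-e`. -/
noncomputable def stereoInv (e : sphere (0 : F) 1) (x : E d) : F := (stereographic' d (-e)).symm x

theorem exists_orthogonal_stereoInv_eq (e : sphere (0 : F) 1) :
    ∃ U : E d →ₗᵢ[ℝ] F, (∀ x, inner ℝ (e : F) (U x) = 0) ∧
      ∀ x, stereoInv e x = (‖x‖ ^ 2 + 4)⁻¹ • ((4 : ℝ) • U x + (4 - ‖x‖ ^ 2) • (e : F)) := by
  let B := (OrthonormalBasis.fromOrthogonalSpanSingleton (𝕜 := ℝ) d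
    (ne_zero_of_mem_unit_sphere (-e))).repr
  let U : E d →ₗᵢ[ℝ] F := (Submodule.subtypeₗᵢ _).comp B.symm.toLinearIsometry
  refine ⟨U, fun x => ?_, fun x => ?_⟩
  · have h : inner ℝ (↑(-e) : F) (U x) = 0 :=
      Submodule.mem_orthogonal_singleton_iff_inner_right.1 (B.symm x).2
    simpa using h
  · have h : stereoInv e x = (‖U x‖ ^ 2 + 4)⁻¹ • (4 : ℝ) • U x +
        (‖U x‖ ^ 2 + 4)⁻¹ • (‖U x‖ ^ 2 - 4) • (↑(-e) : F) := stereographic'_symm_apply (-e) x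
    rw [h, U.norm_map, smul_add, show (↑(-e) : F) = -e from rfl, smul_neg, ← neg_smul, neg_sub]

theorem inner_stereoInv (e : sphere (0 : F) 1) (x y : E d) :
    inner ℝ (stereoInv e x) (stereoInv e y) =
      (16 * inner ℝ x y + (4 - ‖x‖ ^ 2) * (4 - ‖y‖ ^ 2)) / ((‖x‖ ^ 2 + 4) * (‖y‖ ^ 2 + 4)) := by
  obtain ⟨U, horth, hU⟩ := exists_orthogonal_stereoInv_eq (d := d) e
  have horth' (x : E d) : inner ℝ (U x) (e : F) = 0 := by rw [real_inner_comm, horth]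
  simp only [hU, inner_add_left, inner_add_right, inner_smul_left, inner_smul_right, horth, horth',
    U.inner_map_map, real_inner_self_eq_norm_sq, norm_eq_of_mem_sphere, conj_trivial]
  field_simp
  ring

theorem inner_pole_stereoInv (e : sphere (0 : F) 1) (x : E d) :
    inner ℝ (e : F) (stereoInv e x) = (4 - ‖x‖ ^ 2) / (‖x‖ ^ 2 + 4) := by
  obtain ⟨U, horth, hU⟩ := exists_orthogonal_stereoInv_eq (d := d) e
  simp only [hU, inner_add_right, inner_smul_right, horth, real_inner_self_eq_norm_sq,
    norm_eq_of_mem_sphere]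
  field_simp
  ring

theorem stereoInv_mem_sphere (e : sphere (0 : F) 1) (x : E d) : stereoInv e x ∈ sphere (0 : F) 1 :=
  ((stereographic' d (-e)).symm x).2

theorem isConformalChart_stereoInv (e : sphere (0 : F) 1) :
    IsConformalChart (stereoInv (d := d) e) fun x => 2 / NNReal.sqrt (‖x‖₊ ^ 2 + 4) := by
  refine ⟨?_, fun x => by positivity, fun x y => ?_⟩
  · exact continuous_const.div₀ (by fun_prop) fun x => by positivity
  · have hx : 0 < ‖x‖ ^ 2 + 4 := by positivity
    have hy : 0 < ‖y‖ ^ 2 + 4 := by positivity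
    rw [edist_nndist, edist_nndist, ← ENNReal.coe_mul, ENNReal.coe_inj, ← NNReal.coe_inj,
      ← sq_eq_sq₀ NNReal.zero_le_coe NNReal.zero_le_coe]
    push_cast
    have hnorm (x : E d) : ‖stereoInv e x‖ = 1 := by simpa using stereoInv_mem_sphere e x
    rw [dist_eq_norm, dist_eq_norm, mul_pow, mul_pow,
      div_pow, div_pow, Real.sq_sqrt hx.le, Real.sq_sqrt hy.le, norm_sub_sq_real, norm_sub_sq_real,
      inner_stereoInv, hnorm, hnorm]
    field_simp
    ring

theorem exists_stereoInv_eq {e : sphere (0 : F) 1} {z : F} (hz : z ∈ sphere (0 : F) 1)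
    (hze : z ≠ -e) : ∃ x : E d, stereoInv e x = z := by
  have hsource : (⟨z, hz⟩ : sphere (0 : F) 1) ∈ (stereographic' d (-e)).source := by
    simpa [Subtype.ext_iff] using hze
  exact ⟨stereographic' d (-e) ⟨z, hz⟩,
    congrArg Subtype.val ((stereographic' d (-e)).left_inv hsource)⟩

section Cap

variable (e : sphere (0 : F) 1) {t : ℝ}

/-- The radius of the ball that the stereographic projection from the antipode of its center maps a
spherical cap of height `t` onto. -/
noncomputable def capRadius (t : ℝ) : ℝ := √(4 * (1 - t) / (1 + t))

theorem capRadius_pos (ht : t ∈ Set.Ioo (-1) 1) : 0 < capRadius t :=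
  Real.sqrt_pos.2 (div_pos (by linarith [ht.2]) (by linarith [ht.1]))

theorem norm_le_capRadius_iff (ht : t ∈ Set.Ioo (-1) 1) (x : E d) :
    ‖x‖ ≤ capRadius t ↔ t ≤ inner ℝ (e : F) (stereoInv e x) := by
  have ht₁ : 0 < 1 + t := by linarith [ht.1]
  rw [inner_pole_stereoInv, capRadius, Real.le_sqrt (norm_nonneg _)
    (div_nonneg (by linarith [ht.2]) ht₁.le), le_div_iff₀ ht₁, le_div_iff₀ (by positivity)]
  constructor <;> intro h <;> linarith

theorem norm_lt_capRadius_iff (ht : t ∈ Set.Ioo (-1) 1) (x : E d) :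
    ‖x‖ < capRadius t ↔ t < inner ℝ (e : F) (stereoInv e x) := by
  have ht₁ : 0 < 1 + t := by linarith [ht.1]
  rw [inner_pole_stereoInv, capRadius, Real.lt_sqrt (norm_nonneg _), lt_div_iff₀ ht₁,
    lt_div_iff₀ (by positivity)]
  constructor <;> intro h <;> linarith

theorem image_closedBall_stereoInv (ht : t ∈ Set.Ioo (-1) 1) :
    stereoInv e '' closedBall (0 : E d) (capRadius t) = sphereCap (e : F) t := by
  ext z
  constructor
  · rintro ⟨x, hx, rfl⟩
    rw [mem_closedBall_zero_iff, norm_le_capRadius_iff e ht] at hx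
    exact ⟨stereoInv_mem_sphere e x, hx⟩
  · rintro ⟨hz, hzt⟩
    obtain ⟨x, rfl⟩ := exists_stereoInv_eq (d := d) (e := e) hz <| by
      rintro rfl
      rw [inner_neg_right, real_inner_self_eq_norm_sq, norm_eq_of_mem_sphere] at hzt
      linarith [ht.1]
    exact ⟨x, mem_closedBall_zero_iff.2 ((norm_le_capRadius_iff e ht x).2 hzt), rfl⟩

theorem isClosed_sphere_sdiff_image_stereoInv (ht : t ∈ Set.Ioo (-1) 1) :
    IsClosed (sphere (0 : F) 1 \ stereoInv e '' ball (0 : E d) (capRadius t)) := by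
  have hdiff : sphere (0 : F) 1 \ stereoInv e '' ball (0 : E d) (capRadius t) =
      sphereCap (-e : F) (-t) := by
    ext z
    simp only [sphereCap, inner_neg_left, neg_le_neg_iff, Set.mem_sdiff, Set.mem_ofPred_eq]
    refine and_congr_right fun hz => ⟨fun h => not_lt.1 fun hlt => h ?_, ?_⟩
    · obtain ⟨x, -, rfl⟩ := (image_closedBall_stereoInv (d := d) e ht).ge ⟨hz, hlt.le⟩
      exact ⟨x, mem_ball_zero_iff.2 ((norm_lt_capRadius_iff e ht x).2 hlt), rfl⟩
    · rintro hle ⟨x, hx, rfl⟩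
      exact ((norm_lt_capRadius_iff e ht x).1 (mem_ball_zero_iff.1 hx)).not_ge hle
  rw [hdiff]
  exact isClosed_sphereCap _ _

variable [MeasurableSpace F] [BorelSpace F]

theorem isWellTiled_sphereCap (ht : t ∈ Set.Ioo (-1) 1) :
    IsWellTiled d (sphereCap (e : F) t) (μHE[d] (sphereCap (e : F) t)) := by
  rw [← image_closedBall_stereoInv (d := d) e ht]
  refine (isConformalChart_stereoInv e).isWellTiled_image (isCompact_closedBall _ _)
    (convex_closedBall _ _) ?_
  exact ⟨0, ball_subset_interior_closedBall (mem_ball_self (capRadius_pos ht))⟩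

theorem hasImagePackings_sphere (ht : t ∈ Set.Ioo (-1) 1) :
    HasImagePackings d (sphere (0 : F) 1) (μHE[d] (sphereCap (e : F) t)) := by
  rw [← image_closedBall_stereoInv (d := d) e ht]
  refine (isConformalChart_stereoInv e).hasImagePackings (isCompact_closedBall _ _)
    ((convex_closedBall _ _).addHaar_frontier volume) ?_ ?_
  · rintro _ ⟨x, -, rfl⟩
    exact stereoInv_mem_sphere e x
  · rw [interior_closedBall _ (capRadius_pos ht).ne']
    exact isClosed_sphere_sdiff_image_stereoInv e ht

theorem exists_euclideanHausdorffMeasure_sphereCap_lt (hd : d ≠ 0) {ε : ℝ≥0∞} (hε : 0 < ε) :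
    ∃ t ∈ Set.Ioo (-1 : ℝ) 1, μHE[d] (sphereCap (e : F) (-t)) < ε := by
  have hlim := tendsto_measure_biInter_gt (μ := μHE[d]) (s := fun t => sphereCap (e : F) (-t))
    (a := (-1 : ℝ)) (fun t _ => (isClosed_sphereCap _ _).nullMeasurableSet)
    (fun s t _ hst => sphereCap_anti _ (neg_le_neg hst))
    ⟨0, by norm_num, by simpa using (isWellTiled_sphereCap (d := d) e (t := 0) (by simp)).ne_top⟩
  have := Measure.nullSingletonClass_hausdorff F (d := d) (by positivity)
  rw [iInter_sphereCap, Measure.euclideanHausdorffMeasure_def, Measure.smul_apply,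
    measure_singleton, smul_zero, ← Measure.euclideanHausdorffMeasure_def] at hlim
  obtain ⟨t, hlt, ht⟩ := ((hlim.eventually (gt_mem_nhds hε)).and
    (Ioo_mem_nhdsGT (by norm_num : (-1 : ℝ) < 1))).exists
  exact ⟨t, ht, hlt⟩

end Cap

theorem isWellTiled_sphere [MeasurableSpace F] [BorelSpace F] (hd : d ≠ 0) :
    IsWellTiled d (sphere (0 : F) 1) (μHE[d] (sphere (0 : F) 1)) := by
  have : Nontrivial F := Module.nontrivial_of_finrank_pos (R := ℝ)
    ((Fact.out : Module.finrank ℝ F = d + 1) ▸ d.succ_pos)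
  obtain ⟨e, he⟩ := NormedSpace.sphere_nonempty (E := F) (x := 0) |>.2 zero_le_one
  lift e to sphere (0 : F) 1 using he
  have hneg {t : ℝ} (ht : t ∈ Set.Ioo (-1) 1) : -t ∈ Set.Ioo (-1 : ℝ) 1 :=
    ⟨neg_lt_neg ht.2, neg_lt.1 ht.1⟩
  have hunion (t : ℝ) : sphereCap (↑(-e) : F) t ∪ sphereCap (e : F) (-t) = sphere (0 : F) 1 := by
    simpa using sphereCap_union_sphereCap_neg (-e : F) t
  have hle (t : ℝ) : μHE[d] (sphere (0 : F) 1) ≤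
      μHE[d] (sphereCap (↑(-e) : F) t) + μHE[d] (sphereCap (e : F) (-t)) :=
    (measure_mono (hunion t).ge).trans (measure_union_le _ _)
  have hcap := isWellTiled_sphereCap (F := F) (d := d) (t := 0)
  have hne_top : μHE[d] (sphere (0 : F) 1) ≠ ∞ := ne_top_of_le_ne_top
    (ENNReal.add_ne_top.2 ⟨(hcap (-e) (by simp)).ne_top, by simpa using (hcap e (by simp)).ne_top⟩)
    (hle 0)
  refine ⟨⟨e, e.2⟩, ?_, hne_top, fun V' hV' => ?_, fun V' hV' => ?_⟩
  · exact ne_bot_of_le_ne_bot (hcap e (by simp)).ne_zero (measure_mono fun x hx => hx.1)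
  · obtain ⟨t, ht, hlt⟩ := exists_euclideanHausdorffMeasure_sphereCap_lt e hd (tsub_pos_of_lt hV')
    have hcov := (isWellTiled_sphereCap (d := d) (-e) ht).hasImageCovers.union
      (isWellTiled_sphereCap (d := d) e (hneg ht)).hasImageCovers
    rw [hunion] at hcov
    refine hcov V' (lt_of_le_of_lt (add_le_add_left (measure_mono fun x hx => hx.1) _) ?_)
    exact lt_tsub_iff_left.1 hlt
  · obtain ⟨t, ht, hlt⟩ := exists_euclideanHausdorffMeasure_sphereCap_lt e hd (tsub_pos_of_lt hV')
    refine hasImagePackings_sphere (-e) ht V' ?_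
    have := (lt_tsub_iff_right.1 hlt).trans_le (hle t)
    rw [add_comm] at this
    exact lt_of_add_lt_add_right this

end Sphere

theorem IsStronglyConvexBody.isWellTiled {d : ℕ} {A : Set (E d)} (hA : IsStronglyConvexBody A) :
    IsWellTiled d A (μHE[d] A) := by
  refine isWellTiled_of_convex hA.isCompact hA.convex ?_
  rw [← closure_nonempty_iff, hA.closure_interior]
  exact hA.nonempty

theorem IsAdmissibleOrCube.isWellTiled {d ℓ : ℕ} (hd : d ≠ 0) {A : Set (E ℓ)}
    (h : IsAdmissibleOrCube d ℓ A) : IsWellTiled d A (μHE[d] A) := by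
  have : Fact (Module.finrank ℝ (E (d + 1)) = d + 1) := ⟨finrank_euclideanSpace_fin⟩
  cases h with
  | admissible ℓ A hA =>
    cases hA with
    | stronglyConvex A hA => exact hA.isWellTiled
    | sphere => exact isWellTiled_sphere hd
    | cap e he t ht ht' => exact isWellTiled_sphereCap ⟨e, by simpa using he⟩ ⟨ht, ht'⟩
  | cube => exact isWellTiled_unitCube d

section LargeExponent

theorem inv_le_lpPolarization_top_add {X : Type*} [PseudoEMetricSpace X] {A : Set X}
    (hA : A.Nonempty) {N m : ℕ} (ω : Fin N → A) {t : ℝ≥0}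
    (hm : packingNumber t {y ∈ A | ∀ j, t < edist y (ω j : X)} ≤ m) :
    (t : ℝ≥0∞)⁻¹ ≤ lpPolarization ∞ A (N + m) := by
  set Z : Set X := {y ∈ A | ∀ j, t < edist y (ω j : X)}
  have hm' : coveringNumber t Z ≤ m := (coveringNumber_le_packingNumber t Z).trans hm
  obtain ⟨C, hCZ, hC_fin, hC_cover, hC_card⟩ :=
    exists_set_encard_eq_coveringNumber (hm'.trans_lt (ENat.natCast_lt_top m)).ne
  have : Fintype C := hC_fin.fintype
  have hcard : Fintype.card (Fin N ⊕ C) ≤ N + m := by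
    rw [Fintype.card_sum, Fintype.card_fin, ← Nat.card_eq_fintype_card, Nat.card_coe_set_eq]
    rw [← hC_card, ← hC_fin.cast_ncard_eq, Nat.cast_le] at hm'
    gcongr
  let ω' : Fin N ⊕ C → A := Sum.elim ω fun c => ⟨c, (hCZ c.2).1⟩
  refine le_trans (le_iInf fun y => ?_) (le_lpPolarization hA hcard ω')
  obtain ⟨k, hk⟩ : ∃ k, edist (y : X) (ω' k) ≤ t := by
    by_cases hy : (y : X) ∈ Z
    · obtain ⟨c, hc, hyc⟩ := hC_cover hy
      exact ⟨Sum.inr ⟨c, hc⟩, hyc⟩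
    · obtain ⟨j, hj⟩ : ∃ j, edist (y : X) (ω j) ≤ t := by simpa [Z] using hy
      exact ⟨Sum.inl j, hj⟩
  exact (ENNReal.inv_le_inv.2 hk).trans (le_lpSum ENNReal.top_ne_zero _ k)

theorem rpow_sub_mul_le_sum_edist_rpow_neg {X : Type*} [PseudoMetricSpace X] {ι : Type*}
    [Fintype ι] {ω : ι → X} {z : X} {t : ℝ≥0} (ht : 0 < t) (hz : ∀ j, t ≤ nndist z (ω j))
    {m s : ℝ} (hms : m ≤ s) {v : ℝ≥0∞} (hv : v ≤ ∑ j, edist z (ω j) ^ (-s)) :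
    (t : ℝ≥0∞) ^ (s - m) * v ≤ ∑ j, edist z (ω j) ^ (-m) := by
  refine (mul_le_mul_right hv _).trans ?_
  rw [Finset.mul_sum]
  gcongr with j
  have ht' : (t : ℝ≥0∞) ≤ edist z (ω j) := by
    simpa only [edist_nndist, ENNReal.coe_le_coe] using hz j
  have hpos : edist z (ω j) ≠ 0 := (lt_of_lt_of_le (by exact_mod_cast ht) ht').ne'
  calc (t : ℝ≥0∞) ^ (s - m) * edist z (ω j) ^ (-s)
      ≤ edist z (ω j) ^ (s - m) * edist z (ω j) ^ (-s) := by
        gcongr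
    _ = edist z (ω j) ^ (-m) := by
        rw [← ENNReal.rpow_add _ _ hpos (edist_ne_top _ _)]
        ring_nf

variable {F : Type*} [NormedAddCommGroup F] [NormedSpace ℝ F] [FiniteDimensional ℝ F]

theorem measure_biUnion_ball_of_isSeparated [MeasurableSpace F] [BorelSpace F] {μ : Measure F}
    [μ.IsAddHaarMeasure] {t : ℝ≥0} (ht : 0 < t) {Z : Set F} (hZ : IsSeparated t Z) :
    μ (⋃ z ∈ Z, ball z (t / 2 : ℝ)) =
      Z.encard * (ENNReal.ofReal (t / 2) ^ Module.finrank ℝ F * μ (ball 0 1)) := by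
  have hr : (0 : ℝ) < t / 2 := by positivity
  have hdisj : Z.PairwiseDisjoint fun z => ball z (t / 2 : ℝ) := fun x hx y hy hxy =>
    ball_disjoint_ball (by
      have := (hZ hx hy hxy).le
      rw [edist_nndist, ENNReal.coe_le_coe, ← NNReal.coe_le_coe, coe_nndist] at this
      linarith)
  rw [measure_biUnion (hdisj.countable_of_isOpen (fun _ _ => isOpen_ball)
    fun z _ => ⟨z, mem_ball_self hr⟩) hdisj fun _ _ => measurableSet_ball]
  simp only [Measure.addHaar_ball_of_pos _ _ hr, ENNReal.tsum_set_const, ENNReal.ofReal_pow hr.le]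

theorem two_rpow_neg_mul_le_sum_edist_rpow_neg {X : Type*} [PseudoEMetricSpace X] {ι : Type*}
    [Fintype ι] {ω : ι → X} {y z : X} (h : ∀ j, edist y z ≤ edist z (ω j)) {s : ℝ} (hs : 0 ≤ s) :
    2 ^ (-s) * ∑ j, edist z (ω j) ^ (-s) ≤ ∑ j, edist y (ω j) ^ (-s) := by
  rw [Finset.mul_sum]
  gcongr with j
  have htwo : edist y (ω j) ≤ 2 * edist z (ω j) := by
    rw [two_mul]
    exact (edist_triangle y z (ω j)).trans (by gcongr; exact h j)
  rw [ENNReal.rpow_neg, ENNReal.rpow_neg, ENNReal.rpow_neg,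
    ← ENNReal.mul_inv (by simp [hs]) (by simp [hs]), ← ENNReal.mul_rpow_of_nonneg _ _ hs]
  gcongr

theorem div_four_rpow_eq {s : ℝ} (hs : 0 ≤ s) {t : ℝ≥0} (ht : 0 < t) (n : ℕ) :
    (t / 4 : ℝ≥0∞) ^ s = ENNReal.ofReal (t / 2) ^ (s - n) * ENNReal.ofReal (t / 2) ^ n *
      2 ^ (-s) := by
  have ht₀ : ENNReal.ofReal (t / 2) ≠ 0 := (ENNReal.ofReal_pos.2 (by positivity)).ne'
  rw [← ENNReal.rpow_natCast, ← ENNReal.rpow_add _ _ ht₀ ENNReal.ofReal_ne_top, sub_add_cancel,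
    ENNReal.ofReal_div_of_pos two_pos, ENNReal.ofReal_coe_nnreal, ENNReal.ofReal_ofNat,
    ENNReal.rpow_neg, ← ENNReal.inv_rpow, ← ENNReal.mul_rpow_of_nonneg _ _ hs,
    div_eq_mul_inv, div_eq_mul_inv, mul_assoc, ← ENNReal.mul_inv (by simp) (by simp)]
  norm_num

/-- On the ball of radius `t / 2` around a point of `Z` the Riesz sum is still at least
`v / 2 ^ s`, and these balls are disjoint. -/
theorem encard_mul_le_of_le_sum_edist_rpow_neg [MeasurableSpace F] [BorelSpace F] {μ : Measure F}
    [μ.IsAddHaarMeasure] {ι : Type*} [Fintype ι] {ω : ι → F} {t : ℝ≥0} (ht : 0 < t) {s : ℝ}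
    (hs : 0 ≤ s) {Z : Set F} (hZ : IsSeparated t Z) (hZω : ∀ z ∈ Z, ∀ j, t ≤ nndist z (ω j))
    {v : ℝ≥0∞} (hv : ∀ z ∈ Z, v ≤ ∑ j, edist z (ω j) ^ (-s)) :
    (t / 4 : ℝ≥0∞) ^ s * v * (Z.encard * μ (ball 0 1)) ≤
      Fintype.card ι * ∫⁻ y in (ball 0 1)ᶜ, ‖y‖ₑ ^ (-s) ∂μ := by
  set I := ∫⁻ y in (ball (0 : F) 1)ᶜ, ‖y‖ₑ ^ (-s) ∂μ
  have hr : (0 : ℝ) < t / 2 := by positivity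
  have key := mul_measure_le_of_le_sum_edist_rpow_neg (μ := μ) (v := 2 ^ (-s) * v)
    (Y := ⋃ z ∈ Z, ball z (t / 2 : ℝ)) (ω := ω) hr hs
    (fun y hy j => by
      obtain ⟨z, hz, hyz⟩ := Set.mem_iUnion₂.1 hy
      have hzj : (t : ℝ) ≤ dist z (ω j) := hZω z hz j
      linarith [dist_triangle_left z (ω j) y, mem_ball.1 hyz])
    (fun y hy => by
      obtain ⟨z, hz, hyz⟩ := Set.mem_iUnion₂.1 hy
      refine le_trans (by gcongr; exact hv z hz)
        (two_rpow_neg_mul_le_sum_edist_rpow_neg (y := y) (fun j => ?_) hs)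
      have hzj : (t : ℝ) ≤ dist z (ω j) := hZω z hz j
      rw [edist_dist, edist_dist]
      exact ENNReal.ofReal_le_ofReal (by linarith [mem_ball.1 hyz, t.2]))
  have hr₀ : ENNReal.ofReal (t / 2) ≠ 0 := (ENNReal.ofReal_pos.2 hr).ne'
  rw [measure_biUnion_ball_of_isSeparated ht hZ] at key
  calc (t / 4 : ℝ≥0∞) ^ s * v * (Z.encard * μ (ball 0 1))
      = ENNReal.ofReal (t / 2) ^ (s - Module.finrank ℝ F) * (2 ^ (-s) * v *
          (Z.encard * (ENNReal.ofReal (t / 2) ^ Module.finrank ℝ F * μ (ball 0 1)))) := by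
        rw [div_four_rpow_eq hs ht (Module.finrank ℝ F)]
        ring
    _ ≤ ENNReal.ofReal (t / 2) ^ (s - Module.finrank ℝ F) *
          (Fintype.card ι * (ENNReal.ofReal (t / 2) ^ ((Module.finrank ℝ F : ℝ) - s) * I)) := by
        gcongr
    _ = Fintype.card ι * I := by
        rw [mul_left_comm, ← mul_assoc (ENNReal.ofReal _ ^ _),
          ← ENNReal.rpow_add _ _ hr₀ ENNReal.ofReal_ne_top, sub_add_sub_cancel, sub_self,
          ENNReal.rpow_zero, one_mul]

/-- On `Z` the exponent `s` may be traded for the fixed exponent `d + 1`, where `d` is the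
dimension; this gains a factor `(q / v) ^ (s - (d + 1))`. -/
theorem exists_packingNumber_le_of_rpow_le_sum : ∃ K : ℝ≥0, ∀ {ι : Type} [Fintype ι] (ω : ι → F)
    {s : ℝ} {q v : ℝ≥0} {Z : Set F}, Module.finrank ℝ F + 1 ≤ s → 0 < q → 0 < v →
    (∀ z ∈ Z, ∀ j, q / v ≤ nndist z (ω j)) →
    (∀ z ∈ Z, (v : ℝ≥0∞) ^ s ≤ ∑ j, edist z (ω j) ^ (-s)) →
    packingNumber (q / v) Z ≤ ⌊Fintype.card ι * K * q ^ (-s)⌋₊ := by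
  borelize F
  let μ : Measure F := Measure.addHaar
  set m : ℝ := Module.finrank ℝ F + 1
  obtain ⟨I, hI⟩ : ∃ I : ℝ≥0, I = ∫⁻ y in (ball (0 : F) 1)ᶜ, ‖y‖ₑ ^ (-m) ∂μ :=
    WithTop.ne_top_iff_exists.1 (setLIntegral_compl_ball_enorm_rpow_neg_lt_top (lt_add_one _)).ne
  obtain ⟨b, hb⟩ : ∃ b : ℝ≥0, b = μ (ball 0 1) :=
    WithTop.ne_top_iff_exists.1 measure_ball_lt_top.ne
  have hb₀ : b ≠ 0 := by
    rw [← ENNReal.coe_ne_zero, hb]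
    exact (measure_ball_pos μ 0 one_pos).ne'
  refine ⟨4 ^ m * I / b, fun {ι _} ω {s q v Z} hs hq hv hZ hZv => ?_⟩
  have ht : 0 < q / v := div_pos hq hv
  refine iSup_le fun C => iSup₂_le fun hCZ hC => ?_
  have hcard := encard_mul_le_of_le_sum_edist_rpow_neg (μ := μ) ht (by positivity) hC
    (fun z hz => hZ z (hCZ hz))
    fun z hz => rpow_sub_mul_le_sum_edist_rpow_neg ht (hZ z (hCZ hz)) hs (hZv z (hCZ hz))
  have hscale : (q / v / 4) ^ m * ((q / v) ^ (s - m) * v ^ s) = q ^ s / 4 ^ m := by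
    rw [NNReal.div_rpow _ 4, div_mul_eq_mul_div, ← mul_assoc, ← NNReal.rpow_add ht.ne',
      add_sub_cancel, ← NNReal.mul_rpow, div_mul_cancel₀ _ hv.ne']
  have hscale' : ((q / v : ℝ≥0) / 4 : ℝ≥0∞) ^ m * ((q / v : ℝ≥0) ^ (s - m) * v ^ s) =
      (q ^ s / 4 ^ m : ℝ≥0) := by
    rw [← ENNReal.coe_ofNat, ← ENNReal.coe_div (by positivity),
      ← ENNReal.coe_rpow_of_ne_zero (by positivity), ← ENNReal.coe_rpow_of_ne_zero ht.ne',
      ← ENNReal.coe_rpow_of_ne_zero hv.ne', ← ENNReal.coe_mul, ← ENNReal.coe_mul, hscale]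
  rw [hscale', ← hI, ← hb, mul_left_comm, ← ENNReal.coe_mul,
    ← ENNReal.le_div_iff_mul_le (Or.inl (by positivity)) (Or.inl ENNReal.coe_ne_top),
    ← ENNReal.coe_natCast, ← ENNReal.coe_mul, ← ENNReal.coe_div (by positivity)] at hcard
  lift C.encard to ℕ using (by rintro h; simp [h] at hcard) with k hk
  rw [ENat.toENNReal_coe, ← ENNReal.coe_natCast, ENNReal.coe_le_coe] at hcard
  refine Nat.cast_le.2 (Nat.le_floor (hcard.trans_eq ?_))
  rw [NNReal.rpow_neg]
  field_simp

theorem exists_lpPolarization_le_mul_lpPolarization_top : ∃ K : ℝ≥0, ∀ {A : Set F}, A.Nonempty →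
    ∀ (N : ℕ) {s : ℝ} {q : ℝ≥0}, Module.finrank ℝ F + 1 ≤ s → 0 < q →
    lpPolarization (ENNReal.ofReal s) A N ≤
      q * lpPolarization ∞ A (N + ⌊N * K * q ^ (-s)⌋₊) := by
  obtain ⟨K, hK⟩ := exists_packingNumber_le_of_rpow_le_sum (F := F)
  refine ⟨K, fun {A} hA N {s q} hs hq => ENNReal.le_of_forall_nnreal_lt fun v hv => ?_⟩
  rcases eq_or_ne v 0 with rfl | hv₀
  · exact zero_le
  have hs₀ : 0 < s := lt_of_lt_of_le (by positivity) hs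
  obtain ⟨ω, hω⟩ := exists_config_of_lt_lpPolarization hv
  have hpack := hK (fun j => (ω j : F)) (Z := {y ∈ A | ∀ j, (q / v : ℝ≥0) < edist y (ω j : F)})
    hs hq (pos_iff_ne_zero.2 hv₀)
    (fun z hz j => by simpa only [edist_nndist, ENNReal.coe_le_coe] using (hz.2 j).le)
    fun z hz => by
      have h := hω z hz.1
      rw [lpSum_of_ne_top ENNReal.ofReal_ne_top, ENNReal.toReal_ofReal hs₀.le,
        ENNReal.le_rpow_inv_iff hs₀, tsum_fintype] at h
      simpa only [ENNReal.inv_rpow, ← ENNReal.rpow_neg] using h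
  rw [Fintype.card_fin] at hpack
  have hcover := inv_le_lpPolarization_top_add hA ω hpack
  calc (v : ℝ≥0∞) = q * (q / v : ℝ≥0)⁻¹ := by
        rw [← ENNReal.coe_mul, inv_div, mul_div_cancel₀ _ hq.ne']
    _ ≤ _ := by
        rw [ENNReal.coe_inv (by positivity)]
        gcongr

theorem exists_cubeConst_ofReal_le {d : ℕ} (hd : d ≠ 0) : ∃ K : ℝ≥0, ∀ {s : ℝ} {q : ℝ≥0},
    (d : ℝ) + 1 ≤ s → 0 < q → cubeConst (ENNReal.ofReal s) d ≤
      q * cubeConst ∞ d * ((1 + K * q ^ (-s) : ℝ≥0) : ℝ≥0∞) ^ (1 / (d : ℝ)) := by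
  obtain ⟨K, hK⟩ := exists_lpPolarization_le_mul_lpPolarization_top (F := E d)
  rw [finrank_euclideanSpace_fin] at hK
  refine ⟨K, fun {s q} hs hq => ?_⟩
  have hs₀ : ENNReal.ofReal s ≠ 0 := (ENNReal.ofReal_pos.2 (lt_of_lt_of_le (by positivity) hs)).ne'
  refine le_of_tendsto' (tendsto_lpPolarization_unitCube hd hs₀) fun N => ?_
  have hN : ((N + ⌊N * K * q ^ (-s)⌋₊ : ℕ) : ℝ≥0∞) ≤ (1 + K * q ^ (-s) : ℝ≥0) * N := by
    have := Nat.floor_le (zero_le (a := N * K * q ^ (-s)))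
    rw [← ENNReal.coe_natCast, ← ENNReal.coe_natCast, ← ENNReal.coe_mul, ENNReal.coe_le_coe]
    calc ((N + ⌊N * K * q ^ (-s)⌋₊ : ℕ) : ℝ≥0) ≤ N + N * K * q ^ (-s) := by
          push_cast
          gcongr
      _ = _ := by ring
  refine ENNReal.div_le_of_le_mul ?_
  calc lpPolarization (ENNReal.ofReal s) (unitCube d) N
      ≤ q * lpPolarization ∞ (unitCube d) (N + ⌊N * K * q ^ (-s)⌋₊) :=
        hK (unitCube_nonempty d) N hs hq
    _ ≤ q * (cubeConst ∞ d * ((1 + K * q ^ (-s) : ℝ≥0) * N) ^ (1 / (d : ℝ))) := by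
        gcongr
        exact (lpPolarization_unitCube_le hd ENNReal.top_ne_zero _).trans (by gcongr)
    _ = _ := by
        rw [ENNReal.mul_rpow_of_nonneg _ _ (by positivity)]
        ring

theorem tendsto_cubeConst_ofReal {d : ℕ} (hd : d ≠ 0) :
    Tendsto (fun s : ℝ => cubeConst (ENNReal.ofReal s) d) atTop (𝓝 (cubeConst ∞ d)) := by
  have hc_top : cubeConst ∞ d ≠ ∞ := (cubeConst_lt_top hd (ENNReal.natCast_lt_top d)).ne
  obtain ⟨K, hK⟩ := exists_cubeConst_ofReal_le hd
  refine tendsto_order.2 ⟨fun a ha => ?_, fun a ha => ?_⟩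
  · filter_upwards [eventually_gt_atTop 0] with s hs
    exact ha.trans_le (cubeConst_top_le (ENNReal.ofReal_pos.2 hs).ne' d)
  · have hq_lim : Tendsto (fun q : ℝ≥0 => (q : ℝ≥0∞) * cubeConst ∞ d) (𝓝[>] 1)
        (𝓝 (cubeConst ∞ d)) := by
      have h := ENNReal.Tendsto.mul_const (b := cubeConst ∞ d)
        (ENNReal.continuous_coe.tendsto 1) (Or.inr hc_top)
      rw [ENNReal.coe_one, one_mul] at h
      exact h.mono_left nhdsWithin_le_nhds
    obtain ⟨q, hqa, hq⟩ :=
      ((hq_lim.eventually (gt_mem_nhds ha)).and self_mem_nhdsWithin).exists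
    have hpow_lim : Tendsto (fun s : ℝ => q ^ (-s)) atTop (𝓝 0) := by
      rw [← NNReal.tendsto_coe]
      exact (tendsto_rpow_atBot_of_base_gt_one q hq).comp tendsto_neg_atTop_atBot
    have hlim : Tendsto (fun s : ℝ => q * cubeConst ∞ d *
        ((1 + K * q ^ (-s) : ℝ≥0) : ℝ≥0∞) ^ (1 / (d : ℝ))) atTop (𝓝 (q * cubeConst ∞ d)) := by
      have h := ENNReal.Tendsto.const_mul (a := q * cubeConst ∞ d)
        (((ENNReal.continuous_coe.tendsto _).comp
          ((hpow_lim.const_mul K).const_add 1)).ennrpow_const (1 / (d : ℝ)))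
        (Or.inr (ENNReal.mul_ne_top ENNReal.coe_ne_top hc_top))
      simpa using h
    filter_upwards [hlim.eventually (gt_mem_nhds hqa), eventually_ge_atTop ((d : ℝ) + 1)]
      with s hs_lt hs
    exact (hK hs (zero_lt_one.trans hq)).trans_lt hs_lt

end LargeExponent

section Cube

variable {d : ℕ} {R a : ℝ}

theorem cube_eq_preimage (d : ℕ) (R : ℝ) :
    cube d R = WithLp.ofLp ⁻¹' (Set.univ.pi fun _ : Fin d => Set.Icc (-R) R) := by
  ext; simp [cube, -Set.pi_univ_Icc]

theorem measurableSet_cube (d : ℕ) (R : ℝ) : MeasurableSet (cube d R) := by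
  rw [cube_eq_preimage]
  exact (WithLp.measurable_ofLp 2 _) (MeasurableSet.univ_pi fun _ => measurableSet_Icc)

theorem volume_cube (d : ℕ) (R : ℝ) : volume (cube d R) = ENNReal.ofReal (2 * R) ^ d := by
  rw [cube_eq_preimage, (PiLp.volume_preserving_ofLp (Fin d)).measure_preimage
    (MeasurableSet.univ_pi fun _ => measurableSet_Icc).nullMeasurableSet, volume_pi_pi]
  simp [Real.volume_Icc, two_mul]

theorem mem_cube_add_of_dist_le {x y : E d} (hy : y ∈ cube d R) (h : dist x y ≤ a) :
    x ∈ cube d (R + a) := by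
  intro i
  have hi : |x i - y i| ≤ a := by
    rw [dist_eq_norm] at h
    exact (PiLp.norm_apply_le (x - y) i).trans h
  rw [abs_le] at hi
  exact ⟨by linarith [(hy i).1], by linarith [(hy i).2]⟩

theorem tendsto_volume_cube_add_div (d : ℕ) (a : ℝ) :
    Tendsto (fun R : ℝ => volume (cube d (R + a)) / ENNReal.ofReal ((2 * R) ^ d)) atTop
      (𝓝 1) := by
  have hratio : Tendsto (fun R : ℝ => (1 + a / R) ^ d) atTop (𝓝 1) := by
    simpa using ((tendsto_id.const_div_atTop a).const_add 1).pow d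
  have h := ENNReal.tendsto_ofReal hratio
  rw [ENNReal.ofReal_one] at h
  refine h.congr' ?_
  filter_upwards [eventually_gt_atTop 0, eventually_ge_atTop (-a)] with R hR hRa
  have hRa' : 0 ≤ 2 * (R + a) := by linarith
  rw [volume_cube, ← ENNReal.ofReal_pow hRa', ← ENNReal.ofReal_div_of_pos (by positivity),
    ← div_pow]
  congr 2
  field_simp

theorem volume_closedBall_inter_cube_le {x y : E d} (h : dist x y ≤ a) (R : ℝ) :
    volume (closedBall x 1 ∩ cube d R) ≤ volume (closedBall y 1 ∩ cube d (R + a)) := by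
  rw [← measure_preimage_add_right volume (y - x) (closedBall y 1 ∩ cube d (R + a))]
  refine measure_mono fun z hz => ⟨?_, mem_cube_add_of_dist_le hz.2 ?_⟩
  · have hzx := hz.1
    rw [mem_closedBall, dist_eq_norm] at hzx ⊢
    rwa [show z + (y - x) - y = z - x by abel]
  · rwa [dist_self_add_left, ← dist_eq_norm, dist_comm]

theorem lintegral_volume_closedBall_inter_cube (d : ℕ) (R : ℝ) :
    ∫⁻ x : E d, volume (closedBall x 1 ∩ cube d R) =
      volume (closedBall (0 : E d) 1) * volume (cube d R) := by
  set S : Set (E d × E d) := {p | p.2 ∈ closedBall p.1 1 ∩ cube d R}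
  have hS : MeasurableSet S :=
    ((isClosed_le (continuous_snd.dist continuous_fst) continuous_const).measurableSet).inter
      (measurable_snd (measurableSet_cube d R))
  have hslice : ∀ y : E d, volume ((fun x => (x, y)) ⁻¹' S) =
      (cube d R).indicator (fun _ => volume (closedBall (0 : E d) 1)) y := by
    intro y
    by_cases hy : y ∈ cube d R
    · rw [Set.indicator_of_mem hy, ← Measure.addHaar_closedBall_center volume y 1]
      congr 1
      ext x
      simp [S, hy, dist_comm]
    · simp [S, hy]
  calc ∫⁻ x : E d, volume (closedBall x 1 ∩ cube d R) = (volume.prod volume) S :=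
        (Measure.prod_apply hS).symm
    _ = ∫⁻ y, volume ((fun x => (x, y)) ⁻¹' S) := Measure.prod_apply_symm hS
    _ = _ := by
        simp only [hslice]
        rw [lintegral_indicator_const (measurableSet_cube d R)]

end Cube

section PeriodicCovering

variable {d : ℕ} {r : ℝ}

theorem dist_le_of_mem_cell (hr : 0 < r) {k : Fin d → ℤ} {x y : E d} (hx : x ∈ cell r k)
    (hy : y ∈ cell r k) : dist x y ≤ r * √d := by
  obtain ⟨u, hu, rfl⟩ := cell_subset_image hr k hx
  obtain ⟨v, hv, rfl⟩ := cell_subset_image hr k hy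
  rw [dist_cellMap hr.le]
  gcongr
  exact dist_le_sqrt_of_mem_unitCube hu hv

theorem lintegral_eq_tsum_cell (hr : 0 < r) (f : E d → ℝ≥0∞) :
    ∫⁻ x, f x = ∑' k, ∫⁻ x in cell r k, f x := by
  rw [← lintegral_iUnion (measurableSet_cell hr) (pairwise_disjoint_cell d r),
    Set.iUnion_eq_univ_iff.2 (exists_mem_cell r), setLIntegral_univ]

theorem tsum_volume_closedBall_inter_cube_le (hr : 0 < r) {x : (Fin d → ℤ) → E d}
    (hx : ∀ k, x k ∈ cell r k) (R : ℝ) :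
    ENNReal.ofReal r ^ d * ∑' k, volume (closedBall (x k) 1 ∩ cube d R) ≤
      volume (closedBall (0 : E d) 1) * volume (cube d (R + r * √d)) := by
  rw [← lintegral_volume_closedBall_inter_cube, lintegral_eq_tsum_cell hr, ← ENNReal.tsum_mul_left]
  refine ENNReal.tsum_le_tsum fun k => ?_
  rw [mul_comm (ENNReal.ofReal r ^ d), ← volume_cell hr k, ← setLIntegral_const]
  exact setLIntegral_mono' (measurableSet_cell hr k) fun y hy =>
    volume_closedBall_inter_cube_le (dist_le_of_mem_cell hr (hx k) hy) R

theorem le_tsum_volume_closedBall_inter_cube (hr : 0 < r) {x : (Fin d → ℤ) → E d}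
    (hx : ∀ k, x k ∈ cell r k) (R : ℝ) :
    volume (closedBall (0 : E d) 1) * volume (cube d (R - r * √d)) ≤
      ENNReal.ofReal r ^ d * ∑' k, volume (closedBall (x k) 1 ∩ cube d R) := by
  rw [← lintegral_volume_closedBall_inter_cube, lintegral_eq_tsum_cell hr, ← ENNReal.tsum_mul_left]
  refine ENNReal.tsum_le_tsum fun k => ?_
  rw [mul_comm (ENNReal.ofReal r ^ d), ← volume_cell hr k, ← setLIntegral_const]
  refine setLIntegral_mono' (measurableSet_cell hr k) fun y hy => ?_
  simpa using volume_closedBall_inter_cube_le (dist_le_of_mem_cell hr hy (hx k)) (R - r * √d)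

theorem hasBallDensity_range (hr : 0 < r) {ι : Type*} [Fintype ι] {x : ι × (Fin d → ℤ) → E d}
    (hinj : x.Injective) (hx : ∀ p, x p ∈ cell r p.2) :
    HasBallDensity (Set.range x)
      (Fintype.card ι * (volume (closedBall (0 : E d) 1) / ENNReal.ofReal r ^ d)) := by
  set V := volume (closedBall (0 : E d) 1)
  have hr₀ : ENNReal.ofReal r ^ d ≠ 0 := pow_ne_zero d (by simpa)
  have hr_top : ENNReal.ofReal r ^ d ≠ ∞ := ENNReal.pow_ne_top ENNReal.ofReal_ne_top
  have hsum : ∀ R, ∑' y : Set.range x, volume (closedBall (y : E d) 1 ∩ cube d R) =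
      ∑ i, ∑' k, volume (closedBall (x (i, k)) 1 ∩ cube d R) := fun R => by
    rw [tsum_range (fun y : E d => volume (closedBall y 1 ∩ cube d R)) hinj, ENNReal.tsum_prod',
      tsum_fintype]
  have hlim : ∀ a : ℝ, Tendsto (fun R : ℝ => Fintype.card ι * (V / ENNReal.ofReal r ^ d) *
      (volume (cube d (R + a)) / ENNReal.ofReal ((2 * R) ^ d))) atTop
      (𝓝 (Fintype.card ι * (V / ENNReal.ofReal r ^ d))) := fun a => by
    simpa using ENNReal.Tendsto.const_mul (tendsto_volume_cube_add_div d a)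
      (Or.inl one_ne_zero)
  have hcard : ∀ v : ℝ≥0∞, Fintype.card ι * (V / ENNReal.ofReal r ^ d) * v =
      ∑ _ : ι, V * v / ENNReal.ofReal r ^ d := fun v => by
    rw [Finset.sum_const, Finset.card_univ, nsmul_eq_mul, mul_assoc, ENNReal.mul_div_right_comm]
  refine tendsto_of_tendsto_of_tendsto_of_le_of_le (hlim (-(r * √d))) (hlim (r * √d))
    (fun R => ?_) (fun R => ?_)
  all_goals
    simp only [hsum]
    rw [← mul_div_assoc, hcard]
    refine ENNReal.div_le_div_right (Finset.sum_le_sum fun i _ => ?_) _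
  · rw [ENNReal.div_le_iff hr₀ hr_top, mul_comm _ (ENNReal.ofReal r ^ d), ← sub_eq_add_neg]
    exact le_tsum_volume_closedBall_inter_cube hr (fun k => hx (i, k)) R
  · rw [ENNReal.le_div_iff_mul_le (Or.inl hr₀) (Or.inl hr_top), mul_comm]
    exact tsum_volume_closedBall_inter_cube_le hr (fun k => hx (i, k)) R

/-- The representative in `[0,1)^d` of a point of `ℝ^d` modulo `ℤ^d`. -/
noncomputable def fractVec (u : E d) : E d := WithLp.toLp 2 fun i => Int.fract (u i)

theorem fractVec_mem_unitCube (u : E d) : fractVec u ∈ unitCube d := fun _ =>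
  ⟨Int.fract_nonneg _, (Int.fract_lt_one _).le⟩

theorem cellMap_fractVec (r : ℝ) (k : Fin d → ℤ) (u : E d) :
    cellMap r (fun i => k i + ⌊u i⌋) (fractVec u) = cellMap r k u := by
  ext i
  simp [cellMap_apply, fractVec, add_assoc, Int.floor_add_fract]

theorem cellMap_fractVec_mem_cell (hr : 0 < r) (k : Fin d → ℤ) (u : E d) :
    cellMap r k (fractVec u) ∈ cell r k := fun i => by
  rw [cellMap_apply, mul_div_cancel_left₀ _ hr.ne', Int.floor_intCast_add]
  simp [fractVec]

theorem exists_eq_cellMap_fractVec (hr : 0 < r) (y : E d) :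
    ∃ k : Fin d → ℤ, ∃ u, y = cellMap r k (fractVec u) := by
  refine ⟨fun i => 0 + ⌊(r⁻¹ • y) i⌋, r⁻¹ • y, ?_⟩
  rw [cellMap_fractVec]
  ext i
  simp [cellMap_apply, mul_inv_cancel_left₀ hr.ne']

theorem exists_hasBallDensity_of_dist_le (hr : 0 < r) {N : ℕ} (ω : Fin N → E d)
    (hω : ∀ y ∈ unitCube d, ∃ j, r * dist y (ω j) ≤ 1) :
    ∃ (C : Set (E d)) (m : ℕ), m ≤ N ∧ (⋃ x ∈ C, closedBall x 1) = Set.univ ∧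
      HasBallDensity C (m * (volume (closedBall (0 : E d) 1) / ENNReal.ofReal r ^ d)) := by
  classical
  -- Distinct points of the configuration may agree modulo `ℤ^d`, so their classes are collected in
  -- a set, which makes the translates pairwise distinct.
  let F : Finset (E d) := Finset.univ.image fun j => fractVec (ω j)
  let x : F × (Fin d → ℤ) → E d := fun p => cellMap r p.2 p.1
  have hx : ∀ p, x p ∈ cell r p.2 := by
    rintro ⟨⟨f, hf⟩, k⟩
    obtain ⟨j, -, rfl⟩ := Finset.mem_image.1 hf
    exact cellMap_fractVec_mem_cell hr k (ω j)
  have hinj : x.Injective := by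
    rintro ⟨f, k⟩ ⟨g, l⟩ h
    obtain rfl : k = l := by
      by_contra hkl
      exact (pairwise_disjoint_cell d r hkl).ne_of_mem (hx (f, k)) (hx (g, l)) h
    have hfg : r * dist (f : E d) g = 0 := by
      rw [← dist_cellMap hr.le k]; exact dist_eq_zero.2 h
    rw [Subtype.ext (dist_eq_zero.1 ((mul_eq_zero.1 hfg).resolve_left hr.ne'))]
  refine ⟨Set.range x, Fintype.card F, ?_, ?_, hasBallDensity_range hr hinj hx⟩
  · rw [Fintype.card_coe]
    exact Finset.card_image_le.trans (by simp)
  · refine Set.eq_univ_of_forall fun y => ?_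
    obtain ⟨k, u, rfl⟩ := exists_eq_cellMap_fractVec hr y
    obtain ⟨j, hj⟩ := hω _ (fractVec_mem_unitCube u)
    refine Set.mem_iUnion₂.2 ⟨_, ⟨(⟨fractVec (ω j), Finset.mem_image_of_mem _ (Finset.mem_univ j)⟩,
      fun i => k i + ⌊ω j i⌋), rfl⟩, ?_⟩
    change dist _ (cellMap r _ (fractVec (ω j))) ≤ 1
    rwa [cellMap_fractVec, dist_cellMap hr.le]

end PeriodicCovering

section CoveringDensity

variable {d : ℕ}

/-- `δ` is the density of some family of closed unit balls covering `ℝ^d`. The covering density is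
the infimum of these numbers. -/
def IsCoveringDensity (d : ℕ) (δ : ℝ≥0∞) : Prop :=
  ∃ C : Set (E d), (⋃ x ∈ C, closedBall x 1) = Set.univ ∧ HasBallDensity C δ

theorem inv_le_lpPolarization_top_of_edist_le {F : Type*} [NormedAddCommGroup F]
    [InnerProductSpace ℝ F] {K : Set F} (hK : IsComplete K) (hne : K.Nonempty)
    (hconv : Convex ℝ K) {ι : Type*} [Fintype ι] {x : ι → F} {t : ℝ}
    (hx : ∀ y ∈ K, ∃ i, dist y (x i) ≤ t) :
    (ENNReal.ofReal t)⁻¹ ≤ lpPolarization ∞ K (Fintype.card ι) := by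
  choose x' hx'K hx' using fun i => exists_forall_dist_le_of_convex hK hne hconv (x i)
  refine le_trans (le_iInf fun y => ?_) (le_lpPolarization hne le_rfl fun i => ⟨x' i, hx'K i⟩)
  obtain ⟨i, hi⟩ := hx y y.2
  refine le_trans (ENNReal.inv_le_inv.2 ?_) (le_lpSum ENNReal.top_ne_zero _ i)
  rw [edist_dist]
  exact ENNReal.ofReal_le_ofReal ((hx' i y y.2).trans hi)

/-- The similarity `x ↦ (2R)⁻¹(x + q)` maps `[-R,R]^d` onto the unit cube. -/
theorem exists_mem_inter_cube_dist_smul_add_le {C : Set (E d)}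
    (hC : (⋃ x ∈ C, closedBall x 1) = Set.univ) {R : ℝ} (hR : 0 < R) {q : E d} (hq : ∀ i, q i = R)
    {u : E d} (hu : u ∈ unitCube d) :
    ∃ x ∈ C ∩ cube d (R + 1), dist u ((2 * R)⁻¹ • (x + q)) ≤ (2 * R)⁻¹ := by
  have hmem : (2 * R) • u - q ∈ cube d R := fun i => by
    have := hu i
    simp only [PiLp.sub_apply, PiLp.smul_apply, smul_eq_mul, hq]
    constructor <;> nlinarith [this.1, this.2]
  obtain ⟨x, hxC, hx⟩ := Set.mem_iUnion₂.1 (hC.ge (Set.mem_univ ((2 * R) • u - q)))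
  refine ⟨x, ⟨hxC, mem_cube_add_of_dist_le hmem (mem_closedBall'.1 hx)⟩, ?_⟩
  calc dist u ((2 * R)⁻¹ • (x + q))
      = dist ((2 * R)⁻¹ • ((2 * R) • u - q + q)) ((2 * R)⁻¹ • (x + q)) := by
        rw [sub_add_cancel, inv_smul_smul₀ (by positivity)]
    _ = (2 * R)⁻¹ * dist ((2 * R) • u - q) x := by
        rw [dist_smul₀, dist_add_right, Real.norm_of_nonneg (by positivity)]
    _ ≤ (2 * R)⁻¹ := mul_le_of_le_one_right (by positivity) hx

theorem ofReal_two_mul_le_cubeConst_mul_encard (hd : d ≠ 0) {C : Set (E d)}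
    (hC : (⋃ x ∈ C, closedBall x 1) = Set.univ) {R : ℝ} (hR : 0 < R) :
    ENNReal.ofReal (2 * R) ≤
      cubeConst ∞ d * ((C ∩ cube d (R + 1)).encard : ℝ≥0∞) ^ (1 / (d : ℝ)) := by
  by_cases hfin : (C ∩ cube d (R + 1)).Finite
  swap
  · rw [Set.not_finite.1 hfin |>.encard_eq, ENat.toENNReal_top, ENNReal.top_rpow_of_pos
      (by positivity), ENNReal.mul_top (cubeConst_pos ENNReal.top_ne_zero d).ne']
    exact le_top
  have := hfin.fintype
  let q : E d := WithLp.toLp 2 fun _ => R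
  have hcover : ∀ u ∈ unitCube d, ∃ x : ↥(C ∩ cube d (R + 1)),
      dist u ((2 * R)⁻¹ • ((x : E d) + q)) ≤ (2 * R)⁻¹ := fun u hu => by
    simpa using exists_mem_inter_cube_dist_smul_add_le hC hR (q := q) (fun _ => rfl) hu
  have h := inv_le_lpPolarization_top_of_edist_le (isCompact_unitCube d).isComplete
    (unitCube_nonempty d) (convex_unitCube d) hcover
  rw [ENNReal.ofReal_inv_of_pos (by positivity), inv_inv, ← Nat.card_eq_fintype_card,
    Nat.card_coe_set_eq] at h
  rw [← hfin.cast_ncard_eq, ENat.toENNReal_coe]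
  exact h.trans (lpPolarization_unitCube_le hd ENNReal.top_ne_zero _)

theorem mul_encard_le_tsum_volume_closedBall_inter_cube (C : Set (E d)) (R : ℝ) :
    volume (closedBall (0 : E d) 1) * ((C ∩ cube d (R - 1)).encard : ℝ≥0∞) ≤
      ∑' x : C, volume (closedBall (x : E d) 1 ∩ cube d R) := by
  refine le_trans ?_ (ENNReal.tsum_mono_subtype
    (fun x : E d => volume (closedBall x 1 ∩ cube d R))
    (Set.inter_subset_left (t := cube d (R - 1))))
  have hball : ∀ x : ↥(C ∩ cube d (R - 1)), volume (closedBall (x : E d) 1 ∩ cube d R) =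
      volume (closedBall (0 : E d) 1) := fun x => by
    rw [Set.inter_eq_left.2 fun z hz => ?_, ← Measure.addHaar_closedBall_center volume (x : E d) 1]
    simpa using mem_cube_add_of_dist_le x.2.2 (mem_closedBall.1 hz)
  simp only [hball, ENNReal.tsum_set_const]
  rw [mul_comm]

theorem IsCoveringDensity.le (hd : d ≠ 0) {δ : ℝ≥0∞} (h : IsCoveringDensity d δ) :
    volume (closedBall (0 : E d) 1) / cubeConst ∞ d ^ d ≤ δ := by
  obtain ⟨C, hC, hδ⟩ := h
  have hc : cubeConst ∞ d ^ d ≠ ∞ :=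
    ENNReal.pow_ne_top (cubeConst_lt_top hd (ENNReal.natCast_lt_top d)).ne
  have hc₀ : cubeConst ∞ d ^ d ≠ 0 := pow_ne_zero d (cubeConst_pos ENNReal.top_ne_zero d).ne'
  have hlim := ENNReal.Tendsto.const_mul
    (a := volume (closedBall (0 : E d) 1) / cubeConst ∞ d ^ d)
    (tendsto_volume_cube_add_div d (-2)) (Or.inl one_ne_zero)
  rw [mul_one] at hlim
  refine le_of_tendsto_of_tendsto hlim hδ ?_
  filter_upwards [eventually_gt_atTop 2] with R hR
  rw [← mul_div_assoc]
  refine ENNReal.div_le_div_right (le_trans ?_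
    (mul_encard_le_tsum_volume_closedBall_inter_cube C R)) _
  rw [ENNReal.mul_comm_div]
  gcongr
  rw [ENNReal.div_le_iff hc₀ hc, volume_cube]
  have h := ofReal_two_mul_le_cubeConst_mul_encard hd hC (R := R + -2) (by linarith)
  rw [show R + -2 + 1 = R - 1 by ring] at h
  calc ENNReal.ofReal (2 * (R + -2)) ^ d
      ≤ (cubeConst ∞ d * ((C ∩ cube d (R - 1)).encard : ℝ≥0∞) ^ (1 / (d : ℝ))) ^ d := by gcongr
    _ = _ := by
      rw [mul_pow, one_div, ENNReal.rpow_inv_natCast_pow hd, mul_comm]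

theorem exists_isCoveringDensity_le {N : ℕ} {v : ℝ≥0∞} (hv₀ : v ≠ 0)
    (hv : v < lpPolarization ∞ (unitCube d) N) :
    ∃ δ, IsCoveringDensity d δ ∧ δ ≤ N * (volume (closedBall (0 : E d) 1) / v ^ d) := by
  obtain ⟨ω, hω⟩ := exists_config_of_lt_lpPolarization hv
  have hv_top : v ≠ ∞ := hv.ne_top
  have hr : 0 < v.toReal := ENNReal.toReal_pos hv₀ hv_top
  obtain ⟨C, m, hmN, hC, hδ⟩ := exists_hasBallDensity_of_dist_le hr (fun j => (ω j : E d)) (by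
    intro y hy
    have h := hω y hy
    rw [lpSum_top] at h
    obtain hN | hN := isEmpty_or_nonempty (Fin N)
    · simp [hv₀] at h
    obtain ⟨j, hj⟩ := exists_eq_ciSup_of_finite (f := fun j => (edist y (ω j : E d))⁻¹)
    rw [← hj, ENNReal.le_inv_iff_mul_le] at h
    refine ⟨j, ?_⟩
    simpa [edist_dist] using ENNReal.toReal_mono ENNReal.one_ne_top h)
  rw [ENNReal.ofReal_toReal hv_top] at hδ
  exact ⟨_, ⟨C, hC, hδ⟩, by gcongr⟩

theorem sInf_isCoveringDensity (hd : d ≠ 0) :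
    sInf {δ | IsCoveringDensity d δ} =
      volume (closedBall (0 : E d) 1) / cubeConst ∞ d ^ d := by
  refine le_antisymm ?_ (le_sInf fun δ hδ => hδ.le hd)
  have hc := cubeConst_pos ENNReal.top_ne_zero d
  have : (𝓝[<] cubeConst ∞ d).NeBot := nhdsLT_neBot_of_exists_lt ⟨0, hc⟩
  have hlim : Tendsto (fun a : ℝ≥0∞ => volume (closedBall (0 : E d) 1) / a ^ d)
      (𝓝[<] cubeConst ∞ d) (𝓝 (volume (closedBall (0 : E d) 1) / cubeConst ∞ d ^ d)) :=
    ENNReal.Tendsto.const_div ((ENNReal.continuous_pow d).continuousWithinAt)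
      (Or.inr measure_closedBall_lt_top.ne)
  refine ge_of_tendsto hlim ?_
  filter_upwards [Ioo_mem_nhdsLT hc] with a ⟨ha₀, ha⟩
  obtain ⟨N, haN, hN⟩ := (((tendsto_lpPolarization_unitCube hd ENNReal.top_ne_zero).eventually
    (lt_mem_nhds ha)).and (eventually_ge_atTop 1)).exists
  have hN₀ : (N : ℝ≥0∞) ≠ 0 := by exact_mod_cast (Nat.one_le_iff_ne_zero.1 hN)
  have hroot₀ : (N : ℝ≥0∞) ^ (1 / (d : ℝ)) ≠ 0 := by simp [ENNReal.rpow_eq_zero_iff, hN₀]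
  obtain ⟨δ, hδ, hle⟩ := exists_isCoveringDensity_le (mul_ne_zero ha₀.ne' hroot₀)
    (ENNReal.mul_lt_of_lt_div haN)
  refine (sInf_le (s := {δ | IsCoveringDensity d δ}) hδ).trans (hle.trans_eq ?_)
  rw [mul_pow, one_div, ENNReal.rpow_inv_natCast_pow hd, mul_comm, mul_comm (a ^ d),
    ← ENNReal.mul_div_right_comm, mul_comm _ (N : ℝ≥0∞)]
  exact ENNReal.mul_div_mul_left _ _ hN₀ (ENNReal.natCast_ne_top N)

end CoveringDensity

section Asymptotics

variable {d ℓ : ℕ} {p : ℝ≥0∞} {s : ℝ} {A : Set (E ℓ)}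

/-- The limit of `lpPolarization p A N / N ^ (1 / d)` for well-tiled sets `A`. -/
noncomputable def lpPolarizationConst (p : ℝ≥0∞) (d : ℕ) (A : Set (E ℓ)) : ℝ≥0∞ :=
  cubeConst p d / μHE[d] A ^ (1 / (d : ℝ))

theorem lpPolarizationConst_unitCube (p : ℝ≥0∞) (d : ℕ) :
    lpPolarizationConst p d (unitCube d) = cubeConst p d := by
  rw [lpPolarizationConst, EuclideanSpace.euclideanHausdorffMeasure_eq_volume, volume_unitCube,
    ENNReal.one_rpow, div_one]

theorem natCast_lt_ofReal (hs : (d : ℝ) < s) : (d : ℝ≥0∞) < ENNReal.ofReal s := by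
  rw [← ENNReal.ofReal_natCast]
  exact ENNReal.ofReal_lt_ofReal_iff_of_nonneg d.cast_nonneg |>.2 hs

theorem tendsto_lpPolarizationConst (hd : d ≠ 0) (A : Set (E ℓ)) :
    Tendsto (fun s : ℝ => lpPolarizationConst (ENNReal.ofReal s) d A) atTop
      (𝓝 (lpPolarizationConst ∞ d A)) :=
  ENNReal.Tendsto.div_const (tendsto_cubeConst_ofReal hd)
    (Or.inl (cubeConst_pos ENNReal.top_ne_zero d).ne')

namespace IsWellTiled

variable (hA : IsWellTiled d A (μHE[d] A))

include hA

theorem lpPolarizationConst_pos (hp : p ≠ 0) : 0 < lpPolarizationConst p d A :=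
  ENNReal.div_pos (cubeConst_pos hp d).ne'
    (ENNReal.rpow_ne_top_of_nonneg (by positivity) hA.ne_top)

theorem lpPolarizationConst_lt_top (hd : d ≠ 0) (hdp : (d : ℝ≥0∞) < p) :
    lpPolarizationConst p d A < ∞ :=
  ENNReal.div_lt_top (cubeConst_lt_top hd hdp).ne
    (by simp [ENNReal.rpow_eq_zero_iff, hA.ne_zero, hA.ne_top])

theorem tendsto_normalizedPolarization (hd : d ≠ 0) (hs : (d : ℝ) < s) :
    Tendsto (normalizedPolarization d s A) atTop
      (𝓝 (lpPolarizationConst (ENNReal.ofReal s) d A ^ s)) := by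
  have hs₀ : 0 < s := d.cast_nonneg.trans_lt hs
  have h := (ENNReal.continuous_rpow_const (y := s)).tendsto _ |>.comp
    (hA.tendsto_lpPolarization hd (natCast_lt_ofReal hs))
  refine h.congr fun N => ?_
  rw [Function.comp, normalizedPolarization, polarization_eq_rpow hs₀,
    ENNReal.div_rpow_of_nonneg _ _ hs₀.le, ← ENNReal.rpow_mul, one_div_mul_eq_div]

theorem tendsto_bestCoveringRadius (hd : d ≠ 0) :
    Tendsto (fun N : ℕ => (N : ℝ≥0∞) ^ (1 / (d : ℝ)) * bestCoveringRadius A N) atTop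
      (𝓝 (lpPolarizationConst ∞ d A)⁻¹) := by
  refine (tendsto_inv_iff.2
    (hA.tendsto_lpPolarization hd (ENNReal.natCast_lt_top d))).congr' ?_
  filter_upwards [eventually_ne_atTop 0] with N hN
  rw [bestCoveringRadius_eq_inv, ENNReal.inv_div, div_eq_mul_inv]
  · exact Or.inl (ENNReal.rpow_ne_top_of_nonneg (by positivity) (ENNReal.natCast_ne_top N))
  · exact Or.inl (by simp [ENNReal.rpow_eq_zero_iff, hN])

theorem polarizationLimit_eq (hd : d ≠ 0) (hs : (d : ℝ) < s) :
    polarizationLimit d s A = lpPolarizationConst (ENNReal.ofReal s) d A ^ s :=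
  (hA.tendsto_normalizedPolarization hd hs).limUnder_eq

theorem tendsto_polarizationLimit_rpow (hd : d ≠ 0) :
    Tendsto (fun s : ℝ => polarizationLimit d s A ^ (1 / s)) atTop
      (𝓝 (lpPolarizationConst ∞ d A)) := by
  refine (tendsto_lpPolarizationConst hd A).congr' ?_
  filter_upwards [eventually_gt_atTop (d : ℝ)] with s hs
  rw [hA.polarizationLimit_eq hd hs, one_div,
    ENNReal.rpow_rpow_inv (d.cast_nonneg.trans_lt hs).ne']

end IsWellTiled

theorem sigma_eq (hd : d ≠ 0) (hs : (d : ℝ) < s) :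
    sigma d s = (cubeConst (ENNReal.ofReal s) d ^ s).toReal := by
  rw [sigma, (isWellTiled_unitCube d).polarizationLimit_eq hd hs, lpPolarizationConst_unitCube]

theorem sigma_pos (hd : d ≠ 0) (hs : (d : ℝ) < s) : 0 < sigma d s := by
  have hdp := natCast_lt_ofReal hs
  rw [sigma_eq hd hs, ← ENNReal.toReal_rpow]
  exact Real.rpow_pos_of_pos (ENNReal.toReal_pos (cubeConst_pos (zero_le.trans_lt hdp).ne' d).ne'
    (cubeConst_lt_top hd hdp).ne) s

theorem sigma_rpow (hd : d ≠ 0) (hs : (d : ℝ) < s) :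
    sigma d s ^ (1 / s) = (cubeConst (ENNReal.ofReal s) d).toReal := by
  rw [sigma_eq hd hs, ENNReal.toReal_rpow, one_div,
    ENNReal.rpow_rpow_inv (d.cast_nonneg.trans_lt hs).ne']

theorem tendsto_sigma_rpow (hd : d ≠ 0) :
    Tendsto (fun s : ℝ => sigma d s ^ (1 / s)) atTop (𝓝 (cubeConst ∞ d).toReal) := by
  refine ((ENNReal.tendsto_toReal (cubeConst_lt_top hd (ENNReal.natCast_lt_top d)).ne).comp
    (tendsto_cubeConst_ofReal hd)).congr' ?_
  filter_upwards [eventually_gt_atTop (d : ℝ)] with s hs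
  exact (sigma_rpow hd hs).symm

theorem sigma_div_hausdorffVol_rpow (hd : d ≠ 0) (hs : (d : ℝ) < s) (A : Set (E ℓ)) :
    sigma d s / hausdorffVol d A ^ (s / d) =
      (lpPolarizationConst (ENNReal.ofReal s) d A ^ s).toReal := by
  rw [sigma_eq hd hs, hausdorffVol, lpPolarizationConst, ENNReal.div_rpow_of_nonneg _ _
    (d.cast_nonneg.trans hs.le), ← ENNReal.rpow_mul, one_div_mul_eq_div, ENNReal.toReal_div,
    ENNReal.toReal_rpow (μHE[d] A)]

theorem IsWellTiled.polarizationLimit_eq_ofReal (hA : IsWellTiled d A (μHE[d] A)) (hd : d ≠ 0)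
    (hs : (d : ℝ) < s) :
    polarizationLimit d s A = ENNReal.ofReal (sigma d s / hausdorffVol d A ^ (s / d)) := by
  rw [hA.polarizationLimit_eq hd hs, sigma_div_hausdorffVol_rpow hd hs, ENNReal.ofReal_toReal]
  exact ENNReal.rpow_ne_top_of_nonneg (d.cast_nonneg.trans hs.le)
    (hA.lpPolarizationConst_lt_top hd (natCast_lt_ofReal hs)).ne

theorem IsWellTiled.tendsto_sigma_div_rpow (hA : IsWellTiled d A (μHE[d] A)) (hd : d ≠ 0) :
    Tendsto (fun s : ℝ => (sigma d s / hausdorffVol d A ^ (s / d)) ^ (1 / s)) atTop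
      (𝓝 (lpPolarizationConst ∞ d A).toReal) := by
  have hlt := hA.lpPolarizationConst_lt_top hd (ENNReal.natCast_lt_top d)
  refine ((ENNReal.tendsto_toReal hlt.ne).comp (tendsto_lpPolarizationConst hd A)).congr' ?_
  filter_upwards [eventually_gt_atTop (d : ℝ)] with s hs
  rw [sigma_div_hausdorffVol_rpow hd hs, ENNReal.toReal_rpow, one_div,
    ENNReal.rpow_rpow_inv (d.cast_nonneg.trans_lt hs).ne', Function.comp]

theorem IsWellTiled.exists_tendsto_bestCoveringRadius (hA : IsWellTiled d A (μHE[d] A))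
    (hd : d ≠ 0) :
    ∃ c : ℝ, 0 < c ∧ 1 / c = (lpPolarizationConst ∞ d A).toReal ∧
      Tendsto (fun N : ℕ => (N : ℝ≥0∞) ^ (1 / (d : ℝ)) * bestCoveringRadius A N) atTop
        (𝓝 (ENNReal.ofReal c)) := by
  have hpos := hA.lpPolarizationConst_pos ENNReal.top_ne_zero
  have hlt := hA.lpPolarizationConst_lt_top hd (ENNReal.natCast_lt_top d)
  have hc : 0 < (lpPolarizationConst ∞ d A).toReal := ENNReal.toReal_pos hpos.ne' hlt.ne
  refine ⟨_, inv_pos.2 hc, by rw [one_div, inv_inv], ?_⟩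
  rw [ENNReal.ofReal_inv_of_pos hc, ENNReal.ofReal_toReal hlt.ne]
  exact hA.tendsto_bestCoveringRadius hd

theorem ballVolume_pos (d : ℕ) : 0 < ballVolume d := by
  rw [ballVolume, hausdorffVol, EuclideanSpace.euclideanHausdorffMeasure_eq_volume]
  exact ENNReal.toReal_pos (measure_closedBall_pos _ _ one_pos).ne' measure_closedBall_lt_top.ne

theorem cubeConst_top_toReal_pos (hd : d ≠ 0) : 0 < (cubeConst ∞ d).toReal :=
  ENNReal.toReal_pos (cubeConst_pos ENNReal.top_ne_zero d).ne'
    (cubeConst_lt_top hd (ENNReal.natCast_lt_top d)).ne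

theorem coveringDensity_eq (hd : d ≠ 0) :
    coveringDensity d = ballVolume d / (cubeConst ∞ d).toReal ^ d := by
  have h : coveringDensity d = (sInf {δ | IsCoveringDensity d δ}).toReal := rfl
  rw [h, sInf_isCoveringDensity hd, ENNReal.toReal_div, ENNReal.toReal_pow, ballVolume,
    hausdorffVol, EuclideanSpace.euclideanHausdorffMeasure_eq_volume]

theorem coveringDensity_pos (hd : d ≠ 0) : 0 < coveringDensity d := by
  rw [coveringDensity_eq hd]
  exact div_pos (ballVolume_pos d) (pow_pos (cubeConst_top_toReal_pos hd) d)

theorem cubeConst_top_toReal_eq (hd : d ≠ 0) :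
    (cubeConst ∞ d).toReal = (ballVolume d / coveringDensity d) ^ (1 / (d : ℝ)) := by
  rw [coveringDensity_eq hd, div_div_cancel₀ (ballVolume_pos d).ne', one_div,
    Real.pow_rpow_inv_natCast (cubeConst_top_toReal_pos hd).le hd]

end Asymptotics

end RieszPolarization

theorem mainTheorem2 (d : ℕ) (hd : 1 ≤ d) :
    (∀ s : ℝ, (d : ℝ) < s → 0 < sigma d s) ∧
    (∀ (ℓ : ℕ) (A : Set (E ℓ)), IsAdmissibleOrCube d ℓ A →
      (∀ s : ℝ, (d : ℝ) < s →
        Tendsto (normalizedPolarization d s A) atTop (𝓝 (polarizationLimit d s A)) ∧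
        polarizationLimit d s A = ENNReal.ofReal (sigma d s / hausdorffVol d A ^ (s / d))) ∧
      ∃ c : ℝ, 0 < c ∧
        Tendsto (fun N : ℕ => (N : ℝ≥0∞) ^ (1 / (d : ℝ)) * bestCoveringRadius A N) atTop
          (𝓝 (ENNReal.ofReal c)) ∧
        Tendsto (fun s : ℝ => (sigma d s / hausdorffVol d A ^ (s / d)) ^ (1 / s)) atTop
          (𝓝 (1 / c)) ∧
        Tendsto (fun s : ℝ => polarizationLimit d s A ^ (1 / s)) atTop
          (𝓝 (ENNReal.ofReal (1 / c)))) ∧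
    (0 < coveringDensity d ∧
      Tendsto (fun s : ℝ => sigma d s ^ (1 / s)) atTop
        (𝓝 ((ballVolume d / coveringDensity d) ^ (1 / (d : ℝ)))) ∧
      ∃ c : ℝ, 0 < c ∧
        Tendsto (fun N : ℕ => (N : ℝ≥0∞) ^ (1 / (d : ℝ)) * bestCoveringRadius (unitCube d) N) atTop
          (𝓝 (ENNReal.ofReal c)) ∧
        1 / c = (ballVolume d / coveringDensity d) ^ (1 / (d : ℝ))) := by
  have hd₀ : d ≠ 0 := Nat.one_le_iff_ne_zero.1 hd
  refine ⟨fun s hs => sigma_pos hd₀ hs, fun ℓ A hA => ?_, coveringDensity_pos hd₀,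
    cubeConst_top_toReal_eq hd₀ ▸ tendsto_sigma_rpow hd₀, ?_⟩
  · have hA' := hA.isWellTiled hd₀
    obtain ⟨c, hc_pos, hc_eq, hc⟩ := hA'.exists_tendsto_bestCoveringRadius hd₀
    refine ⟨fun s hs => ⟨?_, hA'.polarizationLimit_eq_ofReal hd₀ hs⟩, c, hc_pos, hc, ?_, ?_⟩
    · exact hA'.polarizationLimit_eq hd₀ hs ▸ hA'.tendsto_normalizedPolarization hd₀ hs
    · exact hc_eq ▸ hA'.tendsto_sigma_div_rpow hd₀
    · rw [hc_eq, ENNReal.ofReal_toReal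
        (hA'.lpPolarizationConst_lt_top hd₀ (ENNReal.natCast_lt_top d)).ne]
      exact hA'.tendsto_polarizationLimit_rpow hd₀
  · obtain ⟨c, hc_pos, hc_eq, hc⟩ := (isWellTiled_unitCube d).exists_tendsto_bestCoveringRadius hd₀
    rw [lpPolarizationConst_unitCube, cubeConst_top_toReal_eq hd₀] at hc_eq
    exact ⟨c, hc_pos, hc, hc_eq⟩
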